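/- Let $R$ be a compact (connected) Riemann surface and let $\Sigma\subset\Sigma'\subset R$ be open subsets, regarded as Riemann surfaces with the complex structure of $R$, where $\Sigma'$ is connected and $\Sigma'\neq R$, and assume that $\mathrm{cl}\,\Sigma\subset\Sigma'$ (closure in $R$). Assume that $\Sigma'$ possesses a hyperbolic metric, that is, a complete conformal metric of constant negative curvature, and that $\Sigma'$ has a Green's function $g=g_{\Sigma'}$. The latter means that, for every $w\in\Sigma'$, the function $z\mapsto g(z,w)$ is real-valued and harmonic on $\Sigma'\setminus\{w\}$, that $g(z,w)+\log|\phi(z)-\phi(w)|$ extends harmonically across $z=w$ for every local coordinate $\phi$ near $w$, and that $\lim_{z\to p}g(z,w)=0$ for every $p\in\partial\Sigma'$. For an open set $U\subset R$ let $A(U)$ be the space of holomorphic one-forms $\alpha$ on $U$ with $(\alpha,\alpha)_{A(U)}<\infty$, where $(\alpha,\beta)_{A(U)}=\frac12\iint_U\alpha\wedge*\overline\beta=\frac i2\iint_U\alpha\wedge\overline\beta$. Let $R(\Sigma',\Sigma):A(\Sigma')\to A(\Sigma)$, $\beta\mapsto\beta|_\Sigma$, be the restriction operator, and for $\alpha\in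 A(\Sigma)$ put $$\bigl(S(\Sigma,\Sigma')\alpha\bigr)(z)=\iint_{\Sigma}K_{\Sigma'}(z,w)\wedge_w\alpha(w),\qquad K_{\Sigma'}(z,w)=-\frac1{\pi i}\,\partial_z\overline\partial_w\,g_{\Sigma'}(w,z),\qquad z\in\Sigma'.$$ Then $A(\Sigma)$ and $A(\Sigma')$ are Hilbert spaces, the integral defining $\bigl(S(\Sigma,\Sigma')\alpha\bigr)(z)$ converges absolutely for every $\alpha\in A(\Sigma)$ and $z\in\Sigma'$, the form $S(\Sigma,\Sigma')\alpha$ belongs to $A(\Sigma')$, and $S(\Sigma,\Sigma')$ is the Hilbert-space adjoint of the restriction operator: $$S(\Sigma,\Sigma')=R(\Sigma',\Sigma)^*.$$ -/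

import Mathlib

open Set Filter Topology MeasureTheory
open scoped Manifold ContDiff ENNReal ComplexConjugate Laplacian

noncomputable section

namespace Schiffer

/-! ### Charts of a surface `R` modelled on `ℂ` -/

section Charts

variable {R : Type*} [TopologicalSpace R] [ChartedSpace ℂ R]

/-- The image in the coordinate plane of the part of `U` that is covered by the chart `e`. -/
def chartImage (e : atlas ℂ R) (U : Set R) : Set ℂ := e.1.target ∩ e.1.symm ⁻¹' U

/-- The change of coordinates from the chart `e` to the chart `f`. -/
def transition (e f : atlas ℂ R) (ζ : ℂ) : ℂ := f.1 (e.1.symm ζ)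

theorem isOpen_chartImage (e : atlas ℂ R) {U : Set R} (hU : IsOpen U) :
    IsOpen (chartImage e U) := e.1.isOpen_inter_preimage_symm hU

/-- A family of coefficients `a e` represents a holomorphic one-form on `U`: in the chart `e` with
coordinate `ζ` the form reads `a e ζ dζ`, with `a e` holomorphic, and the local expressions
transform as they must. The coefficients are extended by `0` off `U`, so that two such families are
equal exactly when the forms on `U` are. -/
structure IsHolomorphicForm (U : Set R) (a : atlas ℂ R → ℂ → ℂ) : Prop where
  holomorphic : ∀ e, DifferentiableOn ℂ (a e) (chartImage e U)
  zero_off : ∀ e, ∀ ζ ∉ chartImage e U, a e ζ = 0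
  transform : ∀ e f : atlas ℂ R, ∀ ζ ∈ chartImage e U, e.1.symm ζ ∈ f.1.source →
    a e ζ = a f (transition e f ζ) * deriv (transition e f) ζ

/-- A real function on `R` is harmonic at `x` if it is so in the coordinates around `x`. -/
def HarmonicAtPoint (u : R → ℝ) (x : R) : Prop :=
  ∀ e : atlas ℂ R, x ∈ e.1.source →
    InnerProductSpace.HarmonicAt (fun ζ : ℂ => u (e.1.symm ζ)) (e.1 x)

/-- `g` is the Green's function of the open set `U`: for each pole `w ∈ U` the function
`z ↦ g z w` is harmonic on `U` off `w`, the function `g z w + log |φ z - φ w|` extends harmonically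
across `z = w` for each coordinate `φ` around `w`, and `g z w → 0` as `z` tends to a
boundary point of `U` in `R`. The value of `g` on the diagonal is irrelevant. -/
structure IsGreenFunction (U : Set R) (g : R → R → ℝ) : Prop where
  harmonic : ∀ w ∈ U, ∀ z ∈ U, z ≠ w → HarmonicAtPoint (fun x => g x w) z
  log_pole : ∀ w ∈ U, ∀ e : atlas ℂ R, w ∈ e.1.source →
    ∃ h : ℂ → ℝ, InnerProductSpace.HarmonicAt h (e.1 w) ∧
      ∀ᶠ ζ in 𝓝[≠] (e.1 w), g (e.1.symm ζ) w + Real.log ‖ζ - e.1 w‖ = h ζ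
  boundary : ∀ w ∈ U, ∀ p ∈ frontier U, Tendsto (fun z => g z w) (𝓝[U] p) (𝓝 0)

/-! ### Hyperbolic metrics -/

/-- The length of the curve `γ : [0, 1] → R` for the conformal metric which reads `ρ e |dζ|` in the
chart `e`; the speed at time `t` is computed in the preferred chart at `γ t`. -/
def curveLength (ρ : atlas ℂ R → ℂ → ℝ) (γ : ℝ → R) : ℝ≥0∞ :=
  ∫⁻ t in Icc (0 : ℝ) 1,
    ENNReal.ofReal (ρ ⟨chartAt ℂ (γ t), chart_mem_atlas ℂ (γ t)⟩ (chartAt ℂ (γ t) (γ t)) *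
      ‖derivWithin (fun s => chartAt ℂ (γ t) (γ s)) (Icc 0 1) t‖)

/-- The distance on `U` defined by `ρ`: the infimum of the lengths of the `C¹` curves in `U`. -/
def conformalDist (U : Set R) (ρ : atlas ℂ R → ℂ → ℝ) (x y : R) : ℝ≥0∞ :=
  ⨅ (γ : ℝ → R) (_ : ContMDiffOn 𝓘(ℝ, ℝ) 𝓘(ℝ, ℂ) 1 γ (Icc 0 1) ∧ MapsTo γ (Icc 0 1) U ∧
    γ 0 = x ∧ γ 1 = y), curveLength ρ γ

/-- `ρ` is a hyperbolic metric on `U`: a smooth conformal metric `ρ e |dζ|` which has constant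
negative curvature `-Δ(log ρ)/ρ²` and is complete. -/
structure IsHyperbolicMetric (U : Set R) (ρ : atlas ℂ R → ℂ → ℝ) : Prop where
  pos : ∀ e, ∀ ζ ∈ chartImage e U, 0 < ρ e ζ
  smooth : ∀ e, ContDiffOn ℝ ∞ (ρ e) (chartImage e U)
  transform : ∀ e f : atlas ℂ R, ∀ ζ ∈ chartImage e U, e.1.symm ζ ∈ f.1.source →
    ρ e ζ = ρ f (transition e f ζ) * ‖deriv (transition e f) ζ‖
  curvature : ∃ c : ℝ, c < 0 ∧ ∀ e, ∀ ζ ∈ chartImage e U,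
    -(Δ (fun η : ℂ => Real.log (ρ e η))) ζ / ρ e ζ ^ 2 = c
  complete : ∀ u : ℕ → R, (∀ n, u n ∈ U) →
    (∀ ε : ℝ≥0∞, 0 < ε → ∃ N, ∀ m ≥ N, ∀ n ≥ N, conformalDist U ρ (u m) (u n) < ε) →
    ∃ x ∈ U, Tendsto u atTop (𝓝 x)

/-! ### The Bergman kernel -/

/-- The Wirtinger derivative `∂f/∂ζ = (∂f/∂x - i ∂f/∂y) / 2`. -/
def wirtinger (f : ℂ → ℂ) (ζ : ℂ) : ℂ :=
  (fderiv ℝ f ζ 1 - Complex.I * fderiv ℝ f ζ Complex.I) / 2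

/-- The Wirtinger derivative `∂f/∂ζ̄ = (∂f/∂x + i ∂f/∂y) / 2`. -/
def wirtingerBar (f : ℂ → ℂ) (ζ : ℂ) : ℂ :=
  (fderiv ℝ f ζ 1 + Complex.I * fderiv ℝ f ζ Complex.I) / 2

/-- The coefficient of `dζ dη̄` in the kernel `K(z, w) = -(1 / (π i)) ∂_z ∂̄_w g(w, z)`, where `ζ` is
the coordinate of `z` in the chart `e` and `η` that of `w` in the chart `f`. -/
def bergmanKernel (g : R → R → ℝ) (e f : atlas ℂ R) (ζ η : ℂ) : ℂ :=
  -(1 / ((Real.pi : ℂ) * Complex.I)) *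
    wirtinger (fun ζ' => wirtingerBar (fun η' => (g (f.1.symm η') (e.1.symm ζ') : ℂ)) η) ζ

end Charts

/-! ### Integration over a compact surface -/

section Integration

variable (R : Type*) [TopologicalSpace R] [ChartedSpace ℂ R] [CompactSpace R]

theorem exists_chart_cover :
    ∃ n : ℕ, ∃ c : Fin n → atlas ℂ R, ∀ x, ∃ i, x ∈ (c i).1.source := by
  obtain ⟨t, ht⟩ := isCompact_univ.elim_finite_subcover (fun x : R => (chartAt ℂ x).source)
    (fun x => (chartAt ℂ x).open_source) (fun x _ => mem_iUnion.2 ⟨x, mem_chart_source ℂ x⟩)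
  refine ⟨t.card, fun i => ⟨chartAt ℂ (t.equivFin.symm i : R), chart_mem_atlas ℂ _⟩, fun x => ?_⟩
  obtain ⟨y, hy, hxy⟩ := mem_iUnion₂.1 (ht (mem_univ x))
  exact ⟨t.equivFin ⟨y, hy⟩, by simpa using hxy⟩

/-- The number of charts in a finite cover of `R` by charts, fixed once and for all. -/
def coverCard : ℕ := (exists_chart_cover R).choose

/-- The charts of the fixed finite cover. -/
def coverChart : Fin (coverCard R) → atlas ℂ R := (exists_chart_cover R).choose_spec.choose

theorem coverChart_covers (x : R) : ∃ i, x ∈ (coverChart R i).1.source :=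
  (exists_chart_cover R).choose_spec.choose_spec x

variable {R}

/-- The points of `U` that lie in the `i`-th chart of the fixed cover but in no earlier one, seen in
the coordinate plane of the `i`-th chart. These cells cut `U` into disjoint measurable pieces. -/
def cell (U : Set R) (i : Fin (coverCard R)) : Set ℂ :=
  {ζ | ζ ∈ chartImage (coverChart R i) U ∧
    ∀ j < i, ζ ∉ chartImage (coverChart R i) (coverChart R j).1.source}

/-- The integral over `U` of the two-form which reads `F e ζ dx dy` (`ζ = x + i y`) in the chart
`e`. By the change of variables formula it does not depend on the cover by charts. -/
def surfaceIntegral (U : Set R) (F : atlas ℂ R → ℂ → ℂ) : ℂ :=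
  ∑ i, ∫ ζ in cell U i, F (coverChart R i) ζ

/-- Absolute convergence of the integral `surfaceIntegral U F`. -/
def SurfaceIntegrable (U : Set R) (F : atlas ℂ R → ℂ → ℂ) : Prop :=
  ∀ i, IntegrableOn (F (coverChart R i)) (cell U i)

/-- The pairing `(α, β) = (1/2) ∬ α ∧ *β̄ = (i/2) ∬ α ∧ β̄` of two `(1,0)`-forms on `U`: for
`α = a dζ` and `β = b dζ` the integrand is `a b̄ dx dy`. -/
def pairing (U : Set R) (a b : atlas ℂ R → ℂ → ℂ) : ℂ :=
  surfaceIntegral U fun e ζ => a e ζ * conj (b e ζ)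

theorem measurableSet_cell {U : Set R} (hU : IsOpen U) (i : Fin (coverCard R)) :
    MeasurableSet (cell U i) := by
  have : cell U i = chartImage (coverChart R i) U ∩
      ⋂ j, ⋂ (_ : j < i), (chartImage (coverChart R i) (coverChart R j).1.source)ᶜ := by
    ext ζ; simp [cell]
  rw [this]
  refine (isOpen_chartImage _ hU).measurableSet.inter (MeasurableSet.iInter fun j =>
    MeasurableSet.iInter fun _ => ?_)
  exact (isOpen_chartImage _ (coverChart R j).1.open_source).measurableSet.compl

theorem cell_mono {U V : Set R} (h : U ⊆ V) (i : Fin (coverCard R)) : cell U i ⊆ cell V i :=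
  fun _ hζ => ⟨⟨hζ.1.1, h hζ.1.2⟩, hζ.2⟩

end Integration

/-! ### The Bergman space `A(U)` of square integrable holomorphic one-forms -/

section Bergman

open TopologicalSpace (Opens)

variable {R : Type*} [TopologicalSpace R] [ChartedSpace ℂ R] [CompactSpace R]

/-- The holomorphic one-forms `α` on `U` for which `(α, α)` is finite. -/
def bergmanSubmodule (U : Opens R) : Submodule ℂ (atlas ℂ R → ℂ → ℂ) where
  carrier := {a | IsHolomorphicForm (U : Set R) a ∧
    ∀ i, MemLp (a (coverChart R i)) 2 (volume.restrict (cell (U : Set R) i))}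
  zero_mem' :=
    ⟨⟨fun _ => differentiableOn_const 0, fun _ _ _ => rfl, fun _ _ _ _ _ => by simp⟩,
      fun _ => MemLp.zero⟩
  add_mem' {a b} ha hb :=
    ⟨⟨fun e => (ha.1.holomorphic e).add (hb.1.holomorphic e),
      fun e ζ hζ => by simp [ha.1.zero_off e ζ hζ, hb.1.zero_off e ζ hζ],
      fun e f ζ hζ h => by
        simp only [Pi.add_apply]
        rw [ha.1.transform e f ζ hζ h, hb.1.transform e f ζ hζ h]; ring⟩,
      fun i => (ha.2 i).add (hb.2 i)⟩
  smul_mem' c a ha :=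
    ⟨⟨fun e => (ha.1.holomorphic e).const_smul c,
      fun e ζ hζ => by simp [ha.1.zero_off e ζ hζ],
      fun e f ζ hζ h => by
        simp only [Pi.smul_apply, smul_eq_mul]
        rw [ha.1.transform e f ζ hζ h]; ring⟩,
      fun i => (ha.2 i).const_smul c⟩

/-- The Bergman space `A(U)`, as a type of its own: its topology is that of the norm below. -/
def Bergman (U : Opens R) : Type _ := bergmanSubmodule U

namespace Bergman

variable {U V : Opens R}

instance : AddCommGroup (Bergman U) := inferInstanceAs (AddCommGroup (bergmanSubmodule U))

instance : Module ℂ (Bergman U) := inferInstanceAs (Module ℂ (bergmanSubmodule U))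

/-- The coefficients of a form: `α.coeff e ζ dζ` is its expression in the chart `e`. -/
def coeff (α : Bergman U) : atlas ℂ R → ℂ → ℂ := Subtype.val α

theorem isHolomorphicForm (α : Bergman U) : IsHolomorphicForm (U : Set R) α.coeff :=
  (Subtype.property α).1

theorem memLp (α : Bergman U) (i : Fin (coverCard R)) :
    MemLp (α.coeff (coverChart R i)) 2 (volume.restrict (cell (U : Set R) i)) :=
  (Subtype.property α).2 i

@[ext] theorem ext {α β : Bergman U} (h : α.coeff = β.coeff) : α = β := Subtype.ext h

@[simp] theorem coeff_add (α β : Bergman U) : (α + β).coeff = α.coeff + β.coeff := rfl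

@[simp] theorem coeff_smul (c : ℂ) (α : Bergman U) : (c • α).coeff = c • α.coeff := rfl

theorem integrable_mul_conj (α β : Bergman U) (i : Fin (coverCard R)) :
    Integrable (fun ζ => α.coeff (coverChart R i) ζ * conj (β.coeff (coverChart R i) ζ))
      (volume.restrict (cell (U : Set R) i)) :=
  (α.memLp i).integrable_mul (β.memLp i).star

theorem pairing_self (α : Bergman U) :
    pairing (U : Set R) α.coeff α.coeff =
      ((∑ i, ∫ ζ in cell (U : Set R) i, ‖α.coeff (coverChart R i) ζ‖ ^ 2 : ℝ) : ℂ) := by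
  simp only [pairing, surfaceIntegral, Complex.mul_conj', Complex.ofReal_sum]
  refine Finset.sum_congr rfl fun i _ => ?_
  rw [← integral_complex_ofReal]
  simp

theorem eq_zero_of_pairing_self (α : Bergman U) (h : pairing (U : Set R) α.coeff α.coeff = 0) :
    α = 0 := by
  have hz : ∀ i, ∀ᵐ ζ ∂volume.restrict (cell (U : Set R) i), α.coeff (coverChart R i) ζ = 0 := by
    intro i
    rw [pairing_self, Complex.ofReal_eq_zero,
      Finset.sum_eq_zero_iff_of_nonneg (fun i _ => integral_nonneg fun ζ => by positivity)] at h
    have hi := h i (Finset.mem_univ i)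
    rw [integral_eq_zero_iff_of_nonneg (fun ζ => by positivity)
      ((α.memLp i).integrable_norm_pow two_ne_zero)] at hi
    filter_upwards [hi] with ζ hζ
    simpa using hζ
  have key : ∀ i, ∀ ζ ∈ chartImage (coverChart R i) (U : Set R),
      α.coeff (coverChart R i) ζ = 0 := by
    intro i
    induction i using WellFoundedLT.induction with
    | ind i ih =>
    have hcont := (α.isHolomorphicForm.holomorphic (coverChart R i)).continuousOn
    have hopen : IsOpen (chartImage (coverChart R i) (U : Set R) ∩
        α.coeff (coverChart R i) ⁻¹' {0}ᶜ) :=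
      hcont.isOpen_inter_preimage (isOpen_chartImage _ U.isOpen) isOpen_compl_singleton
    have hsub : chartImage (coverChart R i) (U : Set R) ∩ α.coeff (coverChart R i) ⁻¹' {0}ᶜ ⊆
        cell (U : Set R) i := by
      rintro ζ ⟨hζ, hne⟩
      refine ⟨hζ, fun j hj hζj => hne ?_⟩
      have ht := α.isHolomorphicForm.transform (coverChart R i) (coverChart R j) ζ hζ hζj.2
      have hmem : transition (coverChart R i) (coverChart R j) ζ ∈
          chartImage (coverChart R j) (U : Set R) := by
        refine ⟨(coverChart R j).1.map_source hζj.2, ?_⟩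
        simp only [transition, mem_preimage]
        rw [(coverChart R j).1.left_inv hζj.2]
        exact hζ.2
      rw [mem_singleton_iff, ht, ih j hj _ hmem, zero_mul]
    have hnull : volume (chartImage (coverChart R i) (U : Set R) ∩
        α.coeff (coverChart R i) ⁻¹' {0}ᶜ) = 0 := by
      have h0 := (ae_restrict_iff' (measurableSet_cell U.isOpen i)).1 (hz i)
      rw [ae_iff] at h0
      refine measure_mono_null (fun ζ hζ => ?_) h0
      exact fun hc => hζ.2 (hc (hsub hζ))
    have hempty := hopen.eq_empty_of_measure_zero hnull
    intro ζ hζ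
    by_contra hne
    exact (hempty ▸ (⟨hζ, hne⟩ : ζ ∈ chartImage (coverChart R i) (U : Set R) ∩
        α.coeff (coverChart R i) ⁻¹' {0}ᶜ) : ζ ∈ (∅ : Set ℂ))
  ext e ζ
  by_cases hζ : ζ ∈ chartImage e (U : Set R)
  · obtain ⟨i, hi⟩ := coverChart_covers R (e.1.symm ζ)
    rw [α.isHolomorphicForm.transform e (coverChart R i) ζ hζ hi, key i, zero_mul]
    · rfl
    · refine ⟨(coverChart R i).1.map_source hi, ?_⟩
      simp only [transition, mem_preimage]
      rw [(coverChart R i).1.left_inv hi]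
      exact hζ.2
  · exact α.isHolomorphicForm.zero_off e ζ hζ

/-- The inner product of `A(U)`. In Mathlib `inner ℂ α β` is linear in `β`, so it is `(β, α)`. -/
abbrev innerCore (U : Opens R) : InnerProductSpace.Core ℂ (Bergman U) where
  inner α β := pairing (U : Set R) β.coeff α.coeff
  conj_inner_symm α β := by
    simp only [pairing, surfaceIntegral, map_sum, ← integral_conj, map_mul, Complex.conj_conj,
      mul_comm]
  re_inner_nonneg α := by
    rw [pairing_self, RCLike.re_eq_complex_re, Complex.ofReal_re]
    exact Finset.sum_nonneg fun i _ =>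
      integral_nonneg fun ζ => sq_nonneg ‖α.coeff (coverChart R i) ζ‖
  add_left α β γ := by
    simp only [pairing, surfaceIntegral, ← Finset.sum_add_distrib]
    refine Finset.sum_congr rfl fun i _ => ?_
    rw [← integral_add (integrable_mul_conj γ α i) (integrable_mul_conj γ β i)]
    simp [mul_add]
  smul_left α β c := by
    simp only [pairing, surfaceIntegral, Finset.mul_sum]
    refine Finset.sum_congr rfl fun i _ => ?_
    rw [← integral_const_mul]
    refine integral_congr_ae (ae_of_all _ fun ζ => ?_)
    simp only [coeff_smul, Pi.smul_apply, smul_eq_mul, map_mul]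
    ring
  definite α h := eq_zero_of_pairing_self α h

instance : NormedAddCommGroup (Bergman U) := (innerCore U).toNormedAddCommGroup

instance : InnerProductSpace ℂ (Bergman U) := InnerProductSpace.ofCore (innerCore U).toCore

theorem inner_def (α β : Bergman U) : inner ℂ α β = pairing (U : Set R) β.coeff α.coeff := rfl

theorem norm_sq (α : Bergman U) :
    ‖α‖ ^ 2 = ∑ i, ∫ ζ in cell (U : Set R) i, ‖α.coeff (coverChart R i) ζ‖ ^ 2 := by
  rw [← inner_self_eq_norm_sq (𝕜 := ℂ), inner_def, pairing_self]
  rfl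

theorem restrict_mem (h : U ≤ V) (α : Bergman V) :
    (fun e => (chartImage e (U : Set R)).indicator (α.coeff e)) ∈ bergmanSubmodule U := by
  have hsub : ∀ e : atlas ℂ R, chartImage e (U : Set R) ⊆ chartImage e (V : Set R) :=
    fun e ζ hζ => ⟨hζ.1, h hζ.2⟩
  refine ⟨⟨fun e => ?_, fun e ζ hζ => indicator_of_notMem hζ _, fun e f ζ hζ hf => ?_⟩, fun i => ?_⟩
  · exact ((α.isHolomorphicForm.holomorphic e).mono (hsub e)).congr
      fun ζ hζ => indicator_of_mem hζ _
  · have hmem : transition e f ζ ∈ chartImage f (U : Set R) := by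
      refine ⟨f.1.map_source hf, ?_⟩
      simp only [transition, mem_preimage]
      rw [f.1.left_inv hf]
      exact hζ.2
    rw [indicator_of_mem hζ, indicator_of_mem hmem]
    exact α.isHolomorphicForm.transform e f ζ (hsub e hζ) hf
  · refine MemLp.indicator (isOpen_chartImage _ U.isOpen).measurableSet ?_
    exact (α.memLp i).mono_measure (Measure.restrict_mono (cell_mono h i) le_rfl)

/-- The restriction operator `A(V) → A(U)` for `U ⊆ V`. -/
def restrict (h : U ≤ V) : Bergman V →L[ℂ] Bergman U :=
  LinearMap.mkContinuous
    { toFun := fun α =>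
        (⟨fun e => (chartImage e (U : Set R)).indicator (α.coeff e), restrict_mem h α⟩ :
          bergmanSubmodule U)
      map_add' := fun α β => Subtype.ext <| funext fun e => by
        simp only [coeff_add, Pi.add_apply]
        exact indicator_add _ _ _
      map_smul' := fun c α => Subtype.ext <| funext fun e => by
        simp only [coeff_smul, Pi.smul_apply]
        exact indicator_const_smul _ c (α.coeff e) }
    1 (fun α => by
      rw [one_mul]
      refine le_of_sq_le_sq ?_ (norm_nonneg _)
      rw [norm_sq, norm_sq]
      refine Finset.sum_le_sum fun i _ => ?_
      refine (setIntegral_congr_fun (measurableSet_cell U.isOpen i) fun ζ hζ => ?_).trans_le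
        (setIntegral_mono_set ((α.memLp i).integrable_norm_pow two_ne_zero)
          (ae_of_all _ fun ζ => by positivity) (cell_mono h i).eventuallyLE)
      exact congrArg (fun x : ℂ => ‖x‖ ^ 2) (indicator_of_mem hζ.1 _))

theorem restrict_coeff (h : U ≤ V) (α : Bergman V) (e : atlas ℂ R) {ζ : ℂ}
    (hζ : ζ ∈ chartImage e (U : Set R)) : (restrict h α).coeff e ζ = α.coeff e ζ :=
  indicator_of_mem hζ _

end Bergman

/-! ### The Schiffer comparison operator -/

/-- The integrand of `∬ K(z, w) ∧_w α(w)` at the point `z` with coordinate `ζ` in the chart `e`: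
with `w = η` in the chart `f` and `α = a dη` it is `K dη̄ ∧ a dη = 2i K a dx dy`. -/
def schifferIntegrand (g : R → R → ℝ) (a : atlas ℂ R → ℂ → ℂ) (e : atlas ℂ R) (ζ : ℂ) :
    atlas ℂ R → ℂ → ℂ :=
  fun f η => bergmanKernel g e f ζ η * a f η * (2 * Complex.I)

open Classical in
/-- The Schiffer comparison operator `α ↦ ∬_U K(·, w) ∧_w α(w)`, where `K` is the Bergman kernel
of `V` built from the Green's function `g` of `V`: the coefficients of a form on `V`. -/
def schiffer (g : R → R → ℝ) (U V : Opens R) (α : Bergman U) : atlas ℂ R → ℂ → ℂ :=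
  fun e ζ => if ζ ∈ chartImage e (V : Set R) then
    surfaceIntegral (U : Set R) (schifferIntegrand g α.coeff e ζ) else 0

end Bergman

end Schiffer

end

/-! The operator is a pairing with a reproducing kernel. Fix a point z of Σ' with coordinate ζ₀ and
let k be the form ∂_w ∂̄_z g(w, z) in w (`greenForm`). The singular part -log|η - ζ| of g is killed
by the mixed derivative off the diagonal, so k extends to a holomorphic form on Σ'. Two facts carry
the proof: k is square integrable (`memLp_greenForm`), and (β, k) = -(π/2) β(z) for every β in
A(Σ'), where β(z) is the coefficient of β at ζ₀ (`surfaceIntegral_conj_greenForm_mul`). Since g is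
real, the Bergman kernel is a constant times the conjugate of k, whence (Sα)(z) = -(2/π)(α, Rk) =
-(2/π)(R*α, k) = (R*α)(z); this is `schiffer_eq_adjoint`.

The reproducing formula comes from Stokes' theorem. The form k is a combination of ∂ of the
derivatives of g in the pole, in the directions a = 1 and a = i, and each of these has the pole
Re(a/(η - ζ₀)). Cutting the pole off inside a small disc gives functions u_a that are C² on Σ'. The
form (∂u_1 + i ∂u_i)/2 is orthogonal to A(Σ'), and it differs from k by a form which is supported in
the disc and is radial there, with mass -π/2; the mean value property turns the latter into the
value at ζ₀.

The boundary of Σ' may be arbitrary, so Stokes' theorem is applied to T(u) times a form, where T is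
the truncation `trunc`: if u tends to 0 at the boundary, then T(u) has compact support. With the
form ∂u this bounds the Dirichlet integral of u (`memLp_del`); after that the truncation can be
removed for every square integrable form whose ∂̄ has compact support
(`stokes_of_vanishesAtBoundary`). That u_a tends to 0 is a gradient estimate of Harnack type: g is
nonnegative, so its derivative in the pole is at most a constant times g itself
(`exists_compact_greenDir`).

A Green's function is only given as harmonic in its first variable. Its symmetry
(`IsGreenFunction.symm`) follows from Green's second identity for two Green's functions with
smoothed poles. It is then separately harmonic and, with its logarithm added near the diagonal,
locally bounded below; hence it is jointly smooth (`contDiffAt_of_separately_harmonic`), and the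
derivatives in the pole make sense.

Completeness of the Bergman spaces rests on the local bound of point evaluations by the norm
(`sq_norm_coeff_le`). -/

noncomputable section

namespace Schiffer

/-! ### Wirtinger calculus -/

section Wirtinger

/-- The real-linear map `v ↦ A v + B v̄`. -/
def wirtingerCLM (A B : ℂ) : ℂ →L[ℝ] ℂ :=
  A • (ContinuousLinearMap.id ℝ ℂ) + B • (Complex.conjCLE : ℂ →L[ℝ] ℂ)

@[simp] theorem wirtingerCLM_apply (A B v : ℂ) : wirtingerCLM A B v = A * v + B * conj v := by
  simp [wirtingerCLM]

/-- `f` is real differentiable at `ζ` with Wirtinger derivatives `A = ∂f` and `B = ∂̄f`. -/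
def HasWirtinger (f : ℂ → ℂ) (A B ζ : ℂ) : Prop := HasFDerivAt f (wirtingerCLM A B) ζ

variable {f g : ℂ → ℂ} {A B A' B' ζ : ℂ}

theorem HasWirtinger.wirtinger_eq (h : HasWirtinger f A B ζ) : wirtinger f ζ = A := by
  have hI : Complex.I * Complex.I = -1 := Complex.I_mul_I
  simp only [wirtinger, HasFDerivAt.fderiv h, wirtingerCLM_apply, map_one, Complex.conj_I]
  linear_combination (-A / 2 + B / 2) * hI

theorem HasWirtinger.wirtingerBar_eq (h : HasWirtinger f A B ζ) : wirtingerBar f ζ = B := by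
  have hI : Complex.I * Complex.I = -1 := Complex.I_mul_I
  simp only [wirtingerBar, HasFDerivAt.fderiv h, wirtingerCLM_apply, map_one, Complex.conj_I]
  linear_combination (A / 2 - B / 2) * hI

/-- Since 1 and i span ℂ over ℝ, a real-linear map is determined by its values there. Hence
`HasWirtinger` covers every real differentiable function. -/
theorem wirtingerCLM_eq (L : ℂ →L[ℝ] ℂ) :
    wirtingerCLM ((L 1 - Complex.I * L Complex.I) / 2) ((L 1 + Complex.I * L Complex.I) / 2) = L := by
  ext v
  have hv : L v = v.re * L 1 + v.im * L Complex.I := by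
    conv_lhs => rw [← Complex.re_add_im v]
    have h1 : (v.re : ℂ) = v.re • (1 : ℂ) := by simp
    have h2 : (v.im : ℂ) * Complex.I = v.im • Complex.I := by simp
    rw [map_add, h2, map_smul, h1, map_smul]
    simp
  have hI : Complex.I * Complex.I = -1 := Complex.I_mul_I
  rw [wirtingerCLM_apply, hv]
  have hc : conj v = v.re - v.im * Complex.I := by
    apply Complex.ext <;> simp
  conv_lhs => rw [hc]
  conv_lhs => enter [1, 2]; rw [← Complex.re_add_im v]
  linear_combination (-L Complex.I * v.im) * hI

theorem hasWirtinger (h : DifferentiableAt ℝ f ζ) :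
    HasWirtinger f (wirtinger f ζ) (wirtingerBar f ζ) ζ := by
  have := h.hasFDerivAt
  rw [← wirtingerCLM_eq (fderiv ℝ f ζ)] at this
  exact this

theorem HasWirtinger.congr (h : HasWirtinger f A B ζ) (hA : A = A') (hB : B = B') :
    HasWirtinger f A' B' ζ := hA ▸ hB ▸ h

theorem HasWirtinger.add (hf : HasWirtinger f A B ζ) (hg : HasWirtinger g A' B' ζ) :
    HasWirtinger (fun z => f z + g z) (A + A') (B + B') ζ := by
  refine (HasFDerivAt.add hf hg).congr_fderiv ?_
  ext v; simp; ring

theorem HasWirtinger.sub (hf : HasWirtinger f A B ζ) (hg : HasWirtinger g A' B' ζ) :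
    HasWirtinger (fun z => f z - g z) (A - A') (B - B') ζ := by
  refine (HasFDerivAt.sub hf hg).congr_fderiv ?_
  ext v; simp; ring

theorem HasWirtinger.mul (hf : HasWirtinger f A B ζ) (hg : HasWirtinger g A' B' ζ) :
    HasWirtinger (fun z => f z * g z) (A * g ζ + f ζ * A') (B * g ζ + f ζ * B') ζ := by
  refine (HasFDerivAt.mul hf hg).congr_fderiv ?_
  ext v; simp; ring

theorem HasWirtinger.const_mul (c : ℂ) (hf : HasWirtinger f A B ζ) :
    HasWirtinger (fun z => c * f z) (c * A) (c * B) ζ := by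
  refine (HasFDerivAt.const_mul hf c).congr_fderiv ?_
  ext v; simp; ring

theorem HasWirtinger.conj (hf : HasWirtinger f A B ζ) :
    HasWirtinger (fun z => conj (f z)) (conj B) (conj A) ζ := by
  have h := (Complex.conjCLE : ℂ →L[ℝ] ℂ).hasFDerivAt.comp ζ hf
  refine HasFDerivAt.congr_fderiv h ?_
  ext v; simp; ring

theorem HasWirtinger.comp {τ : ℂ → ℂ} {C D : ℂ} (hf : HasWirtinger f A B (τ ζ))
    (hτ : HasWirtinger τ C D ζ) :
    HasWirtinger (fun z => f (τ z)) (A * C + B * conj D) (A * D + B * conj C) ζ := by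
  refine (HasFDerivAt.comp ζ hf hτ).congr_fderiv ?_
  ext v; simp; ring

theorem hasWirtinger_of_hasDerivAt {c : ℂ} (h : HasDerivAt f c ζ) : HasWirtinger f c 0 ζ := by
  refine (h.hasFDerivAt.restrictScalars ℝ).congr_fderiv ?_
  ext v; simp [mul_comm]

/-- The Cauchy-Riemann criterion: a real derivative without conjugate-linear part is complex linear.
-/
theorem HasWirtinger.hasDerivAt (h : HasWirtinger f A 0 ζ) : HasDerivAt f A ζ := by
  rw [hasDerivAt_iff_hasFDerivAt]
  refine (hasFDerivAt_of_restrictScalars ℝ h ?_)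
  ext v; simp [mul_comm]

theorem HasWirtinger.comp_hasDerivAt {τ : ℂ → ℂ} {t : ℂ} (hf : HasWirtinger f A B (τ ζ))
    (hτ : HasDerivAt τ t ζ) :
    HasWirtinger (fun z => f (τ z)) (A * t) (B * conj t) ζ :=
  (hf.comp (hasWirtinger_of_hasDerivAt hτ)).congr (by simp) (by simp)

/-- Composition of a function on the line with a real function on the plane. -/
theorem HasWirtinger.real_comp {T : ℝ → ℝ} {T' : ℝ} {v : ℂ → ℝ}
    (hv : HasWirtinger (fun z => (v z : ℂ)) A B ζ) (hT : HasDerivAt T T' (v ζ)) :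
    HasWirtinger (fun z => (T (v z) : ℂ)) (T' * A) (T' * B) ζ := by
  have h1 : HasFDerivAt v (Complex.reCLM.comp (wirtingerCLM A B)) ζ :=
    Complex.reCLM.hasFDerivAt.comp ζ hv
  have h3 := Complex.ofRealCLM.hasFDerivAt.comp ζ h1
  -- The function is real valued, so its derivative is too; by uniqueness of the derivative, taking
  -- the real part changes nothing.
  have h4 : (Complex.ofRealCLM.comp (Complex.reCLM.comp (wirtingerCLM A B))) = wirtingerCLM A B :=
    HasFDerivAt.unique h3 hv
  have h2 := Complex.ofRealCLM.hasFDerivAt.comp ζ (hT.comp_hasFDerivAt ζ h1)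
  refine h2.congr_fderiv ?_
  ext z
  have h5 := congrArg (fun L : ℂ →L[ℝ] ℂ => L z) h4
  simp only [ContinuousLinearMap.comp_apply, Complex.ofRealCLM_apply, Complex.reCLM_apply,
    wirtingerCLM_apply, _root_.smul_apply, smul_eq_mul, Complex.ofReal_mul] at h5 ⊢
  rw [h5]; ring

theorem wirtinger_congr (h : f =ᶠ[𝓝 ζ] g) : wirtinger f ζ = wirtinger g ζ := by
  simp only [wirtinger, h.fderiv_eq]

theorem wirtingerBar_congr (h : f =ᶠ[𝓝 ζ] g) : wirtingerBar f ζ = wirtingerBar g ζ := by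
  simp only [wirtingerBar, h.fderiv_eq]

theorem wirtingerBar_eq_zero_of_differentiableAt (h : DifferentiableAt ℂ f ζ) :
    wirtingerBar f ζ = 0 := (hasWirtinger_of_hasDerivAt h.hasDerivAt).wirtingerBar_eq

theorem differentiableAt_of_wirtingerBar_eq_zero (h : DifferentiableAt ℝ f ζ)
    (h0 : wirtingerBar f ζ = 0) : DifferentiableAt ℂ f ζ := by
  have := hasWirtinger h
  rw [h0] at this
  exact this.hasDerivAt.differentiableAt

/-- Conjugation exchanges ∂ and ∂̄ and leaves a real function unchanged. -/
theorem wirtingerBar_ofReal {v : ℂ → ℝ} (h : DifferentiableAt ℝ v ζ) :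
    wirtingerBar (fun z => (v z : ℂ)) ζ = conj (wirtinger (fun z => (v z : ℂ)) ζ) := by
  have h1 := hasWirtinger (Complex.ofRealCLM.differentiableAt.comp ζ h)
  have h2 := h1.conj
  simp only [Function.comp_def, Complex.ofRealCLM_apply, Complex.conj_ofReal] at h1 h2
  exact h2.wirtingerBar_eq

theorem ContDiffAt.wirtinger {n m : WithTop ℕ∞} (h : ContDiffAt ℝ n f ζ) (hmn : m + 1 ≤ n) :
    ContDiffAt ℝ m (wirtinger f) ζ := by
  have h1 := h.fderiv_right hmn
  exact ((h1.clm_apply contDiffAt_const).sub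
    (contDiffAt_const.mul (h1.clm_apply contDiffAt_const))).div_const 2

theorem ContDiffAt.wirtingerBar {n m : WithTop ℕ∞} (h : ContDiffAt ℝ n f ζ) (hmn : m + 1 ≤ n) :
    ContDiffAt ℝ m (wirtingerBar f) ζ := by
  have h1 := h.fderiv_right hmn
  exact ((h1.clm_apply contDiffAt_const).add
    (contDiffAt_const.mul (h1.clm_apply contDiffAt_const))).div_const 2

/-- Twice ∂v is the function v_x - i v_y, whose Cauchy-Riemann equations are the Laplace equation
and the symmetry of second derivatives. -/
theorem differentiableAt_wirtinger_of_harmonicAt {v : ℂ → ℝ}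
    (h : InnerProductSpace.HarmonicAt v ζ) :
    DifferentiableAt ℂ (wirtinger fun z => (v z : ℂ)) ζ := by
  have h1 := (HarmonicAt.differentiableAt_complex_partial h).div_const 2
  refine h1.congr_of_eventuallyEq ?_
  filter_upwards [h.eventually] with z hz
  have hd : HasFDerivAt (fun z => (v z : ℂ)) (Complex.ofRealCLM.comp (fderiv ℝ v z)) z :=
    Complex.ofRealCLM.hasFDerivAt.comp z (hz.1.differentiableAt two_ne_zero).hasFDerivAt
  simp [wirtinger, hd.fderiv]

theorem wirtinger_harmonic_holomorphic {v : ℂ → ℝ} (h : InnerProductSpace.HarmonicAt v ζ) :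
    wirtingerBar (wirtinger fun z => (v z : ℂ)) ζ = 0 :=
  wirtingerBar_eq_zero_of_differentiableAt (differentiableAt_wirtinger_of_harmonicAt h)

/-- The Wirtinger derivative of a function composed with a holomorphic map is multiplied by the
derivative of that map, and so is a mixed second derivative by the square of its modulus. -/
theorem wirtingerBar_wirtinger_comp {τ : ℂ → ℂ} (hf : ContDiffAt ℝ 2 f (τ ζ))
    (hτ : AnalyticAt ℂ τ ζ) :
    wirtingerBar (wirtinger fun z => f (τ z)) ζ =
      wirtingerBar (wirtinger f) (τ ζ) * (‖deriv τ ζ‖ ^ 2 : ℝ) := by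
  have h1 : (wirtinger fun z => f (τ z)) =ᶠ[𝓝 ζ] fun z => wirtinger f (τ z) * deriv τ z := by
    have hc := hτ.continuousAt.eventually (hf.eventually (by simp))
    filter_upwards [hc, hτ.eventually_analyticAt] with z hz1 hz2
    exact ((hasWirtinger (hz1.differentiableAt two_ne_zero)).comp_hasDerivAt
      hz2.differentiableAt.hasDerivAt).wirtinger_eq
  rw [wirtingerBar_congr h1]
  have h2 := hasWirtinger ((ContDiffAt.wirtinger (m := 1) hf (by norm_num)).differentiableAt
    one_ne_zero)
  have h3 := (h2.comp_hasDerivAt hτ.differentiableAt.hasDerivAt).mul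
    (hasWirtinger_of_hasDerivAt hτ.deriv.differentiableAt.hasDerivAt)
  rw [h3.wirtingerBar_eq, Complex.ofReal_pow, ← Complex.mul_conj']
  ring

end Wirtinger

/-! ### Integration and harmonic functions in the plane -/

section Plane

open Metric InnerProductSpace

/-- The integral of `∂̄ψ` over the plane vanishes when `ψ` has compact support. -/
theorem integral_wirtingerBar_eq_zero {ψ : ℂ → ℂ} (h : ContDiff ℝ 1 ψ)
    (hc : HasCompactSupport ψ) : ∫ z, wirtingerBar ψ z = 0 := by
  have hd : Continuous (fderiv ℝ ψ) := h.continuous_fderiv one_ne_zero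
  have hcd : HasCompactSupport (fderiv ℝ ψ) := hc.fderiv ℝ
  have hint : ∀ v : ℂ, Integrable fun z => fderiv ℝ ψ z v := fun v =>
    (hd.clm_apply continuous_const).integrable_of_hasCompactSupport
      (hcd.comp_left (g := fun L : ℂ →L[ℝ] ℂ => L v) (by simp))
  have hψ : Integrable ψ := h.continuous.integrable_of_hasCompactSupport hc
  have key : ∀ v : ℂ, ∫ z, fderiv ℝ ψ z v = 0 := by
    intro v
    -- Integration by parts against the constant function 1, whose derivative is zero.
    have := integral_mul_fderiv_eq_neg_fderiv_mul_of_integrable (μ := (volume : Measure ℂ))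
      (f := fun _ : ℂ => (1 : ℂ)) (g := ψ) (v := v) (by simp) (by simpa using hint v)
      (by simpa using hψ) (fun x _ => by fun_prop)
      (fun x _ => h.differentiable one_ne_zero x)
    simpa using this
  have h2 : Integrable fun z => Complex.I * fderiv ℝ ψ z Complex.I :=
    (hint Complex.I).const_mul Complex.I
  simp only [wirtingerBar]
  rw [integral_div, integral_add (hint 1) h2, integral_const_mul, key, key]
  simp

/-- The derivative of a real function vanishes almost everywhere on its zero set. -/
theorem ae_wirtinger_eq_zero {v : ℂ → ℝ} {Ω : Set ℂ} (hΩ : IsOpen Ω)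
    (hv : ContDiffOn ℝ 1 v Ω) :
    ∀ᵐ z, z ∈ Ω → v z = 0 → wirtinger (fun z => (v z : ℂ)) z = 0 := by
  have hvc : ContDiffOn ℝ 1 (fun z => (v z : ℂ)) Ω :=
    Complex.ofRealCLM.contDiff.comp_contDiffOn hv
  have hm : MeasurableSet (Ω ∩ v ⁻¹' {0}) := by
    have h := hΩ.measurableSet.diff (hv.continuousOn.isOpen_inter_preimage hΩ
      (isOpen_compl_singleton (x := (0 : ℝ)))).measurableSet
    convert h using 1
    ext z
    simp only [mem_inter_iff, mem_preimage, mem_singleton_iff, Set.mem_sdiff, mem_compl_iff]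
    tauto
  -- On its zero set the function is approximated by the linear map 0 with error constant 0, so at
  -- almost every point of that set its derivative is at distance 0 from 0.
  have h1 := ApproximatesLinearOn.norm_fderiv_sub_le (μ := (volume : Measure ℂ))
    (f := fun z => (v z : ℂ)) (A := 0) (δ := 0) (s := Ω ∩ v ⁻¹' {0})
    (fun x hx y hy => by
      have h1 : v x = 0 := hx.2
      have h2 : v y = 0 := hy.2
      simp [h1, h2]) hm (fun z => fderiv ℝ (fun z => (v z : ℂ)) z)
    (fun x hx => ((hvc.contDiffAt (hΩ.mem_nhds hx.1)).differentiableAt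
      one_ne_zero).hasFDerivAt.hasFDerivWithinAt)
  rw [ae_restrict_iff' hm] at h1
  filter_upwards [h1] with z hz hzΩ hz0
  have h3 := hz ⟨hzΩ, hz0⟩
  have h4 : fderiv ℝ (fun z => (v z : ℂ)) z = 0 := by simpa using h3
  simp [wirtinger, h4]

/-- Integration of a harmonic function against a radial function. -/
theorem integral_radial_mul_harmonic {φ h : ℂ → ℂ} {c : ℂ} {r R : ℝ} (hrR : r < R)
    (hφ : Continuous φ) (hφ0 : ∀ x, r ≤ ‖x‖ → φ x = 0)
    (hφr : ∀ u x : ℂ, ‖u‖ = 1 → φ (u * x) = φ x) (hh : HarmonicOnNhd h (ball c R)) :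
    ∫ x, φ (x - c) * h x = (∫ x, φ x) * h c := by
  -- The radial weight does not see a rotation by θ, so the integral may be averaged over θ; after
  -- exchanging the integrals, the inner one is a circle average of `h`.
  have hrot : ∀ θ : ℝ, ∫ x, φ (x - c) * h x =
      ∫ x, φ x * h (c + Complex.exp (θ * Complex.I) * x) := by
    intro θ
    rw [← integral_add_left_eq_self (μ := volume) _ c]
    have hmp := (rotation (Circle.exp θ)).measurePreserving
    rw [← hmp.integral_comp (rotation (Circle.exp θ)).toHomeomorph.measurableEmbedding]
    refine integral_congr_ae (ae_of_all _ fun x => ?_)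
    simp only [rotation_apply, Circle.coe_exp, add_sub_cancel_left]
    rw [hφr _ _ (Complex.norm_exp_ofReal_mul_I θ)]
  -- Nothing is known of `h` off the disc, but there the factor φ already vanishes in a
  -- neighbourhood; this is where `r < R` enters.
  have hcont : Continuous fun p : ℝ × ℂ => φ p.2 * h (c + Complex.exp (p.1 * Complex.I) * p.2) := by
    rw [continuous_iff_continuousAt]
    rintro ⟨θ, x⟩
    rcases lt_or_ge ‖x‖ R with hx | hx
    · have hmem : c + Complex.exp (θ * Complex.I) * x ∈ ball c R := by
        simpa [mem_ball, dist_eq_norm, Complex.norm_exp_ofReal_mul_I] using hx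
      refine ContinuousAt.mul (by fun_prop) ?_
      exact ContinuousAt.comp (g := h) (f := fun p : ℝ × ℂ => c + Complex.exp (p.1 * Complex.I) * p.2)
        (hh _ hmem).1.continuousAt (by fun_prop)
    · have hev : (fun p : ℝ × ℂ => φ p.2 * h (c + Complex.exp (p.1 * Complex.I) * p.2)) =ᶠ[𝓝 (θ, x)]
          fun _ => 0 := by
        have : ∀ᶠ p : ℝ × ℂ in 𝓝 (θ, x), r < ‖p.2‖ :=
          (continuous_snd.norm).continuousAt.eventually (lt_mem_nhds (hrR.trans_le hx))
        filter_upwards [this] with p hp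
        rw [hφ0 _ hp.le, zero_mul]
      exact continuousAt_const.congr hev.symm
  have hint : Integrable (Function.uncurry fun (θ : ℝ) (x : ℂ) =>
      φ x * h (c + Complex.exp (θ * Complex.I) * x))
      ((volume.restrict (Ioc 0 (2 * Real.pi))).prod volume) := by
    have h1 : IntegrableOn (fun p : ℝ × ℂ => φ p.2 * h (c + Complex.exp (p.1 * Complex.I) * p.2))
        (Icc 0 (2 * Real.pi) ×ˢ closedBall 0 r) :=
      hcont.continuousOn.integrableOn_compact (isCompact_Icc.prod (isCompact_closedBall 0 r))
    have h2 : IntegrableOn (fun p : ℝ × ℂ => φ p.2 * h (c + Complex.exp (p.1 * Complex.I) * p.2))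
        (Icc 0 (2 * Real.pi) ×ˢ univ) :=
      h1.of_forall_sdiff_eq_zero (measurableSet_Icc.prod MeasurableSet.univ) fun p hp => by
        have : r ≤ ‖p.2‖ := by
          by_contra hlt
          exact hp.2 ⟨hp.1.1, by simpa using (not_le.1 hlt).le⟩
        rw [hφ0 _ this, zero_mul]
    have h3 := h2.mono_set (prod_mono Ioc_subset_Icc_self (subset_refl univ))
    rw [IntegrableOn, Measure.volume_eq_prod, ← Measure.prod_restrict, Measure.restrict_univ] at h3
    exact h3
  have h1 : ∫ θ in Ioc 0 (2 * Real.pi), (∫ x, φ x * h (c + Complex.exp (θ * Complex.I) * x)) =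
      (2 * Real.pi : ℝ) • ∫ x, φ (x - c) * h x := by
    simp_rw [← hrot]
    rw [setIntegral_const]
    simp [Real.pi_pos.le]
  rw [integral_integral_swap hint] at h1
  have h2 : ∀ x, ∫ θ in Ioc 0 (2 * Real.pi), φ x * h (c + Complex.exp (θ * Complex.I) * x) =
      (2 * Real.pi : ℝ) • (φ x * h c) := by
    intro x
    rw [integral_const_mul]
    rcases lt_or_ge ‖x‖ r with hx | hx
    · have hav : Real.circleAverage h c ‖x‖ = h c := InnerProductSpace.HarmonicOnNhd.circleAverage_eq
        (hh.mono (closedBall_subset_ball (by simpa using hx.trans hrR)))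
      -- Starting the circle at the angle of `x` parametrises it by the rotations of `x`.
      rw [Real.circleAverage_eq_integral_add x.arg,
        intervalIntegral.integral_of_le (by positivity)] at hav
      have hmap : ∀ θ : ℝ, circleMap c ‖x‖ (θ + x.arg) = c + Complex.exp (θ * Complex.I) * x := by
        intro θ
        conv_rhs => rw [← Complex.norm_mul_exp_arg_mul_I x]
        rw [circleMap, Complex.ofReal_add, add_mul, Complex.exp_add]
        ring
      simp_rw [hmap] at hav
      rw [← hav, mul_smul_comm, smul_smul, mul_inv_cancel₀ (by positivity), one_smul]
    · rw [hφ0 x hx]; simp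
  simp_rw [h2] at h1
  rw [integral_smul, integral_mul_const] at h1
  exact (smul_right_injective ℂ (by positivity : (2 * Real.pi) ≠ 0) h1).symm

/-- Harnack's inequality near the centre of a disc. -/
theorem harnack {u : ℂ → ℝ} {c z : ℂ} {R : ℝ} (hu : HarmonicOnNhd u (ball c R))
    (h0 : ∀ z ∈ ball c R, 0 ≤ u z) (hz : z ∈ ball c R) :
    |u z - u c| ≤ 2 * u c * ‖z - c‖ / (R - ‖z - c‖) := by
  obtain ⟨F, hF, hFu⟩ := hu.exists_analyticOnNhd_ball_re_eq
  have hR : 0 < R := pos_of_mem_ball hz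
  have hc : c ∈ ball c R := mem_ball_self hR
  have hzR : ‖z - c‖ < R := by simpa [dist_eq_norm] using hz
  -- The Borel-Carathéodory inequality needs a positive bound for the real part, while `u c` may be
  -- zero; δ is removed by a limit at the end.
  have key : ∀ δ > 0, |u z - u c| ≤ 2 * (u c + δ) * ‖z - c‖ / (R - ‖z - c‖) := by
    intro δ hδ
    have hm : ∀ x ∈ ball (0 : ℂ) R, c + x ∈ ball c R := fun x hx => by
      simpa [dist_eq_norm] using hx
    -- This function vanishes at 0, and its real part `u c - u (c + x)` is at most `u c` because `u`
    -- is nonnegative.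
    have h1 := Complex.borelCaratheodory_zero (f := fun x => F c - F (c + x)) (M := u c + δ)
      (R := R) (z := z - c) (by linarith [h0 c hc])
      (fun x hx => by
        have h3 : DifferentiableAt ℂ F (c + x) := (hF _ (hm x hx)).differentiableAt
        exact ((differentiableAt_const _).sub
          (h3.comp x (by fun_prop))).differentiableWithinAt)
      (fun x hx => by
        have h2 : (F (c + x)).re = u (c + x) := hFu (hm x hx)
        have h3 : (F c).re = u c := hFu hc
        have h4 := h0 _ (hm x hx)
        simp only [mem_ofPred_eq, Complex.sub_re, h2, h3]
        linarith) hR (by simpa using hzR) (by simp)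
    refine le_trans ?_ h1
    have h2 : (F z).re = u z := hFu hz
    have h3 : (F c).re = u c := hFu hc
    rw [abs_sub_comm, ← h2, ← h3, ← Complex.sub_re, add_sub_cancel]
    exact Complex.abs_re_le_norm _
  have hlim : Tendsto (fun δ : ℝ => 2 * (u c + δ) * ‖z - c‖ / (R - ‖z - c‖)) (𝓝[>] 0)
      (𝓝 (2 * (u c + 0) * ‖z - c‖ / (R - ‖z - c‖))) :=
    (Continuous.tendsto (by fun_prop) 0).mono_left nhdsWithin_le_nhds
  rw [add_zero] at hlim
  exact ge_of_tendsto hlim (eventually_nhdsWithin_of_forall fun δ hδ => key δ hδ)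

/-- The gradient of a nonnegative harmonic function is controlled by its value. -/
theorem norm_fderiv_le_of_nonneg_harmonic {u : ℂ → ℝ} {c : ℂ} {R : ℝ} (hR : 0 < R)
    (hu : HarmonicOnNhd u (ball c R)) (h0 : ∀ z ∈ ball c R, 0 ≤ u z) :
    ‖fderiv ℝ u c‖ ≤ 4 / R * u c := by
  have hc : c ∈ ball c R := mem_ball_self hR
  have hd := ((hu c hc).1.differentiableAt two_ne_zero).hasFDerivAt
  refine hd.le_of_lip' (mul_nonneg (by positivity) (h0 c hc)) ?_
  -- On the disc of half the radius the denominator in `harnack` is at least `R / 2`, which gives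
  -- the constant `4 / R`.
  filter_upwards [ball_mem_nhds c (half_pos hR)] with z hz
  have hz' : ‖z - c‖ < R / 2 := by simpa [dist_eq_norm] using hz
  have h1 := harnack hu h0 (ball_subset_ball (by linarith) hz)
  rw [Real.norm_eq_abs]
  refine h1.trans ?_
  rw [div_le_iff₀ (by linarith)]
  have h2 := h0 c hc
  have h3 : 4 / R * u c * ‖z - c‖ * (R - ‖z - c‖) =
    2 * u c * ‖z - c‖ + 4 / R * u c * ‖z - c‖ * (R / 2 - ‖z - c‖) := by field_simp; ring
  rw [h3]
  have : 0 ≤ 4 / R * u c * ‖z - c‖ * (R / 2 - ‖z - c‖) := by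
    have : 0 ≤ R / 2 - ‖z - c‖ := by linarith
    positivity
  linarith

end Plane

/-! ### A radial cutoff, and joint smoothness of separately harmonic functions -/

section Cutoff

open Metric InnerProductSpace

/-- The profile of the cutoff, a function of the square of the distance to the origin. -/
def cutProfile (r t : ℝ) : ℝ := Real.smoothTransition (2 - 2 * t / r ^ 2)

/-- A smooth radial function on the plane which is `1` near `0` and `0` off the disc of
radius `r`. -/
def cut (r : ℝ) (x : ℂ) : ℝ := cutProfile r (Complex.normSq x)

variable {r : ℝ}

theorem contDiff_cutProfile (r : ℝ) (n : ℕ∞) : ContDiff ℝ n (cutProfile r) :=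
  Real.smoothTransition.contDiff.comp (by fun_prop)

theorem contDiff_normSq (n : WithTop ℕ∞) : ContDiff ℝ n Complex.normSq := by
  have : (Complex.normSq : ℂ → ℝ) = fun z => ‖z‖ ^ 2 := by
    ext z; rw [Complex.normSq_eq_norm_sq]
  rw [this]
  exact contDiff_norm_sq ℝ

theorem contDiff_cut (r : ℝ) (n : ℕ∞) : ContDiff ℝ n (cut r) :=
  (contDiff_cutProfile r n).comp (contDiff_normSq n)

theorem cutProfile_eq_zero (hr : 0 < r) {t : ℝ} (ht : r ^ 2 ≤ t) : cutProfile r t = 0 := by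
  apply Real.smoothTransition.zero_of_nonpos
  have : 2 ≤ 2 * t / r ^ 2 := by rw [le_div_iff₀ (by positivity)]; linarith
  linarith

theorem cutProfile_eq_one (hr : 0 < r) {t : ℝ} (ht : t ≤ r ^ 2 / 2) : cutProfile r t = 1 := by
  apply Real.smoothTransition.one_of_one_le
  have : 2 * t / r ^ 2 ≤ 1 := by rw [div_le_iff₀ (by positivity)]; linarith
  linarith

theorem cut_eq_zero (hr : 0 < r) {x : ℂ} (hx : r ≤ ‖x‖) : cut r x = 0 := by
  refine cutProfile_eq_zero hr ?_
  rw [Complex.normSq_eq_norm_sq]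
  gcongr

theorem cut_eq_one (hr : 0 < r) {x : ℂ} (hx : ‖x‖ ≤ r / 2) : cut r x = 1 := by
  refine cutProfile_eq_one hr ?_
  rw [Complex.normSq_eq_norm_sq]
  nlinarith [norm_nonneg x]

theorem cut_nonneg (r : ℝ) (x : ℂ) : 0 ≤ cut r x := Real.smoothTransition.nonneg _

theorem cut_rotate (r : ℝ) {u : ℂ} (hu : ‖u‖ = 1) (x : ℂ) : cut r (u * x) = cut r x := by
  rw [cut, cut, map_mul, Complex.normSq_eq_norm_sq u, hu]; simp

theorem hasCompactSupport_cut (hr : 0 < r) : HasCompactSupport (cut r) :=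
  HasCompactSupport.of_support_subset_isCompact (isCompact_closedBall 0 r) fun x hx => by
    by_contra h
    exact hx (cut_eq_zero hr (by simpa using (not_le.1 (by simpa using h)).le))

theorem integral_cut_pos (hr : 0 < r) : 0 < ∫ x, cut r x :=
  (contDiff_cut r 0).continuous.integral_pos_of_hasCompactSupport_nonneg_nonzero
    (hasCompactSupport_cut hr) (cut_nonneg r) (x := 0)
    (by rw [cut_eq_one hr (by simpa using (half_pos hr).le)]; exact one_ne_zero)

/-- The derivative of the profile of the cutoff, as a function on the plane. -/
def cutDeriv (r : ℝ) (x : ℂ) : ℝ := deriv (cutProfile r) (Complex.normSq x)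

theorem continuous_cutDeriv (r : ℝ) : Continuous (cutDeriv r) :=
  ((contDiff_cutProfile r 1).continuous_deriv le_rfl).comp (contDiff_normSq 0).continuous

theorem cutDeriv_eq_zero (hr : 0 < r) {x : ℂ} (hx : r < ‖x‖) : cutDeriv r x = 0 := by
  have h : cutProfile r =ᶠ[𝓝 (Complex.normSq x)] fun _ => 0 := by
    have : r ^ 2 < Complex.normSq x := by rw [Complex.normSq_eq_norm_sq]; gcongr
    filter_upwards [lt_mem_nhds this] with t ht using cutProfile_eq_zero hr ht.le
  rw [cutDeriv, h.deriv_eq, deriv_const]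

theorem cutDeriv_eq_zero' (hr : 0 < r) {x : ℂ} (hx : ‖x‖ ≤ r / 2) : cutDeriv r x = 0 := by
  have h : cutProfile r =ᶠ[𝓝 (Complex.normSq x)] fun _ => 1 := by
    have : Complex.normSq x < r ^ 2 / 2 := by
      rw [Complex.normSq_eq_norm_sq]
      nlinarith [norm_nonneg x]
    filter_upwards [gt_mem_nhds this] with t ht using cutProfile_eq_one hr ht.le
  rw [cutDeriv, h.deriv_eq, deriv_const]

theorem hasWirtinger_cut (r : ℝ) (x : ℂ) :
    HasWirtinger (fun z => (cut r z : ℂ)) (cutDeriv r x * conj x) (cutDeriv r x * x) x := by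
  have h1 : HasWirtinger (fun z => (Complex.normSq z : ℂ)) (conj x) x x := by
    have h := (hasWirtinger_of_hasDerivAt (hasDerivAt_id x)).mul
      (hasWirtinger_of_hasDerivAt (hasDerivAt_id x)).conj
    simp only [id, Complex.mul_conj] at h
    exact h.congr (by simp) (by simp)
  exact h1.real_comp (((contDiff_cutProfile r 1).differentiable one_ne_zero _).hasDerivAt)

/-- In polar coordinates, with χ the profile, the integral is 2π ∫ y χ'(y²) dy over y > 0. A
primitive of the integrand is χ(y²)/2, which falls from 1/2 to 0. -/
theorem integral_cutDeriv (hr : 0 < r) : ∫ x, cutDeriv r x = -Real.pi := by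
  have h1 : ∀ x : ℂ, cutDeriv r x = (fun y : ℝ => deriv (cutProfile r) (y ^ 2)) ‖x‖ := fun x => by
    rw [cutDeriv, Complex.normSq_eq_norm_sq]
  simp_rw [h1]
  rw [integral_fun_norm_addHaar volume (fun y : ℝ => deriv (cutProfile r) (y ^ 2))]
  have h2 : ∫ y in Ioi (0 : ℝ), y ^ (Module.finrank ℝ ℂ - 1) • deriv (cutProfile r) (y ^ 2) =
      0 / 2 - cutProfile r (0 ^ 2) / 2 := by
    have hder : ∀ y : ℝ, HasDerivAt (fun y : ℝ => cutProfile r (y ^ 2) / 2)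
        (y ^ (Module.finrank ℝ ℂ - 1) • deriv (cutProfile r) (y ^ 2)) y := by
      intro y
      have h := (((contDiff_cutProfile r 1).differentiable one_ne_zero (y ^ 2)).hasDerivAt.comp y
        (hasDerivAt_pow 2 y)).div_const 2
      refine h.congr_deriv ?_
      simp only [Complex.finrank_real_complex, smul_eq_mul]
      norm_num
      ring
    have hcs : ∀ y : ℝ, r ≤ y → cutProfile r (y ^ 2) = 0 := fun y hy =>
      cutProfile_eq_zero hr (by gcongr)
    refine integral_Ioi_of_hasDerivAt_of_tendsto (hder 0).continuousAt.continuousWithinAt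
      (fun y _ => hder y) ?_ ?_
    · have hc : Continuous fun y : ℝ =>
          y ^ (Module.finrank ℝ ℂ - 1) • deriv (cutProfile r) (y ^ 2) :=
        (continuous_pow _).smul (((contDiff_cutProfile r 1).continuous_deriv le_rfl).comp
          (continuous_pow 2))
      refine (hc.continuousOn.integrableOn_compact (isCompact_Icc (a := 0) (b := r))).of_forall_sdiff_eq_zero
        measurableSet_Ioi fun y hy => ?_
      have hy' : r < y := by
        by_contra h
        exact hy.2 ⟨(mem_Ioi.1 hy.1).le, not_lt.1 h⟩
      have h : cutProfile r =ᶠ[𝓝 (y ^ 2)] fun _ => 0 := by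
        have : r ^ 2 < y ^ 2 := by gcongr
        filter_upwards [lt_mem_nhds this] with t ht using cutProfile_eq_zero hr ht.le
      rw [h.deriv_eq, deriv_const, smul_zero]
    · refine (tendsto_const_nhds (x := (0 : ℝ) / 2)).congr' ?_
      filter_upwards [eventually_ge_atTop r] with y hy
      rw [hcs y hy]
  rw [h2, cutProfile_eq_one hr (by rw [zero_pow two_ne_zero]; positivity)]
  simp [measureReal_def, Complex.volume_ball, Complex.finrank_real_complex]
  ring

/-- The smooth function which agrees with `log ‖x‖` off the disc of radius `r`. -/
def smoothLog (r : ℝ) (x : ℂ) : ℝ := (1 - cut r x) * Real.log ‖x‖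

theorem smoothLog_eventuallyEq_zero (hr : 0 < r) : smoothLog r =ᶠ[𝓝 0] fun _ => 0 := by
  filter_upwards [ball_mem_nhds (0 : ℂ) (half_pos hr)] with x hx
  rw [smoothLog, cut_eq_one hr (by simpa using (mem_ball_zero_iff.1 hx).le)]
  simp

theorem smoothLog_of_le (hr : 0 < r) {x : ℂ} (hx : r ≤ ‖x‖) : smoothLog r x = Real.log ‖x‖ := by
  rw [smoothLog, cut_eq_zero hr hx]; simp

theorem contDiffAt_log_norm {x : ℂ} (hx : x ≠ 0) (n : ℕ∞) :
    ContDiffAt ℝ n (fun z : ℂ => Real.log ‖z‖) x :=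
  (contDiffAt_norm ℝ hx).log (by simpa using hx)

theorem contDiff_smoothLog (hr : 0 < r) (n : ℕ∞) : ContDiff ℝ n (smoothLog r) := by
  rw [contDiff_iff_contDiffAt]
  intro x
  rcases eq_or_ne x 0 with rfl | hx
  · exact contDiffAt_const.congr_of_eventuallyEq (smoothLog_eventuallyEq_zero hr)
  · exact (contDiffAt_const.sub (contDiff_cut r n).contDiffAt).mul (contDiffAt_log_norm hx n)

/-- The function is half the logarithm of `x * conj x`, and the latter has the Wirtinger derivatives
`conj x` and `x`. -/
theorem hasWirtinger_log_norm {x : ℂ} (hx : x ≠ 0) :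
    HasWirtinger (fun z => (Real.log ‖z‖ : ℂ)) (1 / (2 * x)) (1 / (2 * conj x)) x := by
  have h1 : HasWirtinger (fun z => (Complex.normSq z : ℂ)) (conj x) x x := by
    have h := (hasWirtinger_of_hasDerivAt (hasDerivAt_id x)).mul
      (hasWirtinger_of_hasDerivAt (hasDerivAt_id x)).conj
    simp only [id, Complex.mul_conj] at h
    exact h.congr (by simp) (by simp)
  have hn : Complex.normSq x ≠ 0 := by simpa using hx
  have h2 := h1.real_comp ((Real.hasDerivAt_log hn).div_const 2)
  have h3 : (fun z : ℂ => ((Real.log (Complex.normSq z) / 2 : ℝ) : ℂ)) =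
      fun z => (Real.log ‖z‖ : ℂ) := by
    ext z
    rw [Complex.normSq_eq_norm_sq, Real.log_pow]
    push_cast
    ring
  rw [h3] at h2
  have hc : conj x ≠ 0 := by simpa using hx
  refine h2.congr ?_ ?_ <;>
  · push_cast
    rw [← Complex.mul_conj]
    field_simp

/-- The quarter of the Laplacian of `smoothLog r`. -/
def lapLog (r : ℝ) : ℂ → ℂ := wirtingerBar (wirtinger fun z => (smoothLog r z : ℂ))

theorem contDiff_smoothLog_ofReal (hr : 0 < r) (n : ℕ∞) :
    ContDiff ℝ n fun z => (smoothLog r z : ℂ) :=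
  Complex.ofRealCLM.contDiff.comp (contDiff_smoothLog hr n)

theorem continuous_lapLog (hr : 0 < r) : Continuous (lapLog r) := by
  rw [continuous_iff_continuousAt]
  intro x
  have h1 := ContDiffAt.wirtinger (m := 1) (ζ := x)
    (contDiff_smoothLog_ofReal hr 2).contDiffAt (by norm_num)
  exact (ContDiffAt.wirtingerBar (m := 0) h1 (by norm_num)).continuousAt

theorem lapLog_eq_zero (hr : 0 < r) {x : ℂ} (hx : r < ‖x‖) : lapLog r x = 0 := by
  have h : ∀ᶠ z in 𝓝 x, r < ‖z‖ := continuous_norm.continuousAt.eventually (lt_mem_nhds hx)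
  have h1 : (fun z => (smoothLog r z : ℂ)) =ᶠ[𝓝 x] fun z => (Real.log ‖z‖ : ℂ) := by
    filter_upwards [h] with z hz using by rw [smoothLog_of_le hr hz.le]
  have h2 : (wirtinger fun z => (smoothLog r z : ℂ)) =ᶠ[𝓝 x]
      wirtinger fun z => (Real.log ‖z‖ : ℂ) := by
    filter_upwards [h1.eventuallyEq_nhds] with z hz using wirtinger_congr hz
  rw [lapLog, wirtingerBar_congr h2]
  exact wirtinger_harmonic_holomorphic (AnalyticAt.harmonicAt_log_norm (f := id) analyticAt_id
    (norm_pos_iff.1 (hr.trans hx)))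

/-- The function `smoothLog` is radial, and ∂̄∂ picks up the factor |u|² = 1 under a rotation. -/
theorem lapLog_rotate (hr : 0 < r) {u : ℂ} (hu : ‖u‖ = 1) (x : ℂ) :
    lapLog r (u * x) = lapLog r x := by
  have h := wirtingerBar_wirtinger_comp (τ := fun z => u * z) (ζ := x)
    ((contDiff_smoothLog_ofReal hr 2).contDiffAt) (by fun_prop)
  have h2 : (fun z => (smoothLog r (u * z) : ℂ)) = fun z => (smoothLog r z : ℂ) := by
    ext z; rw [smoothLog, smoothLog, cut_rotate r hu, norm_mul, hu, one_mul]
  have h3 : deriv (fun z => u * z) x = u := by simp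
  rw [h2, h3, hu] at h
  simpa [lapLog] using h.symm

/-- A smooth form of the identity ∂̄∂ log|x| = (π/2) δ. Off the origin ∂ of `smoothLog` is (1 -
cut)/(2x) - Q, where Q is C¹ with compact support. As 1/x is holomorphic, ∂̄ of the first term is
-`cutDeriv`/2, with integral π/2; ∂̄Q has integral 0. -/
theorem integral_lapLog (hr : 0 < r) : ∫ x, lapLog r x = Real.pi / 2 := by
  set Q : ℂ → ℂ := fun x => cutDeriv r x * conj x * Real.log ‖x‖ with hQ
  have hderiv : ∀ n : ℕ∞, ContDiff ℝ n (cutDeriv r) := fun n =>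
    (ContDiff.deriv' (n := (n : WithTop ℕ∞)) (by exact_mod_cast contDiff_cutProfile r (n + 1))).comp
      (contDiff_normSq n)
  have hnear : Q =ᶠ[𝓝 0] fun _ => 0 := by
    filter_upwards [ball_mem_nhds (0 : ℂ) (half_pos hr)] with x hx
    simp [hQ, cutDeriv_eq_zero' hr (mem_ball_zero_iff.1 hx).le]
  have hQs : ContDiff ℝ 1 Q := by
    rw [contDiff_iff_contDiffAt]
    intro x
    rcases eq_or_ne x 0 with rfl | hx
    · exact contDiffAt_const.congr_of_eventuallyEq hnear
    · exact ((Complex.ofRealCLM.contDiff.comp (hderiv 1)).mul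
        Complex.conjCLE.contDiff).contDiffAt.mul
        (Complex.ofRealCLM.contDiff.contDiffAt.comp x (contDiffAt_log_norm hx 1))
  have hQc : HasCompactSupport Q :=
    HasCompactSupport.of_support_subset_isCompact (isCompact_closedBall 0 r) fun x hx => by
      by_contra h
      refine hx ?_
      simp [hQ, cutDeriv_eq_zero hr (by simpa using h)]
  have hw : ∀ x : ℂ, x ≠ 0 → wirtinger (fun z => (smoothLog r z : ℂ)) x =
      (1 - cut r x) * (1 / (2 * x)) - Q x := by
    intro x hx
    have h := ((hasWirtinger_of_hasDerivAt (hasDerivAt_const x (1 : ℂ))).sub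
      (hasWirtinger_cut r x)).mul (hasWirtinger_log_norm hx)
    have h2 : (fun z => (smoothLog r z : ℂ)) = fun z => (1 - (cut r z : ℂ)) * (Real.log ‖z‖ : ℂ) := by
      ext z; simp [smoothLog]
    rw [h2, h.wirtinger_eq]
    simp only [hQ]
    ring
  -- The formula persists at the origin because all its terms vanish near it.
  have hlap : ∀ x : ℂ, lapLog r x = -(1 / 2) * cutDeriv r x - wirtingerBar Q x := by
    intro x
    rcases eq_or_ne x 0 with rfl | hx
    · have h1 : lapLog r 0 = 0 := by
        have h2 : (fun z => (smoothLog r z : ℂ)) =ᶠ[𝓝 0] fun _ => 0 := by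
          filter_upwards [smoothLog_eventuallyEq_zero hr] with z hz using by simp [hz]
        have h3 : (wirtinger fun z => (smoothLog r z : ℂ)) =ᶠ[𝓝 0] fun _ => 0 := by
          filter_upwards [h2.eventuallyEq_nhds] with z hz
          rw [wirtinger_congr hz]; simp [wirtinger]
        rw [lapLog, wirtingerBar_congr h3]; simp [wirtingerBar]
      rw [h1, wirtingerBar_congr hnear, cutDeriv_eq_zero' hr (by simpa using (half_pos hr).le)]
      simp [wirtingerBar]
    · have hev : (wirtinger fun z => (smoothLog r z : ℂ)) =ᶠ[𝓝 x]
          fun x => (1 - cut r x) * (1 / (2 * x)) - Q x := by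
        filter_upwards [isOpen_ne.mem_nhds hx] with z hz using hw z hz
      rw [lapLog, wirtingerBar_congr hev]
      have hd : HasDerivAt (fun x : ℂ => 1 / (2 * x)) (deriv (fun x : ℂ => 1 / (2 * x)) x) x := by
        have : DifferentiableAt ℂ (fun x : ℂ => 1 / (2 * x)) x := by
          refine (differentiableAt_const _).div (by fun_prop) (by simpa using hx)
        exact this.hasDerivAt
      have h := (((hasWirtinger_of_hasDerivAt (hasDerivAt_const x (1 : ℂ))).sub
        (hasWirtinger_cut r x)).mul (hasWirtinger_of_hasDerivAt hd)).sub
        (hasWirtinger (hQs.differentiable one_ne_zero x))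
      rw [h.wirtingerBar_eq]
      field_simp
      ring
  have hcd : Integrable fun x => (cutDeriv r x : ℂ) :=
    (Complex.continuous_ofReal.comp (continuous_cutDeriv r)).integrable_of_hasCompactSupport
      (HasCompactSupport.of_support_subset_isCompact (isCompact_closedBall 0 r) fun x hx => by
        by_contra h
        refine hx ?_
        simp [cutDeriv_eq_zero hr (by simpa using h)])
  have hQi : Integrable (wirtingerBar Q) := by
    have hcont : Continuous (wirtingerBar Q) := by
      rw [continuous_iff_continuousAt]
      intro x
      exact (ContDiffAt.wirtingerBar (m := 0) hQs.contDiffAt (by norm_num)).continuousAt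
    refine hcont.integrable_of_hasCompactSupport
      ((hQc.fderiv ℝ).comp_left (g := fun L : ℂ →L[ℝ] ℂ => (L 1 + Complex.I * L Complex.I) / 2)
        (by simp))
  simp_rw [hlap]
  rw [integral_sub (hcd.const_mul _) hQi, integral_wirtingerBar_eq_zero hQs hQc,
    integral_const_mul, integral_complex_ofReal, integral_cutDeriv hr]
  push_cast
  ring

end Cutoff

/-! ### Separately harmonic functions -/

section SeparatelyHarmonic

open Metric InnerProductSpace

/-- The mean value property in the form of a convolution: convolving with the radial cutoff
multiplies a harmonic function by the mass of the cutoff. -/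
theorem integral_cut_mul_harmonic {u : ℂ → ℝ} {c : ℂ} {r R : ℝ} (hr : 0 < r) (hrR : r < R)
    (hu : HarmonicOnNhd u (ball c R)) : ∫ x, cut r x * u (c - x) = (∫ x, cut r x) * u c := by
  have h1 := integral_radial_mul_harmonic (φ := fun x => (cut r x : ℂ)) (h := fun x => (u x : ℂ))
    (c := c) hrR (Complex.continuous_ofReal.comp (contDiff_cut r 0).continuous)
    (fun x hx => by simp [cut_eq_zero hr hx]) (fun v x hv => by simp [cut_rotate r hv])
    (fun z hz => (hu z hz).comp_CLM Complex.ofRealCLM)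
  rw [← integral_sub_left_eq_self _ volume c] at h1
  have h2 : ∀ x, cut r (c - x - c) = cut r x := fun x => by
    have : c - x - c = (-1) * x := by ring
    rw [this, cut_rotate r (by simp)]
  simp_rw [h2] at h1
  have h3 : (∫ x, (cut r x : ℂ) * (u (c - x) : ℂ)) = ((∫ x, cut r x * u (c - x) : ℝ) : ℂ) := by
    rw [← integral_complex_ofReal]; simp
  rw [h3, integral_complex_ofReal] at h1
  exact_mod_cast h1

/-- Harnack's inequality in the second variable bounds the change from `u η b` to `u η ζ` by `u η b`
times a factor that tends to 0. This is uniform for η near `a`, because `u η b` is continuous in η.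
-/
theorem continuousAt_of_nonneg_separately_harmonic {u : ℂ → ℂ → ℝ} {a b : ℂ} {R : ℝ}
    (hR : 0 < R)
    (h1 : ∀ ζ ∈ ball b R, HarmonicOnNhd (fun η => u η ζ) (ball a R))
    (h2 : ∀ η ∈ ball a R, HarmonicOnNhd (u η) (ball b R))
    (h0 : ∀ η ∈ ball a R, ∀ ζ ∈ ball b R, 0 ≤ u η ζ) :
    ContinuousAt (fun p : ℂ × ℂ => u p.1 p.2) (a, b) := by
  have hb : b ∈ ball b R := mem_ball_self hR
  have hc1 : ContinuousAt (fun p : ℂ × ℂ => u p.1 b) (a, b) :=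
    ContinuousAt.comp (g := fun η => u η b) (f := Prod.fst)
      (h1 b hb a (mem_ball_self hR)).1.continuousAt continuousAt_fst
  have hz : Tendsto (fun p : ℂ × ℂ => u p.1 p.2 - u p.1 b) (𝓝 (a, b)) (𝓝 0) := by
    have hlim : Tendsto (fun p : ℂ × ℂ => 2 * u p.1 b * ‖p.2 - b‖ / (R - ‖p.2 - b‖)) (𝓝 (a, b))
        (𝓝 (2 * u a b * ‖b - b‖ / (R - ‖b - b‖))) := by
      have hn : Tendsto (fun p : ℂ × ℂ => ‖p.2 - b‖) (𝓝 (a, b)) (𝓝 ‖b - b‖) :=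
        (Continuous.tendsto (by fun_prop) (a, b))
      refine ((tendsto_const_nhds.mul hc1).mul hn).div (tendsto_const_nhds.sub hn) ?_
      simpa using hR.ne'
    simp only [sub_self, norm_zero, mul_zero, zero_div] at hlim
    refine squeeze_zero_norm' ?_ hlim
    have hev : ∀ᶠ p : ℂ × ℂ in 𝓝 (a, b), p ∈ ball a R ×ˢ ball b R :=
      prod_mem_nhds (ball_mem_nhds a hR) (ball_mem_nhds b hR)
    filter_upwards [hev] with p hp
    exact harnack (h2 p.1 hp.1) (h0 p.1 hp.1) hp.2
  have := hz.add hc1.tendsto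
  simpa [ContinuousAt] using this

theorem ball_subset_ball_of_mem {a x : ℂ} {R : ℝ} (hx : x ∈ closedBall a (R / 2)) :
    ball x (R / 2) ⊆ ball a R :=
  ball_subset_ball' (by have := mem_closedBall.1 hx; linarith)

/-- A separately harmonic function which is bounded below is jointly smooth. -/
theorem contDiffAt_of_separately_harmonic {u : ℂ → ℂ → ℝ} {a b : ℂ} {R C : ℝ} (hR : 0 < R)
    (h1 : ∀ ζ ∈ ball b R, HarmonicOnNhd (fun η => u η ζ) (ball a R))
    (h2 : ∀ η ∈ ball a R, HarmonicOnNhd (u η) (ball b R))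
    (hC : ∀ η ∈ ball a R, ∀ ζ ∈ ball b R, C ≤ u η ζ) (n : ℕ∞) :
    ContDiffAt ℝ n (fun p : ℂ × ℂ => u p.1 p.2) (a, b) := by
  have hcont : ContinuousOn (fun p : ℂ × ℂ => u p.1 p.2)
      (closedBall a (R / 2) ×ˢ closedBall b (R / 2)) := by
    rintro ⟨x, y⟩ ⟨hx, hy⟩
    have hsx := ball_subset_ball_of_mem hx
    have hsy := ball_subset_ball_of_mem hy
    -- Subtracting the lower bound makes the function nonnegative without losing harmonicity.
    have h := continuousAt_of_nonneg_separately_harmonic (u := fun η ζ => u η ζ - C) (half_pos hR)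
      (fun ζ hζ => ((h1 ζ (hsy hζ)).mono hsx).sub (harmonicOnNhd_const C))
      (fun η hη => ((h2 η (hsx hη)).mono hsy).sub (harmonicOnNhd_const C))
      (fun η hη ζ hζ => sub_nonneg.2 (hC η (hsx hη) ζ (hsy hζ)))
    have h3 : ContinuousAt (fun p : ℂ × ℂ => (u p.1 p.2 - C) + C) (x, y) := h.add continuousAt_const
    simp only [sub_add_cancel] at h3
    exact h3.continuousWithinAt
  set K : Set (ℂ × ℂ) := closedBall a (R / 2) ×ˢ closedBall b (R / 2) with hK
  have hKc : IsCompact K := (isCompact_closedBall _ _).prod (isCompact_closedBall _ _)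
  have hint : Integrable (K.indicator fun p : ℂ × ℂ => u p.1 p.2) :=
    (integrable_indicator_iff hKc.measurableSet).2 (hcont.integrableOn_compact hKc)
  -- With radius `R / 4`, points within `R / 4` of the centre are moved by the support of `f` to
  -- points that are still in `K`, where the indicator is 1.
  set f : ℂ × ℂ → ℝ := fun p => cut (R / 4) p.1 * cut (R / 4) p.2 with hf
  have hr : 0 < R / 4 := by linarith
  have hfs : ContDiff ℝ n f :=
    ((contDiff_cut _ n).comp contDiff_fst).mul ((contDiff_cut _ n).comp contDiff_snd)
  have hfc : HasCompactSupport f :=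
    HasCompactSupport.of_support_subset_isCompact
      ((isCompact_closedBall 0 (R / 4)).prod (isCompact_closedBall 0 (R / 4))) fun p hp => by
        by_contra h
        refine hp ?_
        rw [mem_prod, not_and_or] at h
        rcases h with h | h
        · have : R / 4 < ‖p.1‖ := by simpa using h
          simp [hf, cut_eq_zero hr this.le]
        · have : R / 4 < ‖p.2‖ := by simpa using h
          simp [hf, cut_eq_zero hr this.le]
  have hinv : (volume : Measure (ℂ × ℂ)).IsAddLeftInvariant := by
    rw [Measure.volume_eq_prod]; infer_instance
  have hneg : (volume : Measure (ℂ × ℂ)).IsNegInvariant := by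
    have : (volume : Measure (ℂ × ℂ)).IsAddHaarMeasure := by
      rw [Measure.volume_eq_prod]; infer_instance
    infer_instance
  have hconv := hfc.contDiff_convolution_left (ContinuousLinearMap.mul ℝ ℝ) hfs
    hint.locallyIntegrable
  set M : ℝ := ∫ x, cut (R / 4) x with hM
  have hMpos : 0 < M := integral_cut_pos hr
  -- The mean value property in each variable, joined by Fubini's theorem, identifies `u` with a
  -- multiple of its convolution with `f`; the latter is as smooth as `f`.
  have key : ∀ p ∈ ball a (R / 4) ×ˢ ball b (R / 4), u p.1 p.2 =
      (M * M)⁻¹ * (convolution f (K.indicator fun p : ℂ × ℂ => u p.1 p.2)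
        (ContinuousLinearMap.mul ℝ ℝ) volume) p := by
    rintro ⟨x, y⟩ ⟨hx, hy⟩
    have hex := (hfc.convolutionExists_left (ContinuousLinearMap.mul ℝ ℝ) hfs.continuous
      hint.locallyIntegrable (x, y)).integrable
    have hmemx : ∀ t : ℂ, cut (R / 4) t ≠ 0 → x - t ∈ closedBall a (R / 2) := fun t ht => by
      have h3 : ‖t‖ < R / 4 := by
        by_contra h; exact ht (cut_eq_zero hr (not_lt.1 h))
      have h4 : ‖x - a‖ < R / 4 := by simpa [dist_eq_norm] using hx
      rw [mem_closedBall, dist_eq_norm]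
      calc ‖x - t - a‖ = ‖(x - a) - t‖ := by ring_nf
        _ ≤ ‖x - a‖ + ‖t‖ := norm_sub_le _ _
        _ ≤ R / 2 := by linarith
    have hmemy : ∀ t : ℂ, cut (R / 4) t ≠ 0 → y - t ∈ closedBall b (R / 2) := fun t ht => by
      have h3 : ‖t‖ < R / 4 := by
        by_contra h; exact ht (cut_eq_zero hr (not_lt.1 h))
      have h4 : ‖y - b‖ < R / 4 := by simpa [dist_eq_norm] using hy
      rw [mem_closedBall, dist_eq_norm]
      calc ‖y - t - b‖ = ‖(y - b) - t‖ := by ring_nf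
        _ ≤ ‖y - b‖ + ‖t‖ := norm_sub_le _ _
        _ ≤ R / 2 := by linarith
    have heq : ∀ t : ℂ × ℂ, ContinuousLinearMap.mul ℝ ℝ (f t)
        (K.indicator (fun p : ℂ × ℂ => u p.1 p.2) ((x, y) - t)) =
        cut (R / 4) t.1 * (cut (R / 4) t.2 * u (x - t.1) (y - t.2)) := by
      intro t
      rw [ContinuousLinearMap.mul_apply']
      by_cases ht1 : cut (R / 4) t.1 = 0
      · simp [hf, ht1]
      by_cases ht2 : cut (R / 4) t.2 = 0
      · simp [hf, ht2]
      rw [indicator_of_mem (show (x, y) - t ∈ K from ⟨hmemx _ ht1, hmemy _ ht2⟩)]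
      simp only [hf, Prod.fst_sub, Prod.snd_sub]
      ring
    rw [convolution_def]
    simp_rw [heq] at hex ⊢
    rw [Measure.volume_eq_prod] at hex ⊢
    rw [integral_prod _ hex]
    simp_rw [integral_const_mul]
    have h3 : ∀ t : ℂ, cut (R / 4) t * ∫ s, cut (R / 4) s * u (x - t) (y - s) =
        M * (cut (R / 4) t * u (x - t) y) := by
      intro t
      by_cases ht : cut (R / 4) t = 0
      · simp [ht]
      · have hxt : x - t ∈ ball a R := closedBall_subset_ball (half_lt_self hR) (hmemx t ht)
        rw [integral_cut_mul_harmonic hr (show R / 4 < R / 2 by linarith)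
          ((h2 _ hxt).mono (ball_subset_ball_of_mem
            (closedBall_subset_closedBall (by linarith) (ball_subset_closedBall hy))))]
        ring
    simp_rw [h3]
    have hyR : y ∈ ball b R := ball_subset_ball (by linarith) hy
    rw [integral_const_mul, integral_cut_mul_harmonic (u := fun η => u η y) hr
      (show R / 4 < R / 2 by linarith) ((h1 y hyR).mono (ball_subset_ball_of_mem
            (closedBall_subset_closedBall (by linarith) (ball_subset_closedBall hx))))]
    field_simp
    rfl
  refine (contDiffAt_const (c := (M * M)⁻¹) |>.mul hconv.contDiffAt).congr_of_eventuallyEq ?_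
  · filter_upwards [prod_mem_nhds (ball_mem_nhds a hr) (ball_mem_nhds b hr)] with p hp
    exact key p hp

/-- Mixed partial derivatives commute. -/
theorem fderiv_fderiv_comm {E : Type*} [NormedAddCommGroup E] [NormedSpace ℝ E]
    {F : ℂ × ℂ → E} {a b : ℂ} (hF : ContDiffAt ℝ 2 F (a, b)) (s t : ℂ) :
    fderiv ℝ (fun ζ => fderiv ℝ (fun η => F (η, ζ)) a s) b t =
      fderiv ℝ (fun η => fderiv ℝ (fun ζ => F (η, ζ)) b t) a s := by
  have hsym : IsSymmSndFDerivAt ℝ F (a, b) := hF.isSymmSndFDerivAt (by simp)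
  have hd : ∀ᶠ p in 𝓝 (a, b), DifferentiableAt ℝ F p := by
    filter_upwards [hF.eventually (by simp)] with p hp using hp.differentiableAt two_ne_zero
  have hd2 : DifferentiableAt ℝ (fderiv ℝ F) (a, b) :=
    (hF.fderiv_right (m := 1) (by norm_num)).differentiableAt one_ne_zero
  have hη : ∀ p : ℂ × ℂ, DifferentiableAt ℝ F p →
      ∀ v, fderiv ℝ (fun η => F (η, p.2)) p.1 v = fderiv ℝ F p (v, 0) := by
    intro p hp v
    have h := HasFDerivAt.comp (f := fun e : ℂ => (e, p.2)) p.1 hp.hasFDerivAt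
      (hasFDerivAt_prodMk_left p.1 p.2)
    have h' : HasFDerivAt (fun η => F (η, p.2)) _ p.1 := h
    rw [h'.fderiv]; simp
  have hζ : ∀ p : ℂ × ℂ, DifferentiableAt ℝ F p →
      ∀ v, fderiv ℝ (fun ζ => F (p.1, ζ)) p.2 v = fderiv ℝ F p (0, v) := by
    intro p hp v
    have h := HasFDerivAt.comp (f := fun e : ℂ => (p.1, e)) p.2 hp.hasFDerivAt
      (hasFDerivAt_prodMk_right p.1 p.2)
    have h' : HasFDerivAt (fun ζ => F (p.1, ζ)) _ p.2 := h
    rw [h'.fderiv]; simp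
  have e1 : (fun ζ => fderiv ℝ (fun η => F (η, ζ)) a s) =ᶠ[𝓝 b] fun ζ => fderiv ℝ F (a, ζ) (s, 0) := by
    filter_upwards [(Continuous.tendsto (f := fun ζ : ℂ => (a, ζ)) (by fun_prop) b).eventually hd]
      with ζ hζ using hη (a, ζ) hζ s
  have e2 : (fun η => fderiv ℝ (fun ζ => F (η, ζ)) b t) =ᶠ[𝓝 a] fun η => fderiv ℝ F (η, b) (0, t) := by
    filter_upwards [(Continuous.tendsto (f := fun η : ℂ => (η, b)) (by fun_prop) a).eventually hd]
      with η hη using hζ (η, b) hη t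
  rw [e1.fderiv_eq, e2.fderiv_eq]
  have h1 : HasFDerivAt (fun ζ => fderiv ℝ F (a, ζ) (s, 0)) _ b :=
    ((ContinuousLinearMap.apply ℝ E ((s, 0) : ℂ × ℂ)).hasFDerivAt.comp b
      (hd2.hasFDerivAt.comp b (hasFDerivAt_prodMk_right a b)))
  have h2 : HasFDerivAt (fun η => fderiv ℝ F (η, b) (0, t)) _ a :=
    ((ContinuousLinearMap.apply ℝ E ((0, t) : ℂ × ℂ)).hasFDerivAt.comp a
      (hd2.hasFDerivAt.comp a (hasFDerivAt_prodMk_left a b)))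
  rw [h1.fderiv, h2.fderiv]
  simpa using hsym.eq (0, t) (s, 0)

end SeparatelyHarmonic

/-! ### Changes of coordinates and two-forms -/

section RealDerivative

/-- The real derivative of a holomorphic function. -/
theorem hasFDerivAt_real {τ : ℂ → ℂ} {t ζ : ℂ} (h : HasDerivAt τ t ζ) :
    HasFDerivAt τ ((ContinuousLinearMap.toSpanSingleton ℂ t).restrictScalars ℝ) ζ :=
  h.hasFDerivAt.restrictScalars ℝ

/-- The real determinant of a complex-linear map is the norm of its complex determinant; so the
Jacobian of a holomorphic change of coordinates is the squared modulus of its derivative. -/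
theorem abs_det_toSpanSingleton (t : ℂ) :
    |((ContinuousLinearMap.toSpanSingleton ℂ t).restrictScalars ℝ).det| = ‖t‖ ^ 2 := by
  have h : LinearMap.det (ContinuousLinearMap.toSpanSingleton ℂ t : ℂ →ₗ[ℂ] ℂ) = t := by
    rw [LinearMap.det_ring]; simp
  have h2 : ((ContinuousLinearMap.toSpanSingleton ℂ t).restrictScalars ℝ).det = ‖t‖ ^ 2 := by
    change LinearMap.det ((ContinuousLinearMap.toSpanSingleton ℂ t : ℂ →ₗ[ℂ] ℂ).restrictScalars ℝ) = _
    rw [LinearMap.det_restrictScalars, h, Algebra.norm_complex_eq]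
    exact Complex.normSq_eq_norm_sq t
  rw [h2, abs_of_nonneg (by positivity)]

end RealDerivative

section Transition

variable {R : Type*} [TopologicalSpace R] [ChartedSpace ℂ R]

theorem transition_mem {e f : atlas ℂ R} {ζ : ℂ} {U : Set R} (hζ : ζ ∈ chartImage e U)
    (hf : e.1.symm ζ ∈ f.1.source) : transition e f ζ ∈ chartImage f U := by
  refine ⟨f.1.map_source hf, ?_⟩
  simp only [transition, mem_preimage]
  rw [f.1.left_inv hf]
  exact hζ.2

theorem symm_transition {e f : atlas ℂ R} {ζ : ℂ} (hf : e.1.symm ζ ∈ f.1.source) :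
    f.1.symm (transition e f ζ) = e.1.symm ζ := f.1.left_inv hf

theorem transition_transition {e f : atlas ℂ R} {ζ : ℂ} (hζ : ζ ∈ e.1.target)
    (hf : e.1.symm ζ ∈ f.1.source) : transition f e (transition e f ζ) = ζ := by
  rw [transition, symm_transition hf, e.1.right_inv hζ]

theorem chartImage_mono (e : atlas ℂ R) {U V : Set R} (h : U ⊆ V) :
    chartImage e U ⊆ chartImage e V := fun _ hζ => ⟨hζ.1, h hζ.2⟩

theorem mem_chartImage {e : atlas ℂ R} {U : Set R} {x : R} (hx : x ∈ e.1.source) (hU : x ∈ U) :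
    e.1 x ∈ chartImage e U :=
  ⟨e.1.map_source hx, by rw [mem_preimage, e.1.left_inv hx]; exact hU⟩

theorem continuousAt_symm {e : atlas ℂ R} {ζ : ℂ} (hζ : ζ ∈ e.1.target) :
    ContinuousAt e.1.symm ζ := e.1.continuousAt_symm hζ

/-- The family `F e dx dy` represents a two-form on `U`. -/
def IsTwoForm (U : Set R) (F : atlas ℂ R → ℂ → ℂ) : Prop :=
  ∀ e f : atlas ℂ R, ∀ ζ ∈ chartImage e U, e.1.symm ζ ∈ f.1.source →
    F e ζ = F f (transition e f ζ) * (‖deriv (transition e f) ζ‖ ^ 2 : ℝ)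

/-! ### The cells of the fixed cover, seen in an arbitrary chart -/

section Cells

variable [CompactSpace R]

/-- The cell of index `i` seen in the chart `e`. -/
def cellIn (e : atlas ℂ R) (U : Set R) (i : Fin (coverCard R)) : Set ℂ :=
  {ζ | ζ ∈ chartImage e U ∧ e.1.symm ζ ∈ (coverChart R i).1.source ∧
    ∀ j < i, e.1.symm ζ ∉ (coverChart R j).1.source}

theorem measurableSet_cellIn (e : atlas ℂ R) {U : Set R} (hU : IsOpen U)
    (i : Fin (coverCard R)) : MeasurableSet (cellIn e U i) := by
  have : cellIn e U i = (chartImage e U ∩ chartImage e (coverChart R i).1.source) ∩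
      ⋂ j, ⋂ (_ : j < i), (chartImage e (coverChart R j).1.source)ᶜ := by
    ext ζ
    simp only [cellIn, chartImage, mem_ofPred_eq, mem_inter_iff, mem_preimage, mem_iInter,
      mem_compl_iff, not_and]
    constructor
    · rintro ⟨h1, h2, h3⟩
      exact ⟨⟨h1, h1.1, h2⟩, fun j hj _ => h3 j hj⟩
    · rintro ⟨⟨h1, _, h2⟩, h3⟩
      exact ⟨h1, h2, fun j hj => h3 j hj h1.1⟩
  rw [this]
  refine ((isOpen_chartImage _ hU).inter
    (isOpen_chartImage _ (coverChart R i).1.open_source)).measurableSet.inter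
    (MeasurableSet.iInter fun j => MeasurableSet.iInter fun _ => ?_)
  exact (isOpen_chartImage _ (coverChart R j).1.open_source).measurableSet.compl

theorem iUnion_cellIn (e : atlas ℂ R) (U : Set R) : ⋃ i, cellIn e U i = chartImage e U := by
  ext ζ
  refine ⟨fun h => ?_, fun h => ?_⟩
  · obtain ⟨i, hi⟩ := mem_iUnion.1 h
    exact hi.1
  -- The cell of a point is given by the least index of a chart around it.
  · obtain ⟨i, hi, hmin⟩ := WellFounded.has_min (wellFounded_lt (α := Fin (coverCard R)))
      {i | e.1.symm ζ ∈ (coverChart R i).1.source} (coverChart_covers R _)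
    exact mem_iUnion.2 ⟨i, h, hi, fun j hj hj' => hmin j hj' hj⟩

theorem disjoint_cellIn (e : atlas ℂ R) (U : Set R) :
    Pairwise (Function.onFun Disjoint (cellIn e U)) := by
  intro i j hij
  rw [Function.onFun, Set.disjoint_left]
  intro ζ hi hj
  rcases lt_or_gt_of_ne hij with h | h
  · exact hj.2.2 i h hi.2.1
  · exact hi.2.2 j h hj.2.1

/-- Both sets show the same points of the surface in different coordinates. This is the domain
identity needed to change variables between the chart `e` and the charts of the cover. -/
theorem image_cellIn (e : atlas ℂ R) (U : Set R) (i : Fin (coverCard R)) :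
    transition e (coverChart R i) '' cellIn e U i =
      cell U i ∩ chartImage (coverChart R i) e.1.source := by
  ext η
  constructor
  · rintro ⟨ζ, hζ, rfl⟩
    have hm := transition_mem hζ.1 hζ.2.1
    refine ⟨⟨hm, fun j hj hj' => hζ.2.2 j hj ?_⟩, hm.1, ?_⟩
    · have := hj'.2
      rwa [mem_preimage, symm_transition hζ.2.1] at this
    · rw [mem_preimage, symm_transition hζ.2.1]
      exact e.1.map_target hζ.1.1
  · rintro ⟨hη, hη'⟩
    have hs : (coverChart R i).1.symm η ∈ (coverChart R i).1.source :=
      (coverChart R i).1.map_target hη'.1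
    have h1 : e.1.symm (transition (coverChart R i) e η) = (coverChart R i).1.symm η :=
      symm_transition hη'.2
    refine ⟨transition (coverChart R i) e η, ⟨transition_mem hη.1 hη'.2, ?_, ?_⟩,
      transition_transition hη'.1 hη'.2⟩
    · rwa [h1]
    · intro j hj
      rw [h1]
      exact fun h => hη.2 j hj ⟨hη'.1, h⟩

theorem injOn_transition (e : atlas ℂ R) (U : Set R) (i : Fin (coverCard R)) :
    InjOn (transition e (coverChart R i)) (cellIn e U i) := by
  intro x hx y hy hxy
  rw [← transition_transition hx.1.1 hx.2.1, hxy, transition_transition hy.1.1 hy.2.1]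

/-- The transformation law of a two-form, put into the shape of the integrand in the change of
variables formula. -/
theorem IsTwoForm.smul_det {U : Set R} {F : atlas ℂ R → ℂ → ℂ} (hF : IsTwoForm U F)
    (e : atlas ℂ R) (i : Fin (coverCard R)) : EqOn (F e) (fun ζ =>
      |((ContinuousLinearMap.toSpanSingleton ℂ
        (deriv (transition e (coverChart R i)) ζ)).restrictScalars ℝ).det| •
        F (coverChart R i) (transition e (coverChart R i) ζ)) (cellIn e U i) := fun ζ hζ => by
  simp only [abs_det_toSpanSingleton]
  rw [hF e _ ζ hζ.1 hζ.2.1, Complex.real_smul, mul_comm]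

theorem surfaceIntegral_add {U : Set R} {F G : atlas ℂ R → ℂ → ℂ} (hF : SurfaceIntegrable U F)
    (hG : SurfaceIntegrable U G) :
    surfaceIntegral U (fun e ζ => F e ζ + G e ζ) = surfaceIntegral U F + surfaceIntegral U G := by
  simp only [surfaceIntegral, ← Finset.sum_add_distrib]
  exact Finset.sum_congr rfl fun i _ => integral_add (hF i) (hG i)

theorem surfaceIntegral_const_mul {U : Set R} {F : atlas ℂ R → ℂ → ℂ} (c : ℂ) :
    surfaceIntegral U (fun e ζ => c * F e ζ) = c * surfaceIntegral U F := by
  simp only [surfaceIntegral, integral_const_mul, Finset.mul_sum]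

theorem surfaceIntegral_congr {U : Set R} (hU : IsOpen U) {F G : atlas ℂ R → ℂ → ℂ}
    (h : ∀ e, ∀ ζ ∈ chartImage e U, F e ζ = G e ζ) : surfaceIntegral U F = surfaceIntegral U G :=
  Finset.sum_congr rfl fun i _ =>
    setIntegral_congr_fun (measurableSet_cell hU i) fun ζ hζ => h _ ζ hζ.1

theorem surfaceIntegral_sum {U : Set R} {ι : Type*} [Fintype ι] {F : ι → atlas ℂ R → ℂ → ℂ}
    (hF : ∀ j, SurfaceIntegrable U (F j)) :
    surfaceIntegral U (fun e ζ => ∑ j, F j e ζ) = ∑ j, surfaceIntegral U (F j) := by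
  simp only [surfaceIntegral]
  rw [Finset.sum_comm]
  exact Finset.sum_congr rfl fun i _ => integral_finsetSum _ fun j _ => hF j i

end Cells

variable [IsManifold 𝓘(ℂ, ℂ) ω R]

theorem analyticAt_transition {e f : atlas ℂ R} {ζ : ℂ} (hζ : ζ ∈ e.1.target)
    (hf : e.1.symm ζ ∈ f.1.source) : AnalyticAt ℂ (transition e f) ζ := by
  have h := HasGroupoid.compatible (G := contDiffGroupoid ω 𝓘(ℂ, ℂ)) e.2 f.2
  rw [contDiffGroupoid, mem_groupoid_of_pregroupoid] at h
  have h1 := h.1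
  simp only [contDiffPregroupoid] at h1
  have h2 : ContDiffOn ℂ ω (fun x => f.1 (e.1.symm x))
      (e.1.target ∩ e.1.symm ⁻¹' f.1.source) := by
    simpa [Function.comp_def, OpenPartialHomeomorph.trans_source] using h1
  have ho : IsOpen (e.1.target ∩ e.1.symm ⁻¹' f.1.source) :=
    e.1.isOpen_inter_preimage_symm f.1.open_source
  exact (h2.contDiffAt (ho.mem_nhds ⟨hζ, hf⟩)).analyticAt

variable [CompactSpace R]

theorem hasFDerivWithinAt_transition (e : atlas ℂ R) (U : Set R) (i : Fin (coverCard R)) :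
    ∀ ζ ∈ cellIn e U i, HasFDerivWithinAt (transition e (coverChart R i))
      ((ContinuousLinearMap.toSpanSingleton ℂ
        (deriv (transition e (coverChart R i)) ζ)).restrictScalars ℝ) (cellIn e U i) ζ :=
  fun _ hζ => (hasFDerivAt_real (analyticAt_transition hζ.1.1
    hζ.2.1).differentiableAt.hasDerivAt).hasFDerivWithinAt

/-- The integral of a nonnegative two-form over a chart is the sum of its integrals over the parts of
the cells covered by that chart. -/
theorem lintegral_chartImage_eq {U : Set R} (hU : IsOpen U) {F : atlas ℂ R → ℂ → ℝ≥0∞}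
    (hF : ∀ e f : atlas ℂ R, ∀ ζ ∈ chartImage e U, e.1.symm ζ ∈ f.1.source →
      F e ζ = ENNReal.ofReal (‖deriv (transition e f) ζ‖ ^ 2) * F f (transition e f ζ))
    (e : atlas ℂ R) : ∫⁻ ζ in chartImage e U, F e ζ =
      ∑ i, ∫⁻ ζ in cell U i ∩ chartImage (coverChart R i) e.1.source, F (coverChart R i) ζ := by
  rw [← iUnion_cellIn e U, lintegral_iUnion (measurableSet_cellIn e hU) (disjoint_cellIn e U),
    tsum_fintype]
  refine Finset.sum_congr rfl fun i _ => ?_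
  rw [← image_cellIn, lintegral_image_eq_lintegral_abs_det_fderiv_mul volume
    (measurableSet_cellIn e hU i) (hasFDerivWithinAt_transition e U i) (injOn_transition e U i)]
  refine setLIntegral_congr_fun (measurableSet_cellIn e hU i) fun ζ hζ => ?_
  simp only [abs_det_toSpanSingleton]
  exact hF e _ ζ hζ.1 hζ.2.1

/-- The integral of a two-form which vanishes off the domain of a chart can be computed in that
chart. -/
theorem surfaceIntegral_eq_integral_chart {U : Set R} (hU : IsOpen U) {F : atlas ℂ R → ℂ → ℂ}
    (hF : IsTwoForm U F) (e : atlas ℂ R)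
    (h0 : ∀ f, ∀ η ∈ chartImage f U, f.1.symm η ∉ e.1.source → F f η = 0)
    (hint : IntegrableOn (F e) (chartImage e U)) :
    SurfaceIntegrable U F ∧ surfaceIntegral U F = ∫ ζ in chartImage e U, F e ζ := by
  have hsub : ∀ i, cell U i ∩ chartImage (coverChart R i) e.1.source ⊆ cell U i :=
    fun i => inter_subset_left
  have hz : ∀ i, ∀ η ∈ cell U i \ (cell U i ∩ chartImage (coverChart R i) e.1.source),
      F (coverChart R i) η = 0 := fun i η hη =>
    h0 _ η hη.1.1 fun h => hη.2 ⟨hη.1, hη.1.1.1, h⟩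
  have hm := measurableSet_cellIn e hU
  refine ⟨fun i => ?_, ?_⟩
  · refine IntegrableOn.of_forall_sdiff_eq_zero ?_ (measurableSet_cell hU i) (hz i)
    rw [← image_cellIn, integrableOn_image_iff_integrableOn_abs_det_fderiv_smul volume (hm i)
      (hasFDerivWithinAt_transition e U i) (injOn_transition e U i)]
    exact (hint.mono_set fun ζ hζ => hζ.1).congr_fun (hF.smul_det e i) (hm i)
  · rw [← iUnion_cellIn e U] at hint ⊢
    rw [integral_iUnion_fintype hm (disjoint_cellIn e U) (fun i => hint.mono_set
      (subset_iUnion _ i)), surfaceIntegral]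
    refine Finset.sum_congr rfl fun i _ => ?_
    rw [setIntegral_eq_of_subset_of_forall_sdiff_eq_zero (measurableSet_cell hU i) (hsub i) (hz i),
      ← image_cellIn, integral_image_eq_integral_abs_det_fderiv_smul volume (hm i)
      (hasFDerivWithinAt_transition e U i) (injOn_transition e U i)]
    exact setIntegral_congr_fun (hm i) (hF.smul_det e i).symm

end Transition

/-! ### Stokes' theorem -/

section Stokes

variable {R : Type*} [TopologicalSpace R] [ChartedSpace ℂ R]

/-- The function `v` is of class `C^n` at `x` in all coordinates around `x`. -/
def SmoothAt {F : Type*} [NormedAddCommGroup F] [NormedSpace ℝ F] (n : WithTop ℕ∞) (v : R → F)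
    (x : R) : Prop :=
  ∀ e : atlas ℂ R, x ∈ e.1.source → ContDiffAt ℝ n (fun ζ => v (e.1.symm ζ)) (e.1 x)

/-- The coefficients `a e` represent a `(1, 0)`-form of class `C¹` on `U`. -/
structure IsSmoothForm (U : Set R) (a : atlas ℂ R → ℂ → ℂ) : Prop where
  smooth : ∀ e, ContDiffOn ℝ 1 (a e) (chartImage e U)
  transform : ∀ e f : atlas ℂ R, ∀ ζ ∈ chartImage e U, e.1.symm ζ ∈ f.1.source →
    a e ζ = a f (transition e f ζ) * deriv (transition e f) ζ

theorem IsHolomorphicForm.isSmoothForm {U : Set R} (hU : IsOpen U) {a : atlas ℂ R → ℂ → ℂ}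
    (h : IsHolomorphicForm U a) : IsSmoothForm U a :=
  ⟨fun e => ((h.holomorphic e).contDiffOn (isOpen_chartImage e hU)).restrict_scalars ℝ,
    h.transform⟩

variable {F : Type*} [NormedAddCommGroup F] [NormedSpace ℝ F] {n : WithTop ℕ∞} {v : R → F}

theorem SmoothAt.contDiffOn {U : Set R} (h : ∀ x ∈ U, SmoothAt n v x) (e : atlas ℂ R) :
    ContDiffOn ℝ n (fun ζ => v (e.1.symm ζ)) (chartImage e U) := by
  intro ζ hζ
  have := h _ hζ.2 e (e.1.map_target hζ.1)
  rw [e.1.right_inv hζ.1] at this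
  exact this.contDiffWithinAt

theorem IsSmoothForm.mul {U : Set R} {a : atlas ℂ R → ℂ → ℂ} (ha : IsSmoothForm U a)
    {v : R → ℂ} (hv : ∀ x ∈ U, SmoothAt 1 v x) :
    IsSmoothForm U fun e ζ => v (e.1.symm ζ) * a e ζ :=
  ⟨fun e => (SmoothAt.contDiffOn hv e).mul (ha.smooth e), fun e f ζ hζ hf => by
    rw [symm_transition hf, ha.transform e f ζ hζ hf, mul_assoc]⟩

/-- In a Hausdorff space `K` is closed, so the form vanishes in a neighbourhood of each point off
`K`, and its derivatives vanish there too. -/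
theorem wirtingerBar_form_eq_zero [T2Space R] {U K : Set R} (hU : IsOpen U) (hK : IsCompact K)
    {a : atlas ℂ R → ℂ → ℂ}
    (h0 : ∀ e, ∀ ζ ∈ chartImage e U, e.1.symm ζ ∉ K → a e ζ = 0) :
    ∀ e, ∀ ζ ∈ chartImage e U, e.1.symm ζ ∉ K → wirtingerBar (a e) ζ = 0 := by
  intro e ζ hζ hK'
  have h1 : a e =ᶠ[𝓝 ζ] fun _ => 0 := by
    filter_upwards [(isOpen_chartImage e hU).mem_nhds hζ,
      (continuousAt_symm hζ.1).eventually (hK.isClosed.isOpen_compl.mem_nhds hK')] with z hz hz'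
    exact h0 e z hz hz'
  rw [wirtingerBar_congr h1]
  simp [wirtingerBar]

theorem isCompact_image_chart {e : atlas ℂ R} {K : Set R} (hK : IsCompact K)
    (hKe : K ⊆ e.1.source) : IsCompact (e.1 '' K) :=
  hK.image_of_continuousOn (e.1.continuousOn.mono hKe)

theorem image_chart_subset {e : atlas ℂ R} {K U : Set R} (hKe : K ⊆ e.1.source) (hKU : K ⊆ U) :
    e.1 '' K ⊆ chartImage e U := by
  rintro _ ⟨x, hx, rfl⟩
  exact mem_chartImage (hKe hx) (hKU hx)

theorem symm_notMem_of_notMem_image {e : atlas ℂ R} {K U : Set R} {ζ : ℂ}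
    (hζ : ζ ∈ chartImage e U) (h : ζ ∉ e.1 '' K) : e.1.symm ζ ∉ K :=
  fun hK => h ⟨_, hK, e.1.right_inv hζ.1⟩

theorem integrableOn_chart_of_compact {U K : Set R} (hU : IsOpen U) (hK : IsCompact K)
    (hKU : K ⊆ U) {e : atlas ℂ R} (hKe : K ⊆ e.1.source) {F : atlas ℂ R → ℂ → ℂ}
    (hc : ContinuousOn (F e) (chartImage e U))
    (h0 : ∀ ζ ∈ chartImage e U, e.1.symm ζ ∉ K → F e ζ = 0) :
    IntegrableOn (F e) (chartImage e U) := by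
  refine ((hc.mono (image_chart_subset hKe hKU)).integrableOn_compact
    (isCompact_image_chart hK hKe)).of_forall_sdiff_eq_zero
    (isOpen_chartImage e hU).measurableSet fun ζ hζ => ?_
  exact h0 ζ hζ.1 (symm_notMem_of_notMem_image hζ.1 hζ.2)

/-- Stokes' theorem for a form supported in one chart. -/
theorem integral_chart_wirtingerBar_eq_zero [T2Space R] {U K : Set R} (hU : IsOpen U)
    (hK : IsCompact K) (hKU : K ⊆ U) {e : atlas ℂ R} (hKe : K ⊆ e.1.source)
    {a : atlas ℂ R → ℂ → ℂ} (ha : IsSmoothForm U a)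
    (h0 : ∀ e, ∀ ζ ∈ chartImage e U, e.1.symm ζ ∉ K → a e ζ = 0) :
    ∫ ζ in chartImage e U, wirtingerBar (a e) ζ = 0 := by
  have ho := isOpen_chartImage e hU
  -- The extension by zero is C¹ on the plane: the support lies in the compact image of `K`, which
  -- stays away from every point outside the chart image.
  set ψ := (chartImage e U).indicator (a e) with hψ
  have hKc := isCompact_image_chart hK hKe
  have hψ0 : ∀ ζ, ζ ∉ e.1 '' K → ψ ζ = 0 := by
    intro ζ hζ
    by_cases h : ζ ∈ chartImage e U
    · rw [hψ, indicator_of_mem h]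
      exact h0 e ζ h (symm_notMem_of_notMem_image h hζ)
    · exact indicator_of_notMem h _
  have hψe : ∀ ζ ∈ chartImage e U, ψ =ᶠ[𝓝 ζ] a e := fun ζ hζ => by
    filter_upwards [ho.mem_nhds hζ] with z hz using indicator_of_mem hz _
  have hψn : ∀ ζ, ζ ∉ e.1 '' K → ψ =ᶠ[𝓝 ζ] fun _ => 0 := fun ζ hζ => by
    filter_upwards [hKc.isClosed.isOpen_compl.mem_nhds hζ] with z hz using hψ0 z hz
  have hs : ContDiff ℝ 1 ψ := by
    rw [contDiff_iff_contDiffAt]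
    intro ζ
    by_cases h : ζ ∈ chartImage e U
    · exact ((ha.smooth e).contDiffAt (ho.mem_nhds h)).congr_of_eventuallyEq (hψe ζ h)
    · exact contDiffAt_const.congr_of_eventuallyEq
        (hψn ζ fun h' => h (image_chart_subset hKe hKU h'))
  rw [← integral_wirtingerBar_eq_zero hs (HasCompactSupport.of_support_subset_isCompact hKc
    fun ζ hζ => by by_contra h; exact hζ (hψ0 ζ h)),
    ← setIntegral_eq_integral_of_forall_compl_eq_zero (s := chartImage e U) (f := wirtingerBar ψ)]
  · exact setIntegral_congr_fun ho.measurableSet fun ζ hζ => (wirtingerBar_congr (hψe ζ hζ)).symm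
  · intro ζ hζ
    rw [wirtingerBar_congr (hψn ζ fun h' => hζ (image_chart_subset hKe hKU h'))]
    simp [wirtingerBar]

theorem IsTwoForm.mul {U : Set R} {F : atlas ℂ R → ℂ → ℂ} (hF : IsTwoForm U F) (v : R → ℂ) :
    IsTwoForm U fun e ζ => v (e.1.symm ζ) * F e ζ := fun e f ζ hζ hf => by
  simp only
  rw [symm_transition hf, hF e f ζ hζ hf, mul_assoc]

theorem IsSmoothForm.continuousOn_wirtingerBar {U : Set R} (hU : IsOpen U)
    {a : atlas ℂ R → ℂ → ℂ} (ha : IsSmoothForm U a) (e : atlas ℂ R) :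
    ContinuousOn (wirtingerBar (a e)) (chartImage e U) := fun ζ hζ =>
  (ContDiffAt.wirtingerBar (m := 0) ((ha.smooth e).contDiffAt
    ((isOpen_chartImage e hU).mem_nhds hζ)) (by norm_num)).continuousAt.continuousWithinAt

variable [IsManifold 𝓘(ℂ, ℂ) ω R]

/-- Smoothness can be checked in one chart. -/
theorem SmoothAt.of_chart {e : atlas ℂ R} {x : R} (hx : x ∈ e.1.source)
    (h : ContDiffAt ℝ n (fun ζ => v (e.1.symm ζ)) (e.1 x)) : SmoothAt n v x := by
  intro f hf
  have hmem : f.1.symm (f.1 x) ∈ e.1.source := by rwa [f.1.left_inv hf]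
  have hτ : ContDiffAt ℝ n (transition f e) (f.1 x) :=
    (analyticAt_transition (f.1.map_source hf) hmem).contDiffAt.restrict_scalars ℝ
  have h1 : transition f e (f.1 x) = e.1 x := by rw [transition, f.1.left_inv hf]
  rw [← h1] at h
  refine (h.comp _ hτ).congr_of_eventuallyEq ?_
  filter_upwards [(isOpen_chartImage f e.1.open_source).mem_nhds (mem_chartImage hf hx)] with z hz
  simp only [Function.comp_apply, symm_transition hz.2]

/-- Partitions of unity exist only over ℝ, so the surface is also needed as a real smooth manifold.
-/
theorem isManifold_real : IsManifold 𝓘(ℝ, ℂ) ((⊤ : ℕ∞) : WithTop ℕ∞) R := by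
  refine isManifold_of_contDiffOn _ _ R fun e f he hf => ?_
  have h : ContDiffOn ℝ ((⊤ : ℕ∞) : WithTop ℕ∞) (transition (⟨e, he⟩ : atlas ℂ R) ⟨f, hf⟩)
      (e.target ∩ e.symm ⁻¹' f.source) := fun ζ hζ =>
    ((analyticAt_transition (e := ⟨e, he⟩) (f := ⟨f, hf⟩) hζ.1
      hζ.2).contDiffAt.restrict_scalars ℝ).contDiffWithinAt
  have h2 : ContDiffOn ℝ ((⊤ : ℕ∞) : WithTop ℕ∞) (fun ζ => f (e.symm ζ))
      (e.target ∩ e.symm ⁻¹' f.source) := h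
  simpa [Function.comp_def, OpenPartialHomeomorph.trans_source] using h2

/-- For a holomorphic change of coordinates τ the factor τ' is not seen by ∂̄, and ∂̄ of the
composite brings out the conjugate of τ'; together they give |τ'|². -/
theorem IsSmoothForm.isTwoForm {U : Set R} (hU : IsOpen U) {a : atlas ℂ R → ℂ → ℂ}
    (ha : IsSmoothForm U a) : IsTwoForm U fun e => wirtingerBar (a e) := by
  intro e f ζ hζ hf
  have hτ := analyticAt_transition hζ.1 hf
  have hev : a e =ᶠ[𝓝 ζ] fun z => a f (transition e f z) * deriv (transition e f) z := by
    filter_upwards [(isOpen_chartImage e hU).mem_nhds hζ,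
      (isOpen_chartImage e f.1.open_source).mem_nhds ⟨hζ.1, hf⟩] with z hz hz'
    exact ha.transform e f z hz hz'.2
  have hd : DifferentiableAt ℝ (a f) (transition e f ζ) :=
    ((ha.smooth f).contDiffAt ((isOpen_chartImage f hU).mem_nhds
      (transition_mem hζ hf))).differentiableAt one_ne_zero
  have h := ((hasWirtinger hd).comp_hasDerivAt hτ.differentiableAt.hasDerivAt).mul
    (hasWirtinger_of_hasDerivAt hτ.deriv.differentiableAt.hasDerivAt)
  simp only
  rw [wirtingerBar_congr hev, h.wirtingerBar_eq, Complex.ofReal_pow, ← Complex.mul_conj']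
  ring

variable [CompactSpace R] [T2Space R]

/-- A smooth partition of unity subordinate to the fixed cover by charts. -/
theorem exists_partition : ∃ χ : Fin (coverCard R) → R → ℝ,
    (∀ j x, SmoothAt 1 (fun y => (χ j y : ℂ)) x) ∧
    (∀ j, tsupport (χ j) ⊆ (coverChart R j).1.source) ∧ ∀ x, ∑ j, χ j x = 1 := by
  have := isManifold_real (R := R)
  obtain ⟨f, hf⟩ := SmoothPartitionOfUnity.exists_isSubordinate 𝓘(ℝ, ℂ) (s := (univ : Set R))
    isClosed_univ (fun j : Fin (coverCard R) => (coverChart R j).1.source)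
    (fun j => (coverChart R j).1.open_source)
    (fun x _ => mem_iUnion.2 (coverChart_covers R x))
  refine ⟨fun j x => f j x, fun j x => ?_, hf, fun x => ?_⟩
  · have h1 := ((f j).contMDiff x)
    rw [contMDiffAt_iff] at h1
    have h2 := h1.2
    simp only [mfld_simps, contDiffWithinAt_univ] at h2
    refine SmoothAt.of_chart (e := ⟨chartAt ℂ x, chart_mem_atlas ℂ x⟩) (mem_chart_source ℂ x) ?_
    exact Complex.ofRealCLM.contDiff.contDiffAt.comp _ (h2.of_le (by exact_mod_cast le_top))
  · have := f.sum_eq_one (mem_univ x)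
    rwa [finsum_eq_sum_of_fintype] at this

/-- A continuous two-form with compact support is integrable. -/
theorem surfaceIntegrable_of_compact {U K : Set R} (hU : IsOpen U) (hK : IsCompact K)
    (hKU : K ⊆ U) {F : atlas ℂ R → ℂ → ℂ} (hF : IsTwoForm U F)
    (hc : ∀ e, ContinuousOn (F e) (chartImage e U))
    (h0 : ∀ e, ∀ ζ ∈ chartImage e U, e.1.symm ζ ∉ K → F e ζ = 0) : SurfaceIntegrable U F := by
  obtain ⟨χ, hχ, hsupp, hsum⟩ := exists_partition (R := R)
  have hj : ∀ j, SurfaceIntegrable U fun e ζ => (χ j (e.1.symm ζ) : ℂ) * F e ζ := by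
    intro j
    have h0' : ∀ e, ∀ ζ ∈ chartImage e U, e.1.symm ζ ∉ K ∩ tsupport (χ j) →
        (χ j (e.1.symm ζ) : ℂ) * F e ζ = 0 := by
      intro e ζ hζ h
      by_cases hK' : e.1.symm ζ ∈ K
      · rw [image_eq_zero_of_notMem_tsupport fun h' => h ⟨hK', h'⟩]; simp
      · rw [h0 e ζ hζ hK', mul_zero]
    refine (surfaceIntegral_eq_integral_chart hU (hF.mul fun x => (χ j x : ℂ)) (coverChart R j)
      (fun f η hη h => h0' f η hη fun h' => h (hsupp j h'.2)) ?_).1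
    exact integrableOn_chart_of_compact (F := fun e ζ => (χ j (e.1.symm ζ) : ℂ) * F e ζ) hU
      (hK.inter_right (isClosed_tsupport _))
      (inter_subset_left.trans hKU) (inter_subset_right.trans (hsupp j))
      ((SmoothAt.contDiffOn (fun x _ => hχ j x) _).continuousOn.mul (hc _)) (h0' _)
  intro i
  have h := integrable_finsetSum Finset.univ fun j _ => hj j i
  refine h.congr (ae_of_all _ fun ζ => ?_)
  simp only
  rw [← Finset.sum_mul, ← Complex.ofReal_sum, hsum]
  simp

/-- Stokes' theorem for a `(1, 0)`-form with compact support. -/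
theorem surfaceIntegral_wirtingerBar_eq_zero {U K : Set R} (hU : IsOpen U) (hK : IsCompact K)
    (hKU : K ⊆ U) {a : atlas ℂ R → ℂ → ℂ} (ha : IsSmoothForm U a)
    (h0 : ∀ e, ∀ ζ ∈ chartImage e U, e.1.symm ζ ∉ K → a e ζ = 0) :
    surfaceIntegral U (fun e => wirtingerBar (a e)) = 0 := by
  obtain ⟨χ, hχ, hsupp, hsum⟩ := exists_partition (R := R)
  -- Each piece is supported in a single chart, where Stokes' theorem is the statement in the plane;
  -- the pieces add up to `a`.
  set b : Fin (coverCard R) → atlas ℂ R → ℂ → ℂ := fun j e ζ => (χ j (e.1.symm ζ) : ℂ) * a e ζ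
    with hb
  have hbs : ∀ j, IsSmoothForm U (b j) := fun j => ha.mul fun x _ => hχ j x
  have hb0 : ∀ j e, ∀ ζ ∈ chartImage e U, e.1.symm ζ ∉ K ∩ tsupport (χ j) → b j e ζ = 0 := by
    intro j e ζ hζ h
    by_cases hK' : e.1.symm ζ ∈ K
    · simp only [hb]
      rw [image_eq_zero_of_notMem_tsupport fun h' => h ⟨hK', h'⟩]; simp
    · simp only [hb]
      rw [h0 e ζ hζ hK', mul_zero]
  have hKj : ∀ j, IsCompact (K ∩ tsupport (χ j)) := fun j => hK.inter_right (isClosed_tsupport _)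
  have hKjU : ∀ j, K ∩ tsupport (χ j) ⊆ U := fun j => inter_subset_left.trans hKU
  have hKjs : ∀ j, K ∩ tsupport (χ j) ⊆ (coverChart R j).1.source :=
    fun j => inter_subset_right.trans (hsupp j)
  have hd0 := fun j => wirtingerBar_form_eq_zero hU (hKj j) (hb0 j)
  have hmain : ∀ j, SurfaceIntegrable U (fun e => wirtingerBar (b j e)) ∧
      surfaceIntegral U (fun e => wirtingerBar (b j e)) = 0 := by
    intro j
    have h := surfaceIntegral_eq_integral_chart hU ((hbs j).isTwoForm hU) (coverChart R j)
      (fun f η hη h => hd0 j f η hη fun h' => h (hKjs j h'))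
      (integrableOn_chart_of_compact (F := fun e => wirtingerBar (b j e)) hU (hKj j) (hKjU j)
        (hKjs j) ((hbs j).continuousOn_wirtingerBar hU _) (hd0 j _))
    exact ⟨h.1, h.2.trans
      (integral_chart_wirtingerBar_eq_zero hU (hKj j) (hKjU j) (hKjs j) (hbs j) (hb0 j))⟩
  have hsum' : ∀ e, ∀ ζ ∈ chartImage e U,
      wirtingerBar (a e) ζ = ∑ j, wirtingerBar (b j e) ζ := by
    intro e ζ hζ
    have hd : ∀ j ∈ Finset.univ, DifferentiableAt ℝ (b j e) ζ := fun j _ =>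
      (((hbs j).smooth e).contDiffAt ((isOpen_chartImage e hU).mem_nhds hζ)).differentiableAt
        one_ne_zero
    have h1 : a e = fun z => ∑ j, b j e z := by
      ext z
      simp only [hb]
      rw [← Finset.sum_mul, ← Complex.ofReal_sum, hsum]
      simp
    have h2 := fderiv_fun_sum hd
    simp only [wirtingerBar]
    conv_lhs => rw [h1, h2]
    simp only [_root_.sum_apply]
    rw [Finset.mul_sum, ← Finset.sum_add_distrib, Finset.sum_div]
  rw [surfaceIntegral_congr hU hsum', surfaceIntegral_sum fun j => (hmain j).1]
  exact Finset.sum_eq_zero fun j _ => (hmain j).2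

end Stokes

/-! ### Functions which vanish on the boundary -/

section Truncation

/-- A `C¹` truncation of the identity, which vanishes on `[-ε, ε]`. -/
def trunc (ε t : ℝ) : ℝ := ∫ s in (0 : ℝ)..t, (1 - (ε / max |s| ε) ^ 2)

variable {ε : ℝ}

theorem continuous_trunc_integrand (hε : 0 < ε) :
    Continuous fun s : ℝ => 1 - (ε / max |s| ε) ^ 2 := by
  refine continuous_const.sub ((continuous_const.div (by fun_prop) fun s => ?_).pow 2)
  exact (hε.trans_le (le_max_right _ _)).ne'

theorem hasDerivAt_trunc (hε : 0 < ε) (t : ℝ) :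
    HasDerivAt (trunc ε) (1 - (ε / max |t| ε) ^ 2) t :=
  (continuous_trunc_integrand hε).integral_hasStrictDerivAt 0 t |>.hasDerivAt

theorem contDiff_trunc (hε : 0 < ε) : ContDiff ℝ 1 (trunc ε) := by
  rw [contDiff_one_iff_deriv]
  refine ⟨fun t => (hasDerivAt_trunc hε t).differentiableAt, ?_⟩
  rw [show deriv (trunc ε) = _ from funext fun t => (hasDerivAt_trunc hε t).deriv]
  exact continuous_trunc_integrand hε

theorem trunc_deriv_mem (hε : 0 < ε) (t : ℝ) : 1 - (ε / max |t| ε) ^ 2 ∈ Icc (0 : ℝ) 1 := by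
  have h : 0 < max |t| ε := hε.trans_le (le_max_right _ _)
  have h1 : ε / max |t| ε ≤ 1 := (div_le_one h).2 (le_max_right _ _)
  have h0 : 0 ≤ ε / max |t| ε := by positivity
  constructor <;> nlinarith

theorem trunc_deriv_eq_zero (hε : 0 < ε) {t : ℝ} (ht : |t| ≤ ε) :
    1 - (ε / max |t| ε) ^ 2 = 0 := by
  rw [max_eq_right ht, div_self hε.ne']; norm_num

theorem trunc_eq_zero (hε : 0 < ε) {t : ℝ} (ht : |t| ≤ ε) : trunc ε t = 0 := by
  rw [trunc, intervalIntegral.integral_congr (g := fun _ => (0 : ℝ))]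
  · simp
  · intro s hs
    refine trunc_deriv_eq_zero hε (le_trans ?_ ht)
    rcases le_total 0 t with h | h
    · rw [uIcc_of_le h] at hs
      rw [abs_of_nonneg hs.1, abs_of_nonneg h]; exact hs.2
    · rw [uIcc_of_ge h] at hs
      rw [abs_of_nonpos hs.2, abs_of_nonpos h]; linarith [hs.1]

theorem abs_trunc_le (hε : 0 < ε) (t : ℝ) : |trunc ε t| ≤ |t| := by
  have h := intervalIntegral.norm_integral_le_of_norm_le_const (a := 0) (b := t) (C := 1)
    (f := fun s : ℝ => 1 - (ε / max |s| ε) ^ 2) fun s _ => by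
      have := trunc_deriv_mem hε s
      rw [Real.norm_eq_abs, abs_of_nonneg this.1]; exact this.2
  simpa [trunc] using h

/-- The limit is 1 only off `t = 0`, where the derivative of the truncation is 0 for all ε > 0. The
exception is harmless because ∂v vanishes almost everywhere on the zero set of v. -/
theorem tendsto_trunc_deriv {t : ℝ} (ht : t ≠ 0) :
    Tendsto (fun ε : ℝ => 1 - (ε / max |t| ε) ^ 2) (𝓝 0) (𝓝 1) := by
  have hc : ContinuousAt (fun ε : ℝ => 1 - (ε / max |t| ε) ^ 2) 0 := by
    refine continuousAt_const.sub ((continuousAt_id.div (by fun_prop) ?_).pow 2)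
    have : 0 < |t| := abs_pos.2 ht
    exact (this.trans_le (le_max_left _ _)).ne'
  have h := hc.tendsto
  simpa using h

theorem tendsto_trunc (t : ℝ) {u : ℕ → ℝ} (hu : ∀ n, 0 < u n) (hu0 : Tendsto u atTop (𝓝 0)) :
    Tendsto (fun n => trunc (u n) t) atTop (𝓝 t) := by
  have h := intervalIntegral.tendsto_integral_filter_of_dominated_convergence
    (μ := volume) (a := 0) (b := t) (l := atTop)
    (F := fun n s => 1 - (u n / max |s| (u n)) ^ 2) (f := fun _ => (1 : ℝ)) (fun _ => (1 : ℝ))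
    (Eventually.of_forall fun n => (continuous_trunc_integrand (hu n)).aestronglyMeasurable)
    (Eventually.of_forall fun n => ae_of_all _ fun s _ => by
      have := trunc_deriv_mem (hu n) s
      rw [Real.norm_eq_abs, abs_of_nonneg this.1]; exact this.2)
    intervalIntegrable_const ?_
  · simpa [trunc] using h
  · have : ∀ᵐ s : ℝ, s ≠ 0 := by simp [ae_iff]
    filter_upwards [this] with s hs _
    exact (tendsto_trunc_deriv hs).comp hu0

end Truncation

/-! ### Functions tending to zero at the boundary, and their derivatives as forms -/

section Energy

variable {R : Type*} [TopologicalSpace R] [ChartedSpace ℂ R]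

/-- The coefficients of `∂v`. -/
def del (v : R → ℝ) (e : atlas ℂ R) : ℂ → ℂ := wirtinger fun ζ => (v (e.1.symm ζ) : ℂ)

/-- The coefficients of the two-form `∂̄∂v`. -/
def lap (v : R → ℝ) (e : atlas ℂ R) : ℂ → ℂ := wirtingerBar (del v e)

/-- `v` is a `C²` function on `U` which tends to `0` at the boundary and is harmonic off a compact
subset. -/
structure VanishesAtBoundary (U : Set R) (v : R → ℝ) : Prop where
  smooth : ∀ x ∈ U, SmoothAt 2 v x
  boundary : ∀ ε > 0, ∃ K ⊆ U, IsCompact K ∧ ∀ x ∈ U, x ∉ K → |v x| < ε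
  harmonic : ∃ K ⊆ U, IsCompact K ∧ ∀ e, ∀ ζ ∈ chartImage e U, e.1.symm ζ ∉ K → lap v e ζ = 0

variable {U : Set R} {v : R → ℝ}

theorem SmoothAt.ofReal {n : WithTop ℕ∞} {x : R} (h : SmoothAt n v x) :
    SmoothAt n (fun y => (v y : ℂ)) x := fun e he =>
  Complex.ofRealCLM.contDiff.contDiffAt.comp _ (h e he)

theorem contDiffOn_ofReal (hs : ∀ x ∈ U, SmoothAt 2 v x) (e : atlas ℂ R) :
    ContDiffOn ℝ 2 (fun ζ => (v (e.1.symm ζ) : ℂ)) (chartImage e U) :=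
  SmoothAt.contDiffOn (fun x hx => (hs x hx).ofReal) e

/-- The Wirtinger derivatives of a truncation multiplied by a form. -/
theorem wirtingerBar_comp_mul (hU : IsOpen U) (hs : ∀ x ∈ U, SmoothAt 2 v x) {T : ℝ → ℝ}
    {T' : ℝ → ℝ} (hT : ∀ t, HasDerivAt T (T' t) t) {a : atlas ℂ R → ℂ → ℂ}
    (ha : IsSmoothForm U a) (e : atlas ℂ R) {ζ : ℂ} (hζ : ζ ∈ chartImage e U) :
    wirtingerBar (fun z => (T (v (e.1.symm z)) : ℂ) * a e z) ζ =
      T' (v (e.1.symm ζ)) * (conj (del v e ζ) * a e ζ) +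
        T (v (e.1.symm ζ)) * wirtingerBar (a e) ζ := by
  have hn := (isOpen_chartImage e hU).mem_nhds hζ
  have hv : DifferentiableAt ℝ (fun z => (v (e.1.symm z) : ℂ)) ζ :=
    ((contDiffOn_ofReal hs e).contDiffAt hn).differentiableAt two_ne_zero
  have hv' : DifferentiableAt ℝ (fun z => v (e.1.symm z)) ζ :=
    ((SmoothAt.contDiffOn hs e).contDiffAt hn).differentiableAt two_ne_zero
  have h := ((hasWirtinger hv).real_comp (hT _)).mul
    (hasWirtinger (((ha.smooth e).contDiffAt hn).differentiableAt one_ne_zero))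
  rw [h.wirtingerBar_eq, wirtingerBar_ofReal hv', del]
  ring

variable [IsManifold 𝓘(ℂ, ℂ) ω R]

theorem isSmoothForm_del (hU : IsOpen U) (hs : ∀ x ∈ U, SmoothAt 2 v x) :
    IsSmoothForm U (del v) := by
  refine ⟨fun e ζ hζ => ?_, fun e f ζ hζ hf => ?_⟩
  · exact (ContDiffAt.wirtinger (m := 1) ((contDiffOn_ofReal hs e).contDiffAt
      ((isOpen_chartImage e hU).mem_nhds hζ)) (by norm_num)).contDiffWithinAt
  · have hd : DifferentiableAt ℝ (fun z => (v (f.1.symm z) : ℂ)) (transition e f ζ) :=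
      ((contDiffOn_ofReal hs f).contDiffAt ((isOpen_chartImage f hU).mem_nhds
        (transition_mem hζ hf))).differentiableAt two_ne_zero
    have h := (hasWirtinger hd).comp_hasDerivAt
      (analyticAt_transition hζ.1 hf).differentiableAt.hasDerivAt
    have hev : (fun z => (v (e.1.symm z) : ℂ)) =ᶠ[𝓝 ζ]
        fun z => (v (f.1.symm (transition e f z)) : ℂ) := by
      filter_upwards [(isOpen_chartImage e f.1.open_source).mem_nhds ⟨hζ.1, hf⟩] with z hz
      rw [symm_transition hz.2]
    rw [del, wirtinger_congr hev, h.wirtinger_eq]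
    rfl

end Energy

/-! ### The Dirichlet integral of a function which vanishes on the boundary -/

section Dirichlet

variable {R : Type*} [TopologicalSpace R] [ChartedSpace ℂ R] {U : Set R} {v : R → ℝ}

theorem isTwoForm_conj_mul {a b : atlas ℂ R → ℂ → ℂ}
    (ha : ∀ e f : atlas ℂ R, ∀ ζ ∈ chartImage e U, e.1.symm ζ ∈ f.1.source →
      a e ζ = a f (transition e f ζ) * deriv (transition e f) ζ)
    (hb : ∀ e f : atlas ℂ R, ∀ ζ ∈ chartImage e U, e.1.symm ζ ∈ f.1.source →
      b e ζ = b f (transition e f ζ) * deriv (transition e f) ζ) :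
    IsTwoForm U fun e ζ => conj (b e ζ) * a e ζ := by
  intro e f ζ hζ hf
  simp only
  rw [ha e f ζ hζ hf, hb e f ζ hζ hf, map_mul, Complex.ofReal_pow, ← Complex.mul_conj']
  ring

theorem continuousOn_comp_ofReal (hs : ∀ x ∈ U, SmoothAt 2 v x) {T : ℝ → ℝ} (hT : Continuous T)
    (e : atlas ℂ R) : ContinuousOn (fun ζ => (T (v (e.1.symm ζ)) : ℂ)) (chartImage e U) :=
  Complex.continuous_ofReal.comp_continuousOn
    (hT.comp_continuousOn (SmoothAt.contDiffOn hs e).continuousOn)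

variable [CompactSpace R]

theorem integrable_conj_mul {a b : atlas ℂ R → ℂ → ℂ}
    (ha : ∀ i, MemLp (a (coverChart R i)) 2 (volume.restrict (cell U i)))
    (hb : ∀ i, MemLp (b (coverChart R i)) 2 (volume.restrict (cell U i))) :
    SurfaceIntegrable U fun e ζ => conj (b e ζ) * a e ζ := fun i =>
  (hb i).star.integrable_mul (ha i)

/-- This disposes of the zero set of `v`, the only place where the derivatives of the truncations do
not tend to 1. -/
theorem ae_del_eq_zero (hU : IsOpen U) (hs : ∀ x ∈ U, SmoothAt 2 v x) (i : Fin (coverCard R)) :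
    ∀ᵐ ζ ∂volume.restrict (cell U i), v ((coverChart R i).1.symm ζ) = 0 →
      del v (coverChart R i) ζ = 0 := by
  rw [ae_restrict_iff' (measurableSet_cell hU i)]
  filter_upwards [ae_wirtinger_eq_zero (isOpen_chartImage (coverChart R i) hU)
    ((SmoothAt.contDiffOn hs (coverChart R i)).of_le one_le_two)] with ζ h hζ h0
  exact h hζ.1 h0

theorem tendsto_trunc_deriv_nat {t : ℝ} (ht : t ≠ 0) :
    Tendsto (fun n : ℕ => 1 - ((1 / ((n : ℝ) + 1)) / max |t| (1 / ((n : ℝ) + 1))) ^ 2) atTop (𝓝 1) :=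
  (tendsto_trunc_deriv ht).comp tendsto_one_div_add_atTop_nhds_zero_nat

variable [IsManifold 𝓘(ℂ, ℂ) ω R] [T2Space R]

/-- Stokes' theorem for `T(v) a`, where `T` is a truncation. -/
theorem stokes_trunc (hU : IsOpen U) (hv : VanishesAtBoundary U v) {a : atlas ℂ R → ℂ → ℂ}
    (ha : IsSmoothForm U a) {ε : ℝ} (hε : 0 < ε) :
    SurfaceIntegrable U (fun e ζ => ((1 - (ε / max |v (e.1.symm ζ)| ε) ^ 2 : ℝ) : ℂ) *
      (conj (del v e ζ) * a e ζ)) ∧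
    SurfaceIntegrable U (fun e ζ => (trunc ε (v (e.1.symm ζ)) : ℂ) * wirtingerBar (a e) ζ) ∧
    surfaceIntegral U (fun e ζ => ((1 - (ε / max |v (e.1.symm ζ)| ε) ^ 2 : ℝ) : ℂ) *
      (conj (del v e ζ) * a e ζ)) +
    surfaceIntegral U (fun e ζ => (trunc ε (v (e.1.symm ζ)) : ℂ) * wirtingerBar (a e) ζ) = 0 := by
  -- Off `K` the values of `v` lie in the interval on which the truncation and its derivative
  -- vanish, so both integrands have compact support.
  obtain ⟨K, hKU, hK, hKv⟩ := hv.boundary ε hε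
  have hdel := isSmoothForm_del hU hv.smooth
  have hb : IsSmoothForm U fun e ζ => (trunc ε (v (e.1.symm ζ)) : ℂ) * a e ζ := by
    refine ha.mul (v := fun x => (trunc ε (v x) : ℂ)) fun x hx => ?_
    exact SmoothAt.ofReal fun e he => (contDiff_trunc hε).contDiffAt.comp (e.1 x)
      ((hv.smooth x hx e he).of_le one_le_two)
  have h1 : SurfaceIntegrable U (fun e ζ => ((1 - (ε / max |v (e.1.symm ζ)| ε) ^ 2 : ℝ) : ℂ) *
      (conj (del v e ζ) * a e ζ)) := by
    refine surfaceIntegrable_of_compact hU hK hKU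
      ((isTwoForm_conj_mul ha.transform hdel.transform).mul
        fun x => ((1 - (ε / max |v x| ε) ^ 2 : ℝ) : ℂ)) (fun e => ?_) fun e ζ hζ hζK => ?_
    · exact (continuousOn_comp_ofReal hv.smooth (continuous_trunc_integrand hε) e).mul
        ((Complex.continuous_conj.comp_continuousOn (hdel.smooth e).continuousOn).mul
          (ha.smooth e).continuousOn)
    · rw [trunc_deriv_eq_zero hε (hKv _ hζ.2 hζK).le]; simp
  have h2 : SurfaceIntegrable U
      (fun e ζ => (trunc ε (v (e.1.symm ζ)) : ℂ) * wirtingerBar (a e) ζ) := by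
    refine surfaceIntegrable_of_compact hU hK hKU
      ((ha.isTwoForm hU).mul fun x => (trunc ε (v x) : ℂ)) (fun e => ?_) fun e ζ hζ hζK => ?_
    · exact (continuousOn_comp_ofReal hv.smooth (contDiff_trunc hε).continuous e).mul
        (ha.continuousOn_wirtingerBar hU e)
    · rw [trunc_eq_zero hε (hKv _ hζ.2 hζK).le]; simp
  refine ⟨h1, h2, ?_⟩
  rw [← surfaceIntegral_add h1 h2, ← surfaceIntegral_wirtingerBar_eq_zero hU hK hKU hb
    fun e ζ hζ hζK => by rw [trunc_eq_zero hε (hKv _ hζ.2 hζK).le]; simp]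
  exact surfaceIntegral_congr hU fun e ζ hζ =>
    (wirtingerBar_comp_mul hU hv.smooth (hasDerivAt_trunc hε) ha e hζ).symm

/-- The coefficients of `v ∂̄a` are integrable when `∂̄a` has compact support. -/
theorem surfaceIntegrable_mul_wirtingerBar (hU : IsOpen U) (hs : ∀ x ∈ U, SmoothAt 2 v x)
    {a : atlas ℂ R → ℂ → ℂ} (ha : IsSmoothForm U a)
    (ha0 : ∃ K ⊆ U, IsCompact K ∧
      ∀ e, ∀ ζ ∈ chartImage e U, e.1.symm ζ ∉ K → wirtingerBar (a e) ζ = 0) :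
    SurfaceIntegrable U (fun e ζ => (v (e.1.symm ζ) : ℂ) * wirtingerBar (a e) ζ) := by
  obtain ⟨K, hKU, hK, hK0⟩ := ha0
  refine surfaceIntegrable_of_compact hU hK hKU ((ha.isTwoForm hU).mul fun x => (v x : ℂ))
    (fun e => ?_) fun e ζ hζ hζK => ?_
  · exact (contDiffOn_ofReal hs e).continuousOn.mul (ha.continuousOn_wirtingerBar hU e)
  · rw [hK0 e ζ hζ hζK, mul_zero]

/-- The Dirichlet integral of a function which vanishes on the boundary is finite. -/
theorem memLp_del (hU : IsOpen U) (hv : VanishesAtBoundary U v) (i : Fin (coverCard R)) :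
    MemLp (del v (coverChart R i)) 2 (volume.restrict (cell U i)) := by
  have hdel := isSmoothForm_del hU hv.smooth
  have hdom := surfaceIntegrable_mul_wirtingerBar hU hv.smooth hdel hv.harmonic
  -- This bound does not depend on ε. It is finite because the Laplacian of `v` is continuous with
  -- compact support.
  set C : ℝ := ∑ j, ∫ ζ in cell U j, ‖(v ((coverChart R j).1.symm ζ) : ℂ) *
    wirtingerBar (del v (coverChart R j)) ζ‖ with hC
  set G : ℝ → atlas ℂ R → ℂ → ℝ := fun ε e ζ =>
    (1 - (ε / max |v (e.1.symm ζ)| ε) ^ 2) * ‖del v e ζ‖ ^ 2 with hG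
  have hG0 : ∀ ε > 0, ∀ e ζ, 0 ≤ G ε e ζ := fun ε hε e ζ =>
    mul_nonneg (trunc_deriv_mem hε _).1 (by positivity)
  have hGc : ∀ ε e ζ, ((1 - (ε / max |v (e.1.symm ζ)| ε) ^ 2 : ℝ) : ℂ) *
      (conj (del v e ζ) * del v e ζ) = (G ε e ζ : ℂ) := fun ε e ζ => by
    rw [Complex.conj_mul', hG]; push_cast; ring
  have hbound : ∀ ε > 0, Integrable (G ε (coverChart R i)) (volume.restrict (cell U i)) ∧
      ∫ ζ in cell U i, G ε (coverChart R i) ζ ≤ C := by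
    intro ε hε
    obtain ⟨h1, h2, h3⟩ := stokes_trunc hU hv hdel hε
    simp_rw [hGc] at h1 h3
    have hint : ∀ j, Integrable (G ε (coverChart R j)) (volume.restrict (cell U j)) := fun j => by
      simpa using (h1 j).re
    refine ⟨hint i, ?_⟩
    have h4 : surfaceIntegral U (fun e ζ => (G ε e ζ : ℂ)) =
        ((∑ j, ∫ ζ in cell U j, G ε (coverChart R j) ζ : ℝ) : ℂ) := by
      rw [surfaceIntegral, Complex.ofReal_sum]
      exact Finset.sum_congr rfl fun j _ => integral_complex_ofReal
    have h5 : ∑ j, ∫ ζ in cell U j, G ε (coverChart R j) ζ ≤ C := by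
      have h6 : ‖surfaceIntegral U (fun e ζ => (G ε e ζ : ℂ))‖ ≤ C := by
        -- By Stokes' theorem the truncated energy is minus the integral of T(v) ∂̄∂v, and |T(v)| ≤
        -- |v|.
        rw [eq_neg_of_add_eq_zero_left h3, norm_neg, surfaceIntegral]
        refine (norm_sum_le _ _).trans (Finset.sum_le_sum fun j _ => ?_)
        refine (norm_integral_le_integral_norm _).trans ?_
        refine integral_mono (h2 j).norm (hdom j).norm fun ζ => ?_
        simp only [norm_mul, Complex.norm_real, Real.norm_eq_abs]
        exact mul_le_mul_of_nonneg_right (abs_trunc_le hε _) (norm_nonneg _)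
      rw [h4, Complex.norm_real] at h6
      exact (le_abs_self _).trans h6
    refine le_trans ?_ h5
    exact Finset.single_le_sum (f := fun j => ∫ ζ in cell U j, G ε (coverChart R j) ζ)
      (fun j _ => integral_nonneg fun ζ => hG0 ε hε _ ζ) (Finset.mem_univ i)
  have hmeas : AEStronglyMeasurable (del v (coverChart R i)) (volume.restrict (cell U i)) :=
    ((hdel.smooth _).continuousOn.mono fun ζ hζ => hζ.1).aestronglyMeasurable
      (measurableSet_cell hU i)
  rw [memLp_two_iff_integrable_sq_norm hmeas]
  refine ⟨hmeas.norm.pow 2, ?_⟩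
  have hlim : ∀ᵐ ζ ∂volume.restrict (cell U i),
      Tendsto (fun n : ℕ => ENNReal.ofReal (G (1 / ((n : ℝ) + 1)) (coverChart R i) ζ)) atTop
        (𝓝 (ENNReal.ofReal (‖del v (coverChart R i) ζ‖ ^ 2))) := by
    filter_upwards [ae_del_eq_zero hU hv.smooth i] with ζ hζ
    refine ENNReal.tendsto_ofReal ?_
    by_cases h0 : v ((coverChart R i).1.symm ζ) = 0
    · simp [hG, hζ h0]
    · simpa using (tendsto_trunc_deriv_nat h0).mul_const (‖del v (coverChart R i) ζ‖ ^ 2)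
  have hpos : ∀ n : ℕ, (0 : ℝ) < 1 / ((n : ℝ) + 1) := fun n => Nat.one_div_pos_of_nat
  -- The truncated energies converge pointwise almost everywhere to the full one, so Fatou's lemma
  -- carries the bound `C` over to the limit.
  have hfatou := lintegral_liminf_le' (μ := volume.restrict (cell U i)) (u := (atTop : Filter ℕ))
    (f := fun n : ℕ => fun ζ => ENNReal.ofReal (G (1 / ((n : ℝ) + 1)) (coverChart R i) ζ))
    fun n => ((hbound _ (hpos n)).1.aemeasurable).ennreal_ofReal
  rw [hasFiniteIntegral_iff_ofReal (ae_of_all _ fun ζ => by positivity)]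
  calc ∫⁻ ζ in cell U i, ENNReal.ofReal (‖del v (coverChart R i) ζ‖ ^ 2)
      = ∫⁻ ζ in cell U i, liminf (fun n : ℕ =>
          ENNReal.ofReal (G (1 / ((n : ℝ) + 1)) (coverChart R i) ζ)) atTop :=
        lintegral_congr_ae (by filter_upwards [hlim] with ζ hζ using hζ.liminf_eq.symm)
    _ ≤ _ := hfatou
    _ ≤ ENNReal.ofReal C := by
        refine liminf_le_of_le (by isBoundedDefault) fun b hb => ?_
        obtain ⟨n, hn⟩ := hb.exists
        refine hn.trans ?_
        rw [← ofReal_integral_eq_lintegral_ofReal (hbound _ (hpos n)).1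
          (ae_of_all _ fun ζ => hG0 _ (hpos n) _ ζ)]
        exact ENNReal.ofReal_le_ofReal (hbound _ (hpos n)).2
    _ < ⊤ := ENNReal.ofReal_lt_top

/-- Stokes' theorem for `v a`, where `v` vanishes on the boundary and `a` is square integrable. -/
theorem stokes_of_vanishesAtBoundary (hU : IsOpen U) (hv : VanishesAtBoundary U v)
    {a : atlas ℂ R → ℂ → ℂ} (ha : IsSmoothForm U a)
    (ha2 : ∀ i, MemLp (a (coverChart R i)) 2 (volume.restrict (cell U i)))
    (ha0 : ∃ K ⊆ U, IsCompact K ∧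
      ∀ e, ∀ ζ ∈ chartImage e U, e.1.symm ζ ∉ K → wirtingerBar (a e) ζ = 0) :
    surfaceIntegral U (fun e ζ => conj (del v e ζ) * a e ζ) +
      surfaceIntegral U (fun e ζ => (v (e.1.symm ζ) : ℂ) * wirtingerBar (a e) ζ) = 0 := by
  have hpos : ∀ n : ℕ, (0 : ℝ) < 1 / ((n : ℝ) + 1) := fun n => Nat.one_div_pos_of_nat
  have hi1 := integrable_conj_mul ha2 (memLp_del hU hv)
  have hi2 := surfaceIntegrable_mul_wirtingerBar hU hv.smooth ha ha0
  have hst := fun n : ℕ => stokes_trunc hU hv ha (hpos n)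
  -- The finite Dirichlet integral of `v` and the square integrability of `a` supply the dominating
  -- function by which ε may tend to 0.
  have hlim1 : Tendsto (fun n : ℕ => surfaceIntegral U (fun e ζ =>
      ((1 - ((1 / ((n : ℝ) + 1)) / max |v (e.1.symm ζ)| (1 / ((n : ℝ) + 1))) ^ 2 : ℝ) : ℂ) *
      (conj (del v e ζ) * a e ζ))) atTop
      (𝓝 (surfaceIntegral U (fun e ζ => conj (del v e ζ) * a e ζ))) := by
    simp only [surfaceIntegral]
    refine tendsto_finsetSum _ fun i _ => ?_
    refine tendsto_integral_of_dominated_convergence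
      (fun ζ => ‖conj (del v (coverChart R i) ζ) * a (coverChart R i) ζ‖)
      (fun n => ((hst n).1 i).aestronglyMeasurable) (hi1 i).norm
      (fun n => ae_of_all _ fun ζ => ?_) ?_
    · have h := trunc_deriv_mem (hpos n) (v ((coverChart R i).1.symm ζ))
      rw [norm_mul, Complex.norm_real, Real.norm_eq_abs, abs_of_nonneg h.1]
      exact mul_le_of_le_one_left (norm_nonneg _) h.2
    · filter_upwards [ae_del_eq_zero hU hv.smooth i] with ζ hζ
      by_cases h0 : v ((coverChart R i).1.symm ζ) = 0
      · simp [hζ h0]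
      · have h1 := (Complex.continuous_ofReal.tendsto 1).comp (tendsto_trunc_deriv_nat h0)
        simpa using h1.mul_const (conj (del v (coverChart R i) ζ) * a (coverChart R i) ζ)
  have hlim2 : Tendsto (fun n : ℕ => surfaceIntegral U (fun e ζ =>
      (trunc (1 / ((n : ℝ) + 1)) (v (e.1.symm ζ)) : ℂ) * wirtingerBar (a e) ζ)) atTop
      (𝓝 (surfaceIntegral U (fun e ζ => (v (e.1.symm ζ) : ℂ) * wirtingerBar (a e) ζ))) := by
    simp only [surfaceIntegral]
    refine tendsto_finsetSum _ fun i _ => ?_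
    refine tendsto_integral_of_dominated_convergence
      (fun ζ => ‖(v ((coverChart R i).1.symm ζ) : ℂ) * wirtingerBar (a (coverChart R i)) ζ‖)
      (fun n => ((hst n).2.1 i).aestronglyMeasurable) (hi2 i).norm
      (fun n => ae_of_all _ fun ζ => ?_) (ae_of_all _ fun ζ => ?_)
    · simp only [norm_mul, Complex.norm_real, Real.norm_eq_abs]
      exact mul_le_mul_of_nonneg_right (abs_trunc_le (hpos n) _) (norm_nonneg _)
    · exact ((Complex.continuous_ofReal.tendsto _).comp (tendsto_trunc _ hpos
        tendsto_one_div_add_atTop_nhds_zero_nat)).mul_const _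
  refine tendsto_nhds_unique (hlim1.add hlim2) ?_
  refine tendsto_const_nhds.congr fun n => ?_
  exact (hst n).2.2.symm

end Dirichlet

/-! ### Completeness of the Bergman space -/

section Complete

open Metric InnerProductSpace
open TopologicalSpace (Opens)

variable {R : Type*} [TopologicalSpace R] [ChartedSpace ℂ R] [CompactSpace R] {U : Opens R}

theorem lintegral_sq_norm_cell (α : Bergman U) (i : Fin (coverCard R)) :
    ∫⁻ ζ in cell (U : Set R) i, ENNReal.ofReal (‖α.coeff (coverChart R i) ζ‖ ^ 2) =
      ENNReal.ofReal (∫ ζ in cell (U : Set R) i, ‖α.coeff (coverChart R i) ζ‖ ^ 2) :=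
  (ofReal_integral_eq_lintegral_ofReal ((α.memLp i).integrable_norm_pow two_ne_zero)
    (ae_of_all _ fun ζ => by positivity)).symm

theorem integral_sq_norm_cell_le (α : Bergman U) (i : Fin (coverCard R)) :
    ∫ ζ in cell (U : Set R) i, ‖α.coeff (coverChart R i) ζ‖ ^ 2 ≤ ‖α‖ ^ 2 := by
  rw [Bergman.norm_sq]
  exact Finset.single_le_sum
    (f := fun i => ∫ ζ in cell (U : Set R) i, ‖α.coeff (coverChart R i) ζ‖ ^ 2)
    (fun j _ => integral_nonneg fun ζ => by positivity) (Finset.mem_univ i)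

variable [IsManifold 𝓘(ℂ, ℂ) ω R]

/-- The density |a|² dx dy is a two-form, so its integral over a chart is a sum over parts of the
cells that define the norm. It makes the norm usable in every chart, not only in those of the cover.
-/
theorem lintegral_sq_norm_chart_le (α : Bergman U) (e : atlas ℂ R) :
    ∫⁻ ζ in chartImage e (U : Set R), ENNReal.ofReal (‖α.coeff e ζ‖ ^ 2) ≤
      ENNReal.ofReal (‖α‖ ^ 2) := by
  rw [lintegral_chartImage_eq (F := fun e ζ => ENNReal.ofReal (‖α.coeff e ζ‖ ^ 2)) U.isOpen
    (fun e f ζ hζ hf => by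
      rw [α.isHolomorphicForm.transform e f ζ hζ hf, norm_mul, mul_pow, mul_comm,
        ENNReal.ofReal_mul (by positivity)]) e, Bergman.norm_sq,
    ENNReal.ofReal_sum_of_nonneg fun i _ => integral_nonneg fun ζ => by positivity]
  refine Finset.sum_le_sum fun i _ => ?_
  rw [← lintegral_sq_norm_cell]
  exact lintegral_mono_set inter_subset_left

/-- Evaluation at a point is bounded by the norm of the Bergman space. -/
theorem sq_norm_coeff_le (α : Bergman U) (e : atlas ℂ R) {ζ : ℂ} {r R' : ℝ} (hr : 0 < r)
    (hr' : r < R') (hsub : ball ζ R' ⊆ chartImage e (U : Set R)) :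
    ‖α.coeff e ζ‖ ^ 2 ≤ (∫ x, cut r x)⁻¹ * ‖α‖ ^ 2 := by
  -- The mean value property is applied to the square of the coefficient, which is holomorphic, so
  -- that the integral of |a|² bounds the value at once.
  set h : ℂ → ℂ := fun x => α.coeff e x ^ 2 with hh
  have hhol : DifferentiableOn ℂ h (ball ζ R') :=
    ((α.isHolomorphicForm.holomorphic e).mono hsub).pow 2
  have hharm : HarmonicOnNhd h (ball ζ R') := fun z hz =>
    (hhol.analyticAt (isOpen_ball.mem_nhds hz)).harmonicAt
  have h1 := integral_radial_mul_harmonic (φ := fun x => (cut r x : ℂ)) hr'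
    (Complex.continuous_ofReal.comp (contDiff_cut r 0).continuous)
    (fun x hx => by simp [cut_eq_zero hr hx]) (fun v x hv => by simp [cut_rotate r hv]) hharm
  rw [integral_complex_ofReal] at h1
  have hM := integral_cut_pos hr
  rw [inv_mul_eq_div, le_div_iff₀ hM]
  have hint : IntegrableOn (fun x => ‖α.coeff e x‖ ^ 2) (chartImage e (U : Set R)) := by
    refine ⟨?_, ?_⟩
    · exact ((α.isHolomorphicForm.holomorphic e).continuousOn.norm.pow 2).aestronglyMeasurable
        (isOpen_chartImage e U.isOpen).measurableSet
    · rw [hasFiniteIntegral_iff_ofReal (ae_of_all _ fun ζ => by positivity)]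
      exact (lintegral_sq_norm_chart_le α e).trans_lt ENNReal.ofReal_lt_top
  have h2 : ∫ x in chartImage e (U : Set R), ‖α.coeff e x‖ ^ 2 ≤ ‖α‖ ^ 2 := by
    have := lintegral_sq_norm_chart_le α e
    rw [← ofReal_integral_eq_lintegral_ofReal hint (ae_of_all _ fun ζ => by positivity)] at this
    exact (ENNReal.ofReal_le_ofReal_iff (by positivity)).1 this
  have hm := (isOpen_chartImage e U.isOpen).measurableSet
  calc ‖α.coeff e ζ‖ ^ 2 * ∫ x, cut r x = ‖∫ x, (cut r (x - ζ) : ℂ) * h x‖ := by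
        rw [h1, norm_mul, Complex.norm_real, Real.norm_eq_abs, abs_of_pos hM, hh, norm_pow,
          mul_comm]
    _ = ‖∫ x in chartImage e (U : Set R), (cut r (x - ζ) : ℂ) * h x‖ := by
        rw [setIntegral_eq_integral_of_forall_compl_eq_zero]
        intro x hx
        rw [cut_eq_zero hr]
        · simp
        · by_contra hlt
          exact hx (hsub (by simpa [dist_eq_norm] using (not_le.1 hlt).trans hr'))
    _ ≤ ∫ x in chartImage e (U : Set R), ‖α.coeff e x‖ ^ 2 := by
        refine norm_integral_le_of_norm_le hint (ae_of_all _ fun x => ?_)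
        rw [norm_mul, hh, norm_pow, Complex.norm_real, Real.norm_eq_abs,
          abs_of_nonneg (cut_nonneg r _)]
        exact mul_le_of_le_one_left (by positivity) (Real.smoothTransition.le_one _)
    _ ≤ ‖α‖ ^ 2 := h2

theorem locally_norm_coeff_le (e : atlas ℂ R) {ζ : ℂ} (hζ : ζ ∈ chartImage e (U : Set R)) :
    ∃ C > 0, ∀ᶠ z in 𝓝 ζ, ∀ α : Bergman U, ‖α.coeff e z‖ ≤ C * ‖α‖ := by
  obtain ⟨R', hR, hsub⟩ := Metric.isOpen_iff.1 (isOpen_chartImage e U.isOpen) ζ hζ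
  have hr : 0 < R' / 4 := by linarith
  have hM := integral_cut_pos hr
  refine ⟨Real.sqrt (∫ x, cut (R' / 4) x)⁻¹, Real.sqrt_pos.2 (inv_pos.2 hM), ?_⟩
  filter_upwards [ball_mem_nhds ζ (half_pos hR)] with z hz α
  have h := sq_norm_coeff_le α e hr (show R' / 4 < R' / 2 by linarith)
    ((ball_subset_ball_of_mem (ball_subset_closedBall hz)).trans hsub)
  rw [← abs_of_nonneg (norm_nonneg (α.coeff e z)), ← Real.sqrt_sq_eq_abs,
    ← abs_of_nonneg (norm_nonneg α), ← Real.sqrt_sq_eq_abs, ← Real.sqrt_mul (inv_pos.2 hM).le]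
  exact Real.sqrt_le_sqrt h

/-- By the bound on point evaluations a Cauchy sequence converges locally uniformly in each chart,
so the limit coefficients are holomorphic and transform correctly. Fatou's lemma, with one index
fixed, shows that the limit is square integrable and that the convergence holds in norm. -/
instance : CompleteSpace (Bergman U) := by
  refine Metric.complete_of_cauchySeq_tendsto fun u hu => ?_
  have hcauchy : ∀ e, ∀ ζ ∈ chartImage e (U : Set R), ∃ S ∈ 𝓝 ζ,
      UniformCauchySeqOn (fun n => (u n).coeff e) atTop S := by
    intro e ζ hζ
    obtain ⟨C, hC, hev⟩ := locally_norm_coeff_le e hζ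
    refine ⟨_, hev, ?_⟩
    rw [Metric.uniformCauchySeqOn_iff]
    intro ε hε
    obtain ⟨N, hN⟩ := Metric.cauchySeq_iff.1 hu (ε / C) (by positivity)
    refine ⟨N, fun m hm n hn z hz => ?_⟩
    have h1 := hz (u m - u n)
    have h2 := hN m hm n hn
    rw [dist_eq_norm] at h2 ⊢
    refine (show ‖(u m).coeff e z - (u n).coeff e z‖ ≤ C * ‖u m - u n‖ from h1).trans_lt ?_
    rw [lt_div_iff₀ hC] at h2
    linarith
  have hlim : ∀ e ζ, ∃ y, Tendsto (fun n => (u n).coeff e ζ) atTop (𝓝 y) := by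
    intro e ζ
    by_cases hζ : ζ ∈ chartImage e (U : Set R)
    · obtain ⟨S, hS, hunif⟩ := hcauchy e ζ hζ
      exact cauchySeq_tendsto_of_complete (hunif.cauchySeq (mem_of_mem_nhds hS))
    · exact ⟨0, tendsto_const_nhds.congr fun n =>
        ((u n).isHolomorphicForm.zero_off e ζ hζ).symm⟩
  choose a ha using hlim
  have hloc : ∀ e, TendstoLocallyUniformlyOn (fun n => (u n).coeff e) (a e) atTop
      (chartImage e (U : Set R)) := by
    intro e
    rw [tendstoLocallyUniformlyOn_iff_forall_tendsto]
    intro ζ hζ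
    obtain ⟨S, hS, hunif⟩ := hcauchy e ζ hζ
    have h1 := hunif.tendstoUniformlyOn_of_tendsto (f := a e) fun z _ => ha e z
    rw [tendstoUniformlyOn_iff_tendsto] at h1
    exact h1.mono_left (prod_mono le_rfl (le_principal_iff.2 (mem_nhdsWithin_of_mem_nhds hS)))
  have hform : IsHolomorphicForm (U : Set R) a := by
    refine ⟨fun e => ?_, fun e ζ hζ => ?_, fun e f ζ hζ hf => ?_⟩
    · exact (hloc e).differentiableOn
        (Eventually.of_forall fun n => (u n).isHolomorphicForm.holomorphic e)
        (isOpen_chartImage e U.isOpen)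
    · exact tendsto_nhds_unique (ha e ζ) (tendsto_const_nhds.congr fun n =>
        ((u n).isHolomorphicForm.zero_off e ζ hζ).symm)
    · exact tendsto_nhds_unique (ha e ζ) (((ha f _).mul_const _).congr fun n =>
        ((u n).isHolomorphicForm.transform e f ζ hζ hf).symm)
  have hmeas : ∀ m i, AEStronglyMeasurable
      (fun ζ => a (coverChart R i) ζ - (u m).coeff (coverChart R i) ζ)
      (volume.restrict (cell (U : Set R) i)) := fun m i =>
    (((hform.holomorphic _).continuousOn.sub
      ((u m).isHolomorphicForm.holomorphic _).continuousOn).mono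
      fun ζ hζ => hζ.1).aestronglyMeasurable (measurableSet_cell U.isOpen i)
  have hfatou : ∀ ε > 0, ∃ N, ∀ m ≥ N, ∀ i, ∫⁻ ζ in cell (U : Set R) i,
      ENNReal.ofReal (‖a (coverChart R i) ζ - (u m).coeff (coverChart R i) ζ‖ ^ 2) ≤
        ENNReal.ofReal (ε ^ 2) := by
    intro ε hε
    obtain ⟨N, hN⟩ := Metric.cauchySeq_iff.1 hu ε hε
    refine ⟨N, fun m hm i => ?_⟩
    have h1 : ∀ ζ, liminf (fun n => ENNReal.ofReal
        (‖(u n - u m).coeff (coverChart R i) ζ‖ ^ 2)) atTop =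
        ENNReal.ofReal (‖a (coverChart R i) ζ - (u m).coeff (coverChart R i) ζ‖ ^ 2) := fun ζ =>
      (ENNReal.tendsto_ofReal (((ha (coverChart R i) ζ).sub_const _).norm.pow 2)).liminf_eq
    simp_rw [← h1]
    refine (lintegral_liminf_le' (u := (atTop : Filter ℕ)) fun n =>
      (((u n - u m).memLp i).aestronglyMeasurable.norm.pow 2).aemeasurable.ennreal_ofReal).trans ?_
    refine liminf_le_of_le (by isBoundedDefault) fun b hb => ?_
    obtain ⟨n, hn, hnN⟩ := (hb.and (eventually_ge_atTop N)).exists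
    refine hn.trans ?_
    refine (lintegral_sq_norm_cell (u n - u m) i).trans_le ?_
    refine ENNReal.ofReal_le_ofReal ((integral_sq_norm_cell_le _ i).trans ?_)
    have := hN n hnN m hm
    rw [dist_eq_norm] at this
    gcongr
  have hint : ∀ m i, (∫⁻ ζ in cell (U : Set R) i, ENNReal.ofReal
      (‖a (coverChart R i) ζ - (u m).coeff (coverChart R i) ζ‖ ^ 2)) < ⊤ →
      Integrable (fun ζ => ‖a (coverChart R i) ζ - (u m).coeff (coverChart R i) ζ‖ ^ 2)
      (volume.restrict (cell (U : Set R) i)) := fun m i h =>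
    ⟨(hmeas m i).norm.pow 2, by
      rwa [hasFiniteIntegral_iff_ofReal (ae_of_all _ fun ζ => by positivity)]⟩
  have hmem : ∀ i, MemLp (a (coverChart R i)) 2 (volume.restrict (cell (U : Set R) i)) := by
    intro i
    obtain ⟨N, hN⟩ := hfatou 1 one_pos
    have h1 : MemLp (fun ζ => a (coverChart R i) ζ - (u N).coeff (coverChart R i) ζ) 2
        (volume.restrict (cell (U : Set R) i)) := by
      rw [memLp_two_iff_integrable_sq_norm (hmeas N i)]
      exact hint N i ((hN N le_rfl i).trans_lt ENNReal.ofReal_lt_top)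
    have h2 := h1.add ((u N).memLp i)
    refine h2.ae_eq (ae_of_all _ fun ζ => ?_)
    simp
  let A : Bergman U := ⟨a, hform, hmem⟩
  refine ⟨A, ?_⟩
  rw [tendsto_iff_norm_sub_tendsto_zero]
  have hsq : Tendsto (fun n => ‖u n - A‖ ^ 2) atTop (𝓝 0) := by
    rw [Metric.tendsto_atTop]
    intro δ hδ
    -- The summand 1 makes the sum over the cells strictly less than δ and avoids a division by zero
    -- for an empty cover.
    have hδ' : 0 < δ / (coverCard R + 1) := by positivity
    obtain ⟨N, hN⟩ := hfatou (Real.sqrt (δ / (coverCard R + 1))) (Real.sqrt_pos.2 hδ')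
    refine ⟨N, fun m hm => ?_⟩
    rw [Real.sq_sqrt hδ'.le] at hN
    have h1 : ∀ i, ∫ ζ in cell (U : Set R) i, ‖(A - u m).coeff (coverChart R i) ζ‖ ^ 2 ≤
        δ / (coverCard R + 1) := by
      intro i
      have h2 := hN m hm i
      rw [← ofReal_integral_eq_lintegral_ofReal (hint m i (h2.trans_lt ENNReal.ofReal_lt_top))
        (ae_of_all _ fun ζ => by positivity)] at h2
      exact (ENNReal.ofReal_le_ofReal_iff hδ'.le).1 h2
    rw [dist_zero_right, Real.norm_eq_abs, abs_of_nonneg (by positivity), norm_sub_rev,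
      Bergman.norm_sq]
    calc _ ≤ ∑ _i : Fin (coverCard R), δ / (coverCard R + 1) := Finset.sum_le_sum fun i _ => h1 i
      _ = coverCard R * (δ / (coverCard R + 1)) := by simp
      _ < δ := by
        rw [mul_div_assoc', div_lt_iff₀ (by positivity)]
        linarith
  have := (Real.continuous_sqrt.tendsto 0).comp hsq
  simpa [Function.comp_def, Real.sqrt_sq] using this

end Complete

/-! ### The Green's function: positivity and the regularised function near the pole -/

section Green

open Metric InnerProductSpace

variable {R : Type*} [TopologicalSpace R] [ChartedSpace ℂ R] {U : Set R} {g : R → R → ℝ}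

/-- The function `g + log |η - ζ|` in the chart `e`, extended across the diagonal. -/
def greenReg (g : R → R → ℝ) (e : atlas ℂ R) (η ζ : ℂ) : ℝ :=
  open Classical in
  if η = ζ then limUnder (𝓝[≠] ζ) fun z => g (e.1.symm z) (e.1.symm ζ) + Real.log ‖z - ζ‖
  else g (e.1.symm η) (e.1.symm ζ) + Real.log ‖η - ζ‖

theorem greenReg_of_ne {e : atlas ℂ R} {η ζ : ℂ} (h : η ≠ ζ) :
    greenReg g e η ζ = g (e.1.symm η) (e.1.symm ζ) + Real.log ‖η - ζ‖ := if_neg h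

theorem symm_ne_symm {e : atlas ℂ R} {η ζ : ℂ} (hη : η ∈ e.1.target) (hζ : ζ ∈ e.1.target)
    (h : η ≠ ζ) : e.1.symm η ≠ e.1.symm ζ := fun h' => h (e.1.symm.injOn hη hζ h')

theorem harmonicAt_log_norm_sub {η ζ : ℂ} (h : η ≠ ζ) :
    HarmonicAt (fun z : ℂ => Real.log ‖z - ζ‖) η :=
  AnalyticAt.harmonicAt_log_norm (f := fun z => z - ζ) (by fun_prop) (sub_ne_zero.2 h)

theorem IsGreenFunction.harmonicAt (hg : IsGreenFunction U g) {w : R} (hw : w ∈ U)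
    {f : atlas ℂ R} {η : ℂ} (hη : η ∈ chartImage f U) (hne : f.1.symm η ≠ w) :
    HarmonicAt (fun z => g (f.1.symm z) w) η := by
  have h := hg.harmonic w hw _ hη.2 hne f (f.1.map_target hη.1)
  rwa [f.1.right_inv hη.1] at h

/-- On the diagonal the limit in the definition is the value of the harmonic extension across the
pole; elsewhere the function is a sum of two harmonic functions. -/
theorem IsGreenFunction.harmonicAt_greenReg (hg : IsGreenFunction U g) {e : atlas ℂ R} {η ζ : ℂ}
    (hη : η ∈ chartImage e U) (hζ : ζ ∈ chartImage e U) :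
    HarmonicAt (fun z => greenReg g e z ζ) η := by
  by_cases h : η = ζ
  · subst h
    obtain ⟨h, hh, hev⟩ := hg.log_pole _ hζ.2 e (e.1.map_target hζ.1)
    rw [e.1.right_inv hζ.1] at hh hev
    have hlim : Tendsto (fun z => g (e.1.symm z) (e.1.symm η) + Real.log ‖z - η‖) (𝓝[≠] η)
        (𝓝 (h η)) :=
      (hh.1.continuousAt.tendsto.mono_left nhdsWithin_le_nhds).congr' (hev.mono fun z hz => hz.symm)
    have h1 : (fun z => greenReg g e z η) =ᶠ[𝓝 η] h := by
      rw [eventually_nhdsWithin_iff] at hev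
      filter_upwards [hev] with z hz
      by_cases hzη : z = η
      · subst hzη
        rw [greenReg, if_pos rfl, hlim.limUnder_eq]
      · rw [greenReg_of_ne hzη]
        exact hz hzη
    exact (harmonicAt_congr_nhds h1).2 hh
  · have h1 : (fun z => greenReg g e z ζ) =ᶠ[𝓝 η]
        (fun z => g (e.1.symm z) (e.1.symm ζ)) + fun z => Real.log ‖z - ζ‖ := by
      filter_upwards [isOpen_ne.mem_nhds h] with z hz using greenReg_of_ne hz
    exact (harmonicAt_congr_nhds h1).2
      ((hg.harmonicAt hζ.2 hη (symm_ne_symm hη.1 hζ.1 h)).add (harmonicAt_log_norm_sub h))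

theorem exists_chart (x : R) : ∃ e : atlas ℂ R, x ∈ e.1.source :=
  ⟨⟨chartAt ℂ x, chart_mem_atlas ℂ x⟩, mem_chart_source ℂ x⟩

theorem tendsto_chart {e : atlas ℂ R} {x : R} (hx : x ∈ e.1.source) :
    Tendsto e.1 (𝓝 x) (𝓝 (e.1 x)) := e.1.continuousAt hx

theorem IsGreenFunction.continuousAt (hg : IsGreenFunction U g) {w z : R} (hw : w ∈ U)
    (hz : z ∈ U) (hne : z ≠ w) : ContinuousAt (fun x => g x w) z := by
  obtain ⟨e, he⟩ := exists_chart z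
  have h1 := (hg.harmonic w hw z hz hne e he).1.continuousAt.comp (e.1.continuousAt he)
  refine h1.congr ?_
  filter_upwards [e.1.open_source.mem_nhds he] with x hx
  simp only [Function.comp_apply, e.1.left_inv hx]

/-- Near the pole the regular part is bounded below and minus the logarithm tends to infinity. -/
theorem IsGreenFunction.tendsto_pole (hg : IsGreenFunction U g) {w : R} (hw : w ∈ U) (c : ℝ) :
    ∀ᶠ z in 𝓝 w, z ≠ w → c < g z w := by
  obtain ⟨e, he⟩ := exists_chart w
  have hw' := mem_chartImage he hw
  have hc := (hg.harmonicAt_greenReg hw' hw').1.continuousAt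
  have h1 : ∀ᶠ z in 𝓝 (e.1 w), greenReg g e (e.1 w) (e.1 w) - 1 < greenReg g e z (e.1 w) :=
    hc.eventually (lt_mem_nhds (by linarith))
  have h2 : ∀ᶠ z : ℂ in 𝓝 (e.1 w), z ≠ e.1 w →
      Real.log ‖z - e.1 w‖ < greenReg g e (e.1 w) (e.1 w) - 1 - c := by
    have h3 : Tendsto (fun z : ℂ => ‖z - e.1 w‖) (𝓝[≠] (e.1 w)) (𝓝[≠] 0) :=
      tendsto_nhdsWithin_of_tendsto_nhds_of_eventually_within _
        ((Continuous.tendsto' (by fun_prop) _ _ (by simp)).mono_left nhdsWithin_le_nhds)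
        (eventually_nhdsWithin_of_forall fun z hz => by simpa [sub_eq_zero] using hz)
    have h4 := (Real.tendsto_log_nhdsNE_zero.comp h3).eventually
      (eventually_lt_atBot (greenReg g e (e.1 w) (e.1 w) - 1 - c))
    rw [eventually_nhdsWithin_iff] at h4
    exact h4
  filter_upwards [(tendsto_chart he).eventually h1, (tendsto_chart he).eventually h2,
    e.1.open_source.mem_nhds he] with z hz1 hz2 hzs hne
  have hne' : e.1 z ≠ e.1 w := fun h => hne (e.1.injOn hzs he h)
  rw [greenReg_of_ne hne', e.1.left_inv hzs, e.1.left_inv he] at hz1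
  linarith [hz2 hne']

/-- Sublevel sets of the Green's function for negative levels are closed. -/
theorem IsGreenFunction.isClosed_sublevel (hg : IsGreenFunction U g) (hU : IsOpen U) {w : R}
    (hw : w ∈ U) {c : ℝ} (hc : c < 0) : IsClosed {z | z ∈ U ∧ z ≠ w ∧ g z w ≤ c} := by
  refine isClosed_of_closure_subset fun x hx => ?_
  have hx' := mem_closure_iff_frequently.1 hx
  -- A limit point cannot lie on the boundary of `U`, where the function tends to 0 > c, nor at the
  -- pole, where it tends to infinity.
  have hxU : x ∈ U := by
    by_contra h
    have hfr : x ∈ frontier U := by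
      rw [hU.frontier_eq]
      exact ⟨closure_mono (fun z hz => hz.1) hx, h⟩
    have h1 := (hg.boundary w hw x hfr).eventually (lt_mem_nhds hc)
    rw [eventually_nhdsWithin_iff] at h1
    exact hx' (h1.mono fun z hz h => absurd (hz h.1) (not_lt.2 h.2.2))
  have hne : x ≠ w := by
    rintro rfl
    exact hx' ((hg.tendsto_pole hw c).mono fun z hz h => absurd (hz h.2.1) (not_lt.2 h.2.2))
  refine ⟨hxU, hne, ?_⟩
  by_contra h
  exact hx' (((hg.continuousAt hw hxU hne).eventually (lt_mem_nhds (not_le.1 h))).mono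
    fun z hz h => absurd hz (not_lt.2 h.2.2))

variable [CompactSpace R]

/-- The Green's function is nonnegative. -/
theorem IsGreenFunction.nonneg [T2Space R] [ConnectedSpace R] (hg : IsGreenFunction U g)
    (hU : IsOpen U) {z w : R} (hw : w ∈ U) (hz : z ∈ U) (hne : z ≠ w) : 0 ≤ g z w := by
  by_contra hneg
  rw [not_le] at hneg
  -- A negative value would yield a negative minimum over all of `U` off the pole, since the
  -- sublevel set is compact.
  obtain ⟨m, hm, hmin⟩ := (hg.isClosed_sublevel hU hw hneg).isCompact.exists_isMinOn
    ⟨z, hz, hne, le_rfl⟩ (f := fun x => g x w) fun x hx =>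
      (hg.continuousAt hw hx.1 hx.2.1).continuousWithinAt
  have hm0 : g m w < 0 := hm.2.2.trans_lt hneg
  have hmin' : ∀ x ∈ U, x ≠ w → g m w ≤ g x w := fun x hx hxw => by
    rcases le_total (g x w) (g z w) with h | h
    · exact hmin ⟨hx, hxw, h⟩
    · exact hm.2.2.trans h
  set A : Set R := {x | x ∈ U ∧ x ≠ w ∧ g x w ≤ g m w} with hA
  have hclosed : IsClosed A := hg.isClosed_sublevel hU hw hm0
  -- The strong minimum principle: by Harnack's inequality a nonnegative harmonic function that is
  -- zero at the centre of a disc is zero on the disc. As `R` is connected, `A` would then be all of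
  -- `R`, but it omits the pole.
  have hopen : IsOpen A := by
    rw [isOpen_iff_mem_nhds]
    rintro x ⟨hxU, hxw, hxm⟩
    obtain ⟨e, he⟩ := exists_chart x
    have hV : IsOpen (U ∩ {w}ᶜ) := hU.inter isOpen_compl_singleton
    have hxV : e.1 x ∈ chartImage e (U ∩ {w}ᶜ) := mem_chartImage he ⟨hxU, hxw⟩
    obtain ⟨r, hr, hsub⟩ := Metric.isOpen_iff.1 (isOpen_chartImage e hV) _ hxV
    have hh : HarmonicOnNhd (fun η => g (e.1.symm η) w - g m w) (ball (e.1 x) r) :=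
      fun η hη => (hg.harmonicAt hw ⟨(hsub hη).1, (hsub hη).2.1⟩ (hsub hη).2.2).sub
        (harmonicAt_const _)
    have h0 : ∀ η ∈ ball (e.1 x) r, 0 ≤ g (e.1.symm η) w - g m w :=
      fun η hη => sub_nonneg.2 (hmin' _ (hsub hη).2.1 (hsub hη).2.2)
    filter_upwards [e.1.open_source.mem_nhds he,
      (tendsto_chart he).eventually (ball_mem_nhds _ hr)] with y hys hy
    have h := harnack hh h0 hy
    have hx0 : g x w = g m w := le_antisymm hxm (hmin' x hxU hxw)
    simp only [e.1.left_inv he, e.1.left_inv hys, hx0, sub_self, mul_zero, zero_mul,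
      zero_div, sub_zero] at h
    have h2 : g y w - g m w = 0 := abs_nonpos_iff.1 h
    have hyV := (hsub hy).2
    rw [mem_preimage, e.1.left_inv hys] at hyV
    exact ⟨hyV.1, hyV.2, by linarith⟩
  have huniv : A = univ := IsClopen.eq_univ ⟨hclosed, hopen⟩ ⟨m, hm.1, hm.2.1, le_rfl⟩
  have hwA : w ∈ A := huniv ▸ mem_univ w
  exact hwA.2.1 rfl

/-- The Green's function is small off a compact subset. -/
theorem IsGreenFunction.exists_compact [T2Space R] (hg : IsGreenFunction U g) (hU : IsOpen U) {w : R}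
    (hw : w ∈ U) {ε : ℝ} (hε : 0 < ε) :
    ∃ K ⊆ U, IsCompact K ∧ w ∈ K ∧ ∀ x ∈ U, x ∉ K → |g x w| < ε := by
  -- The pole is put into the set by hand, because the value of `g` on the diagonal is arbitrary.
  refine ⟨{x | x ∈ U ∧ (x ≠ w → ε ≤ |g x w|)}, fun x hx => hx.1, ?_, ⟨hw, fun h => absurd rfl h⟩,
    fun x hx hxK => ?_⟩
  · refine IsClosed.isCompact (isClosed_of_closure_subset fun x hx => ?_)
    have hx' := mem_closure_iff_frequently.1 hx
    have hxU : x ∈ U := by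
      by_contra h
      have hfr : x ∈ frontier U := by
        rw [hU.frontier_eq]
        exact ⟨closure_mono (fun z hz => hz.1) hx, h⟩
      have h1 := (hg.boundary w hw x hfr).abs.eventually (gt_mem_nhds (by simpa using hε))
      rw [eventually_nhdsWithin_iff] at h1
      have hxw : x ≠ w := fun hxw => h (hxw ▸ hw)
      exact hx' ((h1.and (isOpen_ne.mem_nhds hxw)).mono fun z hz hzA =>
        absurd (hzA.2 hz.2) (not_le.2 (hz.1 hzA.1)))
    refine ⟨hxU, fun hne => ?_⟩
    by_contra h
    exact hx' ((((hg.continuousAt hw hxU hne).abs.eventually (gt_mem_nhds (not_le.1 h))).and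
      (isOpen_ne.mem_nhds hne)).mono fun z hz hzA => absurd (hzA.2 hz.2) (not_le.2 hz.1))
  · by_contra h
    exact hxK ⟨hx, fun _ => not_lt.1 h⟩

end Green

/-! ### Modifying a function on a coordinate disc -/

section Patch

open Metric InnerProductSpace

variable {R : Type*} [TopologicalSpace R] [ChartedSpace ℂ R] {U : Set R}

/-- The closed coordinate disc of radius `r` around `ζ₀`. -/
def disc (e : atlas ℂ R) (ζ₀ : ℂ) (r : ℝ) : Set R := e.1.symm '' closedBall ζ₀ r

open Classical in
/-- The function which is `p`, read in the chart `e`, on a coordinate disc and `q` elsewhere. -/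
def patch (e : atlas ℂ R) (ζ₀ : ℂ) (r : ℝ) (p : ℂ → ℝ) (q : R → ℝ) (x : R) : ℝ :=
  if x ∈ disc e ζ₀ r then p (e.1 x) else q x

variable {e : atlas ℂ R} {ζ₀ : ℂ} {r R' : ℝ} {p : ℂ → ℝ} {q : R → ℝ}

theorem isCompact_disc (hr : r < R') (hB : ball ζ₀ R' ⊆ chartImage e U) :
    IsCompact (disc e ζ₀ r) :=
  (isCompact_closedBall ζ₀ r).image_of_continuousOn (e.1.continuousOn_symm.mono fun _ hη =>
    (hB (closedBall_subset_ball hr hη)).1)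

theorem disc_subset (hr : r < R') (hB : ball ζ₀ R' ⊆ chartImage e U) : disc e ζ₀ r ⊆ U := by
  rintro _ ⟨η, hη, rfl⟩
  exact (hB (closedBall_subset_ball hr hη)).2

theorem disc_subset_source (hr : r < R') (hB : ball ζ₀ R' ⊆ chartImage e U) :
    disc e ζ₀ r ⊆ e.1.source := by
  rintro _ ⟨η, hη, rfl⟩
  exact e.1.map_target (hB (closedBall_subset_ball hr hη)).1

theorem symm_mem_disc_iff (hr : r < R') (hB : ball ζ₀ R' ⊆ chartImage e U) {η : ℂ}
    (hη : η ∈ e.1.target) : e.1.symm η ∈ disc e ζ₀ r ↔ η ∈ closedBall ζ₀ r := by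
  refine ⟨?_, fun h => ⟨η, h, rfl⟩⟩
  rintro ⟨ξ, hξ, h⟩
  rwa [← e.1.symm.injOn (hB (closedBall_subset_ball hr hξ)).1 hη h]

/-- The two expressions agree on the annulus between `r` and `R'`. So there is an open disc on which
only `p` matters, and regularity on the rim of the closed disc needs no separate argument. -/
theorem patch_symm (hr : r < R') (hB : ball ζ₀ R' ⊆ chartImage e U)
    (hpq : ∀ η ∈ ball ζ₀ R', r < ‖η - ζ₀‖ → p η = q (e.1.symm η)) {η : ℂ} (hη : η ∈ ball ζ₀ R') :
    patch e ζ₀ r p q (e.1.symm η) = p η := by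
  rw [patch]
  split_ifs with h
  · rw [e.1.right_inv (hB hη).1]
  · rw [symm_mem_disc_iff hr hB (hB hη).1, mem_closedBall, dist_eq_norm, not_le] at h
    exact (hpq η hη h).symm

theorem patch_of_notMem {x : R} (hx : x ∉ disc e ζ₀ r) : patch e ζ₀ r p q x = q x := if_neg hx

theorem patch_symm_eventuallyEq (hr : r < R') (hB : ball ζ₀ R' ⊆ chartImage e U)
    (hpq : ∀ η ∈ ball ζ₀ R', r < ‖η - ζ₀‖ → p η = q (e.1.symm η)) {η : ℂ} (hη : η ∈ ball ζ₀ R') :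
    (fun z => patch e ζ₀ r p q (e.1.symm z)) =ᶠ[𝓝 η] p := by
  filter_upwards [isOpen_ball.mem_nhds hη] with z hz using patch_symm hr hB hpq hz

theorem del_congr {v v' : R → ℝ} {f : atlas ℂ R} {η : ℂ}
    (h : (fun z => v (f.1.symm z)) =ᶠ[𝓝 η] fun z => v' (f.1.symm z)) :
    del v f =ᶠ[𝓝 η] del v' f := by
  filter_upwards [h.eventuallyEq_nhds] with z hz
  exact wirtinger_congr (hz.mono fun y hy => congrArg Complex.ofReal hy)

theorem wirtinger_ofReal_congr {u u' : ℂ → ℝ} {η : ℂ} (h : u =ᶠ[𝓝 η] u') :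
    (wirtinger fun z => (u z : ℂ)) =ᶠ[𝓝 η] wirtinger fun z => (u' z : ℂ) := by
  filter_upwards [h.eventuallyEq_nhds] with z hz
  exact wirtinger_congr (hz.mono fun y hy => congrArg Complex.ofReal hy)

theorem del_patch_of_mem_ball (hr : r < R') (hB : ball ζ₀ R' ⊆ chartImage e U)
    (hpq : ∀ η ∈ ball ζ₀ R', r < ‖η - ζ₀‖ → p η = q (e.1.symm η)) {η : ℂ} (hη : η ∈ ball ζ₀ R') :
    del (patch e ζ₀ r p q) e =ᶠ[𝓝 η] wirtinger fun z => (p z : ℂ) :=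
  wirtinger_ofReal_congr (patch_symm_eventuallyEq hr hB hpq hη)

/-- The integral of a two-form which vanishes off a coordinate disc. -/
theorem surfaceIntegral_eq_integral_ball [CompactSpace R] [IsManifold 𝓘(ℂ, ℂ) ω R] (hU : IsOpen U) (hr : r < R')
    (hB : ball ζ₀ R' ⊆ chartImage e U) {F : atlas ℂ R → ℂ → ℂ} (hF : IsTwoForm U F)
    (hc : ContinuousOn (F e) (ball ζ₀ R'))
    (h0 : ∀ f, ∀ η ∈ chartImage f U, f.1.symm η ∉ disc e ζ₀ r → F f η = 0) :
    SurfaceIntegrable U F ∧ surfaceIntegral U F = ∫ ζ in ball ζ₀ R', F e ζ := by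
  have h1 : ∀ ζ ∈ chartImage e U \ closedBall ζ₀ r, F e ζ = 0 := fun ζ hζ =>
    h0 e ζ hζ.1 fun h => hζ.2 ((symm_mem_disc_iff hr hB hζ.1.1).1 h)
  have hint : IntegrableOn (F e) (chartImage e U) :=
    ((hc.mono (closedBall_subset_ball hr)).integrableOn_compact
      (isCompact_closedBall ζ₀ r)).of_forall_sdiff_eq_zero
      (isOpen_chartImage e hU).measurableSet h1
  have h2 := surfaceIntegral_eq_integral_chart hU hF e
    (fun f η hη hf => h0 f η hη fun h => hf (disc_subset_source hr hB h)) hint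
  refine ⟨h2.1, h2.2.trans ?_⟩
  refine setIntegral_eq_of_subset_of_forall_sdiff_eq_zero (isOpen_chartImage e hU).measurableSet hB
    fun ζ hζ => h1 ζ ⟨hζ.1, fun h => hζ.2 (closedBall_subset_ball hr h)⟩

variable [T2Space R]

theorem patch_eventuallyEq_of_notMem (hr : r < R') (hB : ball ζ₀ R' ⊆ chartImage e U)
    {f : atlas ℂ R} {η : ℂ} (hη : η ∈ f.1.target) (hx : f.1.symm η ∉ disc e ζ₀ r) :
    (fun z => patch e ζ₀ r p q (f.1.symm z)) =ᶠ[𝓝 η] fun z => q (f.1.symm z) := by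
  filter_upwards [(continuousAt_symm hη).eventually
    ((isCompact_disc hr hB).isClosed.isOpen_compl.mem_nhds hx)] with z hz using patch_of_notMem hz

theorem del_patch_of_notMem (hr : r < R') (hB : ball ζ₀ R' ⊆ chartImage e U)
    {f : atlas ℂ R} {η : ℂ} (hη : η ∈ f.1.target) (hx : f.1.symm η ∉ disc e ζ₀ r) :
    del (patch e ζ₀ r p q) f =ᶠ[𝓝 η] del q f :=
  del_congr (patch_eventuallyEq_of_notMem hr hB hη hx)

variable [IsManifold 𝓘(ℂ, ℂ) ω R]

/-- The coordinate disc is compact, so it may be absorbed into the exceptional compact sets: the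
singular function `q` has to be smooth and harmonic only off the disc. -/
theorem vanishesAtBoundary_patch (hr : r < R') (hB : ball ζ₀ R' ⊆ chartImage e U)
    (hpq : ∀ η ∈ ball ζ₀ R', r < ‖η - ζ₀‖ → p η = q (e.1.symm η))
    (hp : ∀ η ∈ ball ζ₀ R', ContDiffAt ℝ 2 p η)
    (hq : ∀ x ∈ U, x ∉ disc e ζ₀ r → SmoothAt 2 q x)
    (hl : ∀ f, ∀ η ∈ chartImage f U, f.1.symm η ∉ disc e ζ₀ r → lap q f η = 0)
    (hb : ∀ ε > 0, ∃ K ⊆ U, IsCompact K ∧ ∀ x ∈ U, x ∉ K → |q x| < ε) :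
    VanishesAtBoundary U (patch e ζ₀ r p q) := by
  refine ⟨fun x hx => ?_, fun ε hε => ?_, disc e ζ₀ r, disc_subset hr hB, isCompact_disc hr hB,
    fun f η hη hd => ?_⟩
  · by_cases hd : x ∈ disc e ζ₀ r
    · obtain ⟨η, hη, rfl⟩ := hd
      have hη' := closedBall_subset_ball hr hη
      have ht := (hB hη').1
      refine SmoothAt.of_chart (e.1.map_target ht) ?_
      rw [e.1.right_inv ht]
      exact (hp η hη').congr_of_eventuallyEq (patch_symm_eventuallyEq hr hB hpq hη')
    · intro f hf
      refine (hq x hx hd f hf).congr_of_eventuallyEq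
        (patch_eventuallyEq_of_notMem hr hB (f.1.map_source hf) ?_)
      rwa [f.1.left_inv hf]
  · obtain ⟨K, hKU, hK, h⟩ := hb ε hε
    refine ⟨K ∪ disc e ζ₀ r, union_subset hKU (disc_subset hr hB), hK.union (isCompact_disc hr hB),
      fun x hx hxK => ?_⟩
    rw [mem_union, not_or] at hxK
    rw [patch_of_notMem hxK.2]
    exact h x hx hxK.1
  · rw [lap, wirtingerBar_congr (del_patch_of_notMem hr hB hη.1 hd)]
    exact hl f η hη hd

end Patch

/-! ### Symmetry of the Green's function -/

section Symmetry

open Metric InnerProductSpace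

theorem wirtingerBar_wirtinger_sub {f h : ℂ → ℂ} {ζ : ℂ} (hf : ContDiffAt ℝ 2 f ζ)
    (hh : ContDiffAt ℝ 2 h ζ) : wirtingerBar (wirtinger fun z => f z - h z) ζ =
      wirtingerBar (wirtinger f) ζ - wirtingerBar (wirtinger h) ζ := by
  have h1 : (wirtinger fun z => f z - h z) =ᶠ[𝓝 ζ] fun z => wirtinger f z - wirtinger h z := by
    filter_upwards [hf.eventually (by simp), hh.eventually (by simp)] with z hz1 hz2
    exact ((hasWirtinger (hz1.differentiableAt two_ne_zero)).sub
      (hasWirtinger (hz2.differentiableAt two_ne_zero))).wirtinger_eq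
  rw [wirtingerBar_congr h1]
  exact ((hasWirtinger ((ContDiffAt.wirtinger (m := 1) hf (by norm_num)).differentiableAt
    one_ne_zero)).sub (hasWirtinger ((ContDiffAt.wirtinger (m := 1) hh
      (by norm_num)).differentiableAt one_ne_zero))).wirtingerBar_eq

variable {R : Type*} [TopologicalSpace R] [ChartedSpace ℂ R] {U : Set R} {g : R → R → ℝ}

/-- The Green's function with its pole smoothed out. -/
def greenPatch (g : R → R → ℝ) (e : atlas ℂ R) (ζ₀ : ℂ) (r : ℝ) : R → ℝ :=
  patch e ζ₀ r (fun η => greenReg g e η ζ₀ - smoothLog r (η - ζ₀)) fun x => g x (e.1.symm ζ₀)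

variable {e : atlas ℂ R} {ζ₀ : ℂ} {r R' : ℝ}

/-- Off the disc the smoothed logarithm is the true one and cancels the logarithm added in
`greenReg`. -/
theorem greenPatch_compatible (hr0 : 0 < r) (η : ℂ) (hη : r < ‖η - ζ₀‖) :
    greenReg g e η ζ₀ - smoothLog r (η - ζ₀) = g (e.1.symm η) (e.1.symm ζ₀) := by
  have hne : η ≠ ζ₀ := by
    rintro rfl
    simp only [sub_self, norm_zero] at hη
    exact hη.not_gt hr0
  rw [greenReg_of_ne hne, smoothLog_of_le hr0 hη.le, add_sub_cancel_right]

theorem symm_mem_disc_self (hr0 : 0 < r) : e.1.symm ζ₀ ∈ disc e ζ₀ r :=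
  ⟨ζ₀, mem_closedBall_self hr0.le, rfl⟩

theorem contDiff_smoothLog_sub (hr0 : 0 < r) (n : ℕ∞) :
    ContDiff ℝ n fun z => (smoothLog r (z - ζ₀) : ℂ) :=
  (contDiff_smoothLog_ofReal hr0 n).comp (contDiff_id.sub contDiff_const)

theorem IsGreenFunction.smoothAt [IsManifold 𝓘(ℂ, ℂ) ω R] (hg : IsGreenFunction U g) {w x : R}
    (hw : w ∈ U) (hx : x ∈ U) (hne : x ≠ w) : SmoothAt 2 (fun y => g y w) x :=
  fun f hf => (hg.harmonic w hw x hx hne f hf).1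

/-- The regularised Green's function is harmonic, so only the smoothed logarithm contributes. -/
theorem lap_greenPatch (hg : IsGreenFunction U g) (hr0 : 0 < r) (hr : r < R')
    (hB : ball ζ₀ R' ⊆ chartImage e U) {η : ℂ} (hη : η ∈ ball ζ₀ R') :
    lap (greenPatch g e ζ₀ r) e η = -lapLog r (η - ζ₀) := by
  have hζ₀ : ζ₀ ∈ chartImage e U := hB (mem_ball_self (hr0.trans hr))
  have hh := hg.harmonicAt_greenReg (hB hη) hζ₀
  have hsl : ContDiffAt ℝ 2 (fun z => (smoothLog r (z - ζ₀) : ℂ)) η :=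
    (contDiff_smoothLog_sub hr0 2).contDiffAt
  rw [lap, greenPatch, wirtingerBar_congr (del_patch_of_mem_ball hr hB
    (fun η _ h => greenPatch_compatible hr0 η h) hη)]
  simp only [Complex.ofReal_sub]
  have h2 := wirtingerBar_wirtinger_comp (τ := fun z => z - ζ₀) (ζ := η)
    (contDiff_smoothLog_ofReal hr0 2).contDiffAt (by fun_prop)
  have hgr : ContDiffAt ℝ 2 (fun z => (greenReg g e z ζ₀ : ℂ)) η :=
    Complex.ofRealCLM.contDiff.contDiffAt.comp η hh.1
  rw [wirtingerBar_wirtinger_sub hgr hsl,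
    wirtinger_harmonic_holomorphic hh, h2]
  have h3 : deriv (fun z => z - ζ₀) η = 1 := by simp
  rw [h3]
  simp [lapLog]

theorem lap_greenPatch_of_notMem [T2Space R] (hg : IsGreenFunction U g) (hr0 : 0 < r)
    (hr : r < R') (hB : ball ζ₀ R' ⊆ chartImage e U) {f : atlas ℂ R} {η : ℂ}
    (hη : η ∈ chartImage f U) (hd : f.1.symm η ∉ disc e ζ₀ r) :
    lap (greenPatch g e ζ₀ r) f η = 0 := by
  have hζ₀ : ζ₀ ∈ chartImage e U := hB (mem_ball_self (hr0.trans hr))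
  rw [lap, greenPatch, wirtingerBar_congr (del_patch_of_notMem hr hB hη.1 hd)]
  exact wirtinger_harmonic_holomorphic (hg.harmonicAt hζ₀.2 hη
    fun h => hd (h ▸ symm_mem_disc_self hr0))

variable [CompactSpace R] [T2Space R] [IsManifold 𝓘(ℂ, ℂ) ω R]

theorem vanishesAtBoundary_greenPatch (hg : IsGreenFunction U g) (hU : IsOpen U) (hr0 : 0 < r)
    (hr : r < R') (hB : ball ζ₀ R' ⊆ chartImage e U) :
    VanishesAtBoundary U (greenPatch g e ζ₀ r) := by
  have hζ₀ : ζ₀ ∈ chartImage e U := hB (mem_ball_self (hr0.trans hr))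
  have hne : ∀ x, x ∉ disc e ζ₀ r → x ≠ e.1.symm ζ₀ := fun x hx h =>
    hx (h ▸ symm_mem_disc_self hr0)
  refine vanishesAtBoundary_patch hr hB (fun η _ h => greenPatch_compatible hr0 η h)
    (fun η hη => ?_) (fun x hx hd => hg.smoothAt hζ₀.2 hx (hne x hd)) (fun f η hη hd => ?_)
    fun ε hε => ?_
  · exact (hg.harmonicAt_greenReg (hB hη) hζ₀).1.sub
      ((contDiff_smoothLog hr0 2).comp (contDiff_id.sub contDiff_const)).contDiffAt
  · exact wirtinger_harmonic_holomorphic (hg.harmonicAt hζ₀.2 hη (hne _ hd))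
  · obtain ⟨K, hKU, hK, -, h⟩ := hg.exists_compact hU hζ₀.2 hε
    exact ⟨K, hKU, hK, h⟩

/-- The Laplacian of the smoothed Green's function reproduces the values of harmonic functions. -/
theorem surfaceIntegral_mul_lap_greenPatch (hg : IsGreenFunction U g) (hU : IsOpen U)
    (hr0 : 0 < r) (hr : r < R') (hB : ball ζ₀ R' ⊆ chartImage e U) {u : R → ℝ}
    (hu : HarmonicOnNhd (fun ζ => u (e.1.symm ζ)) (ball ζ₀ R')) :
    surfaceIntegral U (fun f η => (u (f.1.symm η) : ℂ) * lap (greenPatch g e ζ₀ r) f η) =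
      -(Real.pi / 2) * u (e.1.symm ζ₀) := by
  have hv := vanishesAtBoundary_greenPatch hg hU hr0 hr hB
  have hdel := isSmoothForm_del hU hv.smooth
  have huc : HarmonicOnNhd (fun ζ => (u (e.1.symm ζ) : ℂ)) (ball ζ₀ R') := fun ζ hζ =>
    (hu ζ hζ).comp_CLM Complex.ofRealCLM
  -- The Laplacian of the smoothed logarithm is known to vanish for norms strictly above `r`, hence
  -- the slightly larger radius in the mean value property.
  obtain ⟨ρ, hρ, hρ'⟩ := exists_between hr
  have hF : IsTwoForm U fun f η => (u (f.1.symm η) : ℂ) * lap (greenPatch g e ζ₀ r) f η :=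
    (hdel.isTwoForm hU).mul fun x => (u x : ℂ)
  rw [(surfaceIntegral_eq_integral_ball hU hr hB hF ?_ ?_).2]
  · have h1 := integral_radial_mul_harmonic (φ := fun x => -lapLog r x) hρ'
      (continuous_lapLog hr0).neg (fun x hx => by rw [lapLog_eq_zero hr0 (hρ.trans_le hx), neg_zero])
      (fun v x hv => by rw [lapLog_rotate hr0 hv]) huc
    rw [integral_neg, integral_lapLog hr0] at h1
    have h2 : ∀ ζ, ζ ∉ ball ζ₀ R' → -lapLog r (ζ - ζ₀) * (u (e.1.symm ζ) : ℂ) = 0 := by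
      intro ζ hζ
      rw [mem_ball, dist_eq_norm, not_lt] at hζ
      rw [lapLog_eq_zero hr0 (hr.trans_le hζ), neg_zero, zero_mul]
    rw [← h1, ← setIntegral_eq_integral_of_forall_compl_eq_zero h2]
    refine setIntegral_congr_fun isOpen_ball.measurableSet fun ζ hζ => ?_
    simp only [lap_greenPatch hg hr0 hr hB hζ]
    ring
  · exact (ContDiffOn.continuousOn fun ζ hζ => (huc ζ hζ).1.contDiffWithinAt).mul
      ((hdel.continuousOn_wirtingerBar hU e).mono hB)
  · intro f η hη hd
    rw [lap_greenPatch_of_notMem hg hr0 hr hB hη hd, mul_zero]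

/-- Green's second identity: by Stokes' theorem both integrals are minus a Dirichlet pairing of ∂v₁
and ∂v₂, which is Hermitian. -/
theorem surfaceIntegral_lap_comm (hU : IsOpen U) {v₁ v₂ : R → ℝ} (h₁ : VanishesAtBoundary U v₁)
    (h₂ : VanishesAtBoundary U v₂) :
    surfaceIntegral U (fun e ζ => (v₁ (e.1.symm ζ) : ℂ) * lap v₂ e ζ) =
      conj (surfaceIntegral U fun e ζ => (v₂ (e.1.symm ζ) : ℂ) * lap v₁ e ζ) := by
  have s1 := stokes_of_vanishesAtBoundary hU h₁ (isSmoothForm_del hU h₂.smooth)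
    (memLp_del hU h₂) h₂.harmonic
  have s2 := stokes_of_vanishesAtBoundary hU h₂ (isSmoothForm_del hU h₁.smooth)
    (memLp_del hU h₁) h₁.harmonic
  have h3 : surfaceIntegral U (fun e ζ => conj (del v₁ e ζ) * del v₂ e ζ) =
      conj (surfaceIntegral U fun e ζ => conj (del v₂ e ζ) * del v₁ e ζ) := by
    simp only [surfaceIntegral, map_sum, ← integral_conj, map_mul, Complex.conj_conj, mul_comm]
  have s3 := congrArg conj s2
  rw [map_add, ← h3, map_zero] at s3
  exact add_left_cancel (s1.trans s3.symm)

/-- The Green's function is symmetric. -/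
theorem IsGreenFunction.symm (hg : IsGreenFunction U g) (hU : IsOpen U) {z w : R} (hz : z ∈ U)
    (hw : w ∈ U) (hne : z ≠ w) : g z w = g w z := by
  obtain ⟨N₁, N₂, hN₁, hN₂, hzN, hwN, hdisj⟩ := t2_separation hne
  obtain ⟨e₁, he₁⟩ := exists_chart z
  obtain ⟨e₂, he₂⟩ := exists_chart w
  obtain ⟨R₁, hR₁, hB₁⟩ := Metric.isOpen_iff.1 (isOpen_chartImage e₁ (hU.inter hN₁)) _
    (mem_chartImage he₁ ⟨hz, hzN⟩)
  obtain ⟨R₂, hR₂, hB₂⟩ := Metric.isOpen_iff.1 (isOpen_chartImage e₂ (hU.inter hN₂)) _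
    (mem_chartImage he₂ ⟨hw, hwN⟩)
  have hB₁' := hB₁.trans (chartImage_mono e₁ inter_subset_left)
  have hB₂' := hB₂.trans (chartImage_mono e₂ inter_subset_left)
  -- The discs around the two poles are disjoint, so on the disc of one pole the smoothed function
  -- of the other is the true, harmonic Green's function, and its value at the centre is reproduced.
  have key : ∀ {e₁ e₂ : atlas ℂ R} {x y : R} {N₁ N₂ : Set R} {R₁ R₂ : ℝ}, x ∈ e₁.1.source →
      y ∈ e₂.1.source → Disjoint N₁ N₂ → 0 < R₁ → 0 < R₂ →
      ball (e₁.1 x) R₁ ⊆ chartImage e₁ (U ∩ N₁) → ball (e₂.1 y) R₂ ⊆ chartImage e₂ (U ∩ N₂) →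
      surfaceIntegral U (fun f η => (greenPatch g e₁ (e₁.1 x) (R₁ / 2) (f.1.symm η) : ℂ) *
        lap (greenPatch g e₂ (e₂.1 y) (R₂ / 2)) f η) = -(Real.pi / 2) * g y x := by
    intro e₁ e₂ x y N₁ N₂ R₁ R₂ hx hy hd h1 h2 hB1 hB2
    have hoff : ∀ η ∈ ball (e₂.1 y) R₂, e₂.1.symm η ∉ disc e₁ (e₁.1 x) (R₁ / 2) := by
      rintro η hη ⟨ξ, hξ, h⟩
      refine Set.disjoint_left.1 hd (hB1 (closedBall_subset_ball (half_lt_self h1) hξ)).2.2 ?_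
      rw [h]
      exact (hB2 hη).2.2
    have hxU := (hB1 (mem_ball_self h1)).2.1
    rw [e₁.1.left_inv hx] at hxU
    have hxd : x ∈ disc e₁ (e₁.1 x) (R₁ / 2) := by
      have h := symm_mem_disc_self (e := e₁) (ζ₀ := e₁.1 x) (half_pos h1)
      rwa [e₁.1.left_inv hx] at h
    have heq : ∀ η ∈ ball (e₂.1 y) R₂, greenPatch g e₁ (e₁.1 x) (R₁ / 2) (e₂.1.symm η) =
        g (e₂.1.symm η) x := fun η hη => by
      rw [greenPatch, patch_of_notMem (hoff η hη), e₁.1.left_inv hx]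
    rw [surfaceIntegral_mul_lap_greenPatch hg hU (half_pos h2) (half_lt_self h2)
      (hB2.trans (chartImage_mono e₂ inter_subset_left)),
      heq _ (mem_ball_self h2), e₂.1.left_inv hy]
    intro η hη
    refine (harmonicAt_congr_nhds (f₂ := fun ζ => g (e₂.1.symm ζ) x) ?_).2
      (hg.harmonicAt hxU ⟨(hB2 hη).1, (hB2 hη).2.1⟩ fun h => hoff η hη (h ▸ hxd))
    filter_upwards [isOpen_ball.mem_nhds hη] with ζ hζ using heq ζ hζ
  have hc := surfaceIntegral_lap_comm hU
    (vanishesAtBoundary_greenPatch hg hU (half_pos hR₁) (half_lt_self hR₁) hB₁')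
    (vanishesAtBoundary_greenPatch hg hU (half_pos hR₂) (half_lt_self hR₂) hB₂')
  rw [key he₁ he₂ hdisj hR₁ hR₂ hB₁ hB₂, key he₂ he₁ hdisj.symm hR₂ hR₁ hB₂ hB₁] at hc
  have h4 : (-((Real.pi : ℂ) / 2) * (g w z : ℂ)) = ((-(Real.pi / 2) * g w z : ℝ) : ℂ) := by
    push_cast; ring
  have h5 : (-((Real.pi : ℂ) / 2) * (g z w : ℂ)) = ((-(Real.pi / 2) * g z w : ℝ) : ℂ) := by
    push_cast; ring
  rw [h4, h5, Complex.conj_ofReal, Complex.ofReal_inj] at hc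
  have hpi : -(Real.pi / 2) ≠ 0 := by have := Real.pi_pos; linarith
  exact (mul_left_cancel₀ hpi hc).symm

end Symmetry

/-! ### Joint smoothness of the Green's function -/

section JointSmoothness

open Metric InnerProductSpace

variable {R : Type*} [TopologicalSpace R] [ChartedSpace ℂ R] {U : Set R} {g : R → R → ℝ}

/-- The value at η is the average over the circle of radius `s`. There g ≥ 0 leaves at least log|z -
ζ|, whose average is log s because ζ lies inside the circle. This lower bound is what joint
smoothness across the diagonal requires. -/
theorem IsGreenFunction.log_le_greenReg [CompactSpace R] [T2Space R] [ConnectedSpace R]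
    (hg : IsGreenFunction U g) (hU : IsOpen U)
    {e : atlas ℂ R} {ζ₀ : ℂ} {s : ℝ} (hs : 0 < s) (hB : ball ζ₀ (2 * s) ⊆ chartImage e U)
    {η ζ : ℂ} (hη : η ∈ ball ζ₀ (s / 2)) (hζ : ζ ∈ ball ζ₀ (s / 2)) :
    Real.log s ≤ greenReg g e η ζ := by
  have hsub : closedBall η |s| ⊆ ball ζ₀ (2 * s) := by
    rw [abs_of_pos hs]
    refine closedBall_subset_ball' ?_
    have := mem_ball.1 hη
    linarith
  have hζB : ζ ∈ ball ζ₀ (2 * s) := ball_subset_ball (by linarith) hζ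
  have hd : dist ζ η < s := by
    have h1 := dist_triangle_right ζ η ζ₀
    have h2 := mem_ball.1 hη
    have h3 := mem_ball.1 hζ
    linarith
  have hh : HarmonicOnNhd (fun z => greenReg g e z ζ) (closedBall η |s|) := fun z hz =>
    hg.harmonicAt_greenReg (hB (hsub hz)) (hB hζB)
  rw [← hh.circleAverage_eq, ← circleAverage_log_norm_sub_const_of_mem_closedBall
    (c := η) (R := s) (a := ζ) (by rw [abs_of_pos hs]; exact mem_closedBall.2 hd.le)]
  refine Real.circleAverage_mono (circleIntegrable_log_norm_sub_const s)
    (hh.continuousOn.mono sphere_subset_closedBall).circleIntegrable' fun z hz => ?_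
  have hzB := hB (hsub (sphere_subset_closedBall hz))
  have hne : z ≠ ζ := by
    rintro rfl
    rw [mem_sphere, abs_of_pos hs] at hz
    exact hd.ne hz
  rw [greenReg_of_ne hne]
  have := hg.nonneg hU (hB hζB).2 hzB.2 (symm_ne_symm hzB.1 (hB hζB).1 hne)
  linarith

variable [CompactSpace R] [T2Space R] [IsManifold 𝓘(ℂ, ℂ) ω R]

theorem IsGreenFunction.greenReg_symm (hg : IsGreenFunction U g) (hU : IsOpen U) {e : atlas ℂ R}
    {η ζ : ℂ} (hη : η ∈ chartImage e U) (hζ : ζ ∈ chartImage e U) :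
    greenReg g e η ζ = greenReg g e ζ η := by
  by_cases h : η = ζ
  · rw [h]
  · rw [greenReg_of_ne h, greenReg_of_ne (Ne.symm h), norm_sub_rev,
      hg.symm hU hη.2 hζ.2 (symm_ne_symm hη.1 hζ.1 h)]

/-- Symmetry carries harmonicity over to the pole variable. -/
theorem IsGreenFunction.harmonicAt_right (hg : IsGreenFunction U g) (hU : IsOpen U) {w : R}
    (hw : w ∈ U) {f : atlas ℂ R} {η : ℂ} (hη : η ∈ chartImage f U) (hne : f.1.symm η ≠ w) :
    HarmonicAt (fun z => g w (f.1.symm z)) η := by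
  refine (harmonicAt_congr_nhds (f₂ := fun z => g (f.1.symm z) w) ?_).2 (hg.harmonicAt hw hη hne)
  filter_upwards [(isOpen_chartImage f hU).mem_nhds hη,
    (continuousAt_symm hη.1).eventually (isOpen_ne.mem_nhds hne)] with z hz hzw
  exact hg.symm hU hw hz.2 (Ne.symm hzw)

theorem IsGreenFunction.harmonicAt_greenReg_right (hg : IsGreenFunction U g) (hU : IsOpen U)
    {e : atlas ℂ R} {η ζ : ℂ} (hη : η ∈ chartImage e U) (hζ : ζ ∈ chartImage e U) :
    HarmonicAt (greenReg g e η) ζ := by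
  refine (harmonicAt_congr_nhds (f₂ := fun z => greenReg g e z η) ?_).2
    (hg.harmonicAt_greenReg hζ hη)
  filter_upwards [(isOpen_chartImage e hU).mem_nhds hζ] with z hz using hg.greenReg_symm hU hη hz

variable [ConnectedSpace R]

/-- The Green's function is jointly smooth off the diagonal. -/
theorem IsGreenFunction.contDiffAt (hg : IsGreenFunction U g) (hU : IsOpen U) {e f : atlas ℂ R}
    {η ζ : ℂ} (hη : η ∈ chartImage f U) (hζ : ζ ∈ chartImage e U)
    (hne : f.1.symm η ≠ e.1.symm ζ) (n : ℕ∞) :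
    ContDiffAt ℝ n (fun p : ℂ × ℂ => g (f.1.symm p.1) (e.1.symm p.2)) (η, ζ) := by
  obtain ⟨N₁, N₂, hN₁, hN₂, hN₁', hN₂', hdisj⟩ := t2_separation hne
  obtain ⟨R₁, hR₁, hB₁⟩ := Metric.isOpen_iff.1 (isOpen_chartImage f (hU.inter hN₁)) η
    ⟨hη.1, hη.2, hN₁'⟩
  obtain ⟨R₂, hR₂, hB₂⟩ := Metric.isOpen_iff.1 (isOpen_chartImage e (hU.inter hN₂)) ζ
    ⟨hζ.1, hζ.2, hN₂'⟩
  have h1 : ∀ x ∈ ball η (min R₁ R₂), x ∈ chartImage f (U ∩ N₁) := fun x hx =>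
    hB₁ (ball_subset_ball (min_le_left _ _) hx)
  have h2 : ∀ x ∈ ball ζ (min R₁ R₂), x ∈ chartImage e (U ∩ N₂) := fun x hx =>
    hB₂ (ball_subset_ball (min_le_right _ _) hx)
  have h12 : ∀ x ∈ ball η (min R₁ R₂), ∀ y ∈ ball ζ (min R₁ R₂), f.1.symm x ≠ e.1.symm y :=
    fun x hx y hy h => Set.disjoint_left.1 hdisj (h1 x hx).2.2 (h ▸ (h2 y hy).2.2)
  exact contDiffAt_of_separately_harmonic (u := fun x y => g (f.1.symm x) (e.1.symm y)) (C := 0)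
    (lt_min hR₁ hR₂)
    (fun y hy x hx => hg.harmonicAt (h2 y hy).2.1 ⟨(h1 x hx).1, (h1 x hx).2.1⟩ (h12 x hx y hy))
    (fun x hx y hy => hg.harmonicAt_right hU (h1 x hx).2.1 ⟨(h2 y hy).1, (h2 y hy).2.1⟩
      (h12 x hx y hy).symm)
    (fun x hx y hy => hg.nonneg hU (h2 y hy).2.1 (h1 x hx).2.1 (h12 x hx y hy)) n

/-- The regularised Green's function is jointly smooth. -/
theorem IsGreenFunction.contDiffAt_greenReg (hg : IsGreenFunction U g) (hU : IsOpen U)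
    {e : atlas ℂ R} {η ζ : ℂ} (hη : η ∈ chartImage e U) (hζ : ζ ∈ chartImage e U) (n : ℕ∞) :
    ContDiffAt ℝ n (fun p : ℂ × ℂ => greenReg g e p.1 p.2) (η, ζ) := by
  by_cases h : η = ζ
  · subst h
    obtain ⟨r, hr, hB⟩ := Metric.isOpen_iff.1 (isOpen_chartImage e hU) η hη
    have hB' : ball η (2 * (r / 2)) ⊆ chartImage e U := by rwa [mul_div_cancel₀ r two_ne_zero]
    have hsub : ∀ x ∈ ball η (r / 2 / 2), x ∈ chartImage e U := fun x hx =>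
      hB (ball_subset_ball (by linarith) hx)
    exact contDiffAt_of_separately_harmonic (u := greenReg g e) (R := r / 2 / 2) (by positivity)
      (fun y hy x hx => hg.harmonicAt_greenReg (hsub x hx) (hsub y hy))
      (fun x hx y hy => hg.harmonicAt_greenReg_right hU (hsub x hx) (hsub y hy))
      (fun x hx y hy => hg.log_le_greenReg hU (half_pos hr) hB' hx hy) n
  · have h1 := hg.contDiffAt hU hη hζ (symm_ne_symm hη.1 hζ.1 h) n
    have h2 : ContDiffAt ℝ n (fun p : ℂ × ℂ => Real.log ‖p.1 - p.2‖) (η, ζ) :=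
      (contDiffAt_log_norm (sub_ne_zero.2 h) n).comp (η, ζ)
        (contDiff_fst.sub contDiff_snd).contDiffAt
    refine (h1.add h2).congr_of_eventuallyEq ?_
    filter_upwards [(isOpen_ne_fun continuous_fst continuous_snd).mem_nhds h] with p hp
    exact greenReg_of_ne hp

end JointSmoothness

/-! ### Derivatives with respect to a parameter -/

section PartialDerivatives

variable {E : Type*} [NormedAddCommGroup E] [NormedSpace ℝ E]

theorem fderiv_left_eq {F : ℂ × ℂ → E} {p : ℂ × ℂ} (hF : DifferentiableAt ℝ F p) (s : ℂ) :
    fderiv ℝ (fun η => F (η, p.2)) p.1 s = fderiv ℝ F p (s, 0) := by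
  have h : HasFDerivAt (fun η => F (η, p.2)) _ p.1 :=
    HasFDerivAt.comp (f := fun x : ℂ => (x, p.2)) p.1 hF.hasFDerivAt
      (hasFDerivAt_prodMk_left p.1 p.2)
  rw [h.fderiv]; simp

theorem fderiv_right_eq {F : ℂ × ℂ → E} {p : ℂ × ℂ} (hF : DifferentiableAt ℝ F p) (t : ℂ) :
    fderiv ℝ (fun ζ => F (p.1, ζ)) p.2 t = fderiv ℝ F p (0, t) := by
  have h : HasFDerivAt (fun ζ => F (p.1, ζ)) _ p.2 :=
    HasFDerivAt.comp (f := fun x : ℂ => (p.1, x)) p.2 hF.hasFDerivAt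
      (hasFDerivAt_prodMk_right p.1 p.2)
  rw [h.fderiv]; simp

/-- The partial derivative is a value of the total derivative at all points near `p`; the exclusion
of `n = ∞` makes differentiability of class C^n an open condition. -/
theorem ContDiffAt.fderiv_left {F : ℂ × ℂ → E} {p : ℂ × ℂ} {n m : WithTop ℕ∞}
    (hF : ContDiffAt ℝ n F p) (hn : n ≠ ((⊤ : ℕ∞) : WithTop ℕ∞)) (hmn : m + 1 ≤ n) (s : ℂ) :
    ContDiffAt ℝ m (fun q : ℂ × ℂ => fderiv ℝ (fun η => F (η, q.2)) q.1 s) p := by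
  refine ((hF.fderiv_right hmn).clm_apply (contDiffAt_const (c := ((s, 0) : ℂ × ℂ)))
    ).congr_of_eventuallyEq ?_
  filter_upwards [hF.eventually hn] with q hq
  exact fderiv_left_eq (hq.differentiableAt (ne_of_gt (lt_of_lt_of_le (by simp)
    (le_add_self.trans hmn)))) s

theorem ContDiffAt.fderiv_right_apply {F : ℂ × ℂ → E} {p : ℂ × ℂ} {n m : WithTop ℕ∞}
    (hF : ContDiffAt ℝ n F p) (hn : n ≠ ((⊤ : ℕ∞) : WithTop ℕ∞)) (hmn : m + 1 ≤ n) (t : ℂ) :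
    ContDiffAt ℝ m (fun q : ℂ × ℂ => fderiv ℝ (fun ζ => F (q.1, ζ)) q.2 t) p := by
  refine ((hF.fderiv_right hmn).clm_apply (contDiffAt_const (c := ((0, t) : ℂ × ℂ)))
    ).congr_of_eventuallyEq ?_
  filter_upwards [hF.eventually hn] with q hq
  exact fderiv_right_eq (hq.differentiableAt (ne_of_gt (lt_of_lt_of_le (by simp)
    (le_add_self.trans hmn)))) t

theorem ContDiffAt.slice_left {F : ℂ × ℂ → E} {a b : ℂ} {n : WithTop ℕ∞}
    (hF : ContDiffAt ℝ n F (a, b)) : ContDiffAt ℝ n (fun η => F (η, b)) a :=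
  hF.comp (f := fun η : ℂ => (η, b)) a (contDiff_id.prodMk contDiff_const).contDiffAt

theorem ContDiffAt.slice_right {F : ℂ × ℂ → E} {a b : ℂ} {n : WithTop ℕ∞}
    (hF : ContDiffAt ℝ n F (a, b)) : ContDiffAt ℝ n (fun ζ => F (a, ζ)) b :=
  hF.comp (f := fun ζ : ℂ => (a, ζ)) b (contDiff_const.prodMk contDiff_id).contDiffAt

theorem hasFDerivAt_fderiv_left {F : ℂ × ℂ → E} {a b : ℂ} (hF : ContDiffAt ℝ 2 F (a, b)) (s : ℂ) :
    HasFDerivAt (fun ζ => fderiv ℝ (fun η => F (η, ζ)) a s)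
      (fderiv ℝ (fun ζ => fderiv ℝ (fun η => F (η, ζ)) a s) b) b :=
  ((ContDiffAt.slice_right (ContDiffAt.fderiv_left (m := 1) hF (by simp)
    (by norm_num) s)).differentiableAt one_ne_zero).hasFDerivAt

theorem wirtinger_fderiv {F : ℂ × ℂ → ℂ} {a b : ℂ} (hF : ContDiffAt ℝ 2 F (a, b)) (t : ℂ) :
    wirtinger (fun η => fderiv ℝ (fun ζ => F (η, ζ)) b t) a =
      fderiv ℝ (fun ζ => wirtinger (fun η => F (η, ζ)) a) b t := by
  have h := (((hasFDerivAt_fderiv_left hF 1).sub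
    ((hasFDerivAt_fderiv_left hF Complex.I).const_mul Complex.I)).mul_const (2⁻¹ : ℂ)).fderiv
  simp only [wirtinger, div_eq_mul_inv]
  refine Eq.trans ?_ (congrArg (fun L : ℂ →L[ℝ] ℂ => L t) h.symm)
  simp [← fderiv_fderiv_comm hF, mul_comm]

theorem wirtingerBar_fderiv {F : ℂ × ℂ → ℂ} {a b : ℂ} (hF : ContDiffAt ℝ 2 F (a, b)) (t : ℂ) :
    wirtingerBar (fun η => fderiv ℝ (fun ζ => F (η, ζ)) b t) a =
      fderiv ℝ (fun ζ => wirtingerBar (fun η => F (η, ζ)) a) b t := by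
  have h := (((hasFDerivAt_fderiv_left hF 1).add
    ((hasFDerivAt_fderiv_left hF Complex.I).const_mul Complex.I)).mul_const (2⁻¹ : ℂ)).fderiv
  simp only [wirtingerBar, div_eq_mul_inv]
  refine Eq.trans ?_ (congrArg (fun L : ℂ →L[ℝ] ℂ => L t) h.symm)
  simp [← fderiv_fderiv_comm hF, mul_comm, mul_add]

theorem ContDiffAt.wirtinger_left {F : ℂ × ℂ → ℂ} {p : ℂ × ℂ} {n m : WithTop ℕ∞}
    (hF : ContDiffAt ℝ n F p) (hn : n ≠ ((⊤ : ℕ∞) : WithTop ℕ∞)) (hmn : m + 1 ≤ n) :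
    ContDiffAt ℝ m (fun q : ℂ × ℂ => Schiffer.wirtinger (fun η => F (η, q.2)) q.1) p :=
  ((ContDiffAt.fderiv_left hF hn hmn 1).sub
    (contDiffAt_const.mul (ContDiffAt.fderiv_left hF hn hmn Complex.I))).div_const 2

/-- The derivative with respect to a parameter of a family of harmonic functions is harmonic. -/
theorem wirtingerBar_wirtinger_fderiv {F : ℂ × ℂ → ℂ} {a b : ℂ} (hF : ContDiffAt ℝ 3 F (a, b))
    (h : ∀ᶠ p : ℂ × ℂ in 𝓝 (a, b), wirtingerBar (wirtinger fun η => F (η, p.2)) p.1 = 0) (t : ℂ) :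
    wirtingerBar (wirtinger fun η => fderiv ℝ (fun ζ => F (η, ζ)) b t) a = 0 := by
  have h1 : (wirtinger fun η => fderiv ℝ (fun ζ => F (η, ζ)) b t) =ᶠ[𝓝 a]
      fun η => fderiv ℝ (fun ζ => wirtinger (fun η => F (η, ζ)) η) b t := by
    filter_upwards [(Continuous.tendsto (f := fun η : ℂ => (η, b)) (by fun_prop) a).eventually
      (hF.eventually (by simp))] with η hη
    exact wirtinger_fderiv (hη.of_le (by norm_num)) t
  have h2 := wirtingerBar_fderiv (F := fun q : ℂ × ℂ => wirtinger (fun η => F (η, q.2)) q.1)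
    (ContDiffAt.wirtinger_left (m := 2) hF (by simp) (by norm_num)) t
  have h3 : (fun ζ => wirtingerBar (wirtinger fun η => F (η, ζ)) a) =ᶠ[𝓝 b] fun _ => 0 := by
    filter_upwards [(Continuous.tendsto (f := fun ζ : ℂ => (a, ζ)) (by fun_prop) b).eventually h]
      with ζ hζ using hζ
  rw [wirtingerBar_congr h1]
  refine h2.trans ?_
  have h4 := h3.fderiv_eq (𝕜 := ℝ)
  refine (congrArg (fun L : ℂ →L[ℝ] ℂ => L t) h4).trans ?_
  simp

theorem ofReal_fderiv {u : ℂ → ℝ} {b : ℂ} (hu : DifferentiableAt ℝ u b) (t : ℂ) :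
    fderiv ℝ (fun ζ => (u ζ : ℂ)) b t = (fderiv ℝ u b t : ℂ) := by
  have h : HasFDerivAt (fun ζ => (u ζ : ℂ)) (Complex.ofRealCLM.comp (fderiv ℝ u b)) b :=
    Complex.ofRealCLM.hasFDerivAt.comp b hu.hasFDerivAt
  rw [h.fderiv]; simp

end PartialDerivatives

/-! ### Derivatives of the Green's function in the pole -/

section GreenDerivative

open Metric InnerProductSpace

variable {R : Type*} [TopologicalSpace R] [ChartedSpace ℂ R] {U : Set R} {g : R → R → ℝ}

/-- The derivative of `g x w` with respect to `w` in the direction `a`, in the chart `e`. -/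
def greenDir (g : R → R → ℝ) (e : atlas ℂ R) (ζ₀ a : ℂ) (x : R) : ℝ :=
  fderiv ℝ (fun ζ => g x (e.1.symm ζ)) ζ₀ a

/-- The derivative of the regularised Green's function with respect to the pole. -/
def greenRegDir (g : R → R → ℝ) (e : atlas ℂ R) (ζ₀ a η : ℂ) : ℝ := fderiv ℝ (greenReg g e η) ζ₀ a

variable {e : atlas ℂ R} {ζ₀ : ℂ}

theorem fderiv_log_norm {x : ℂ} (hx : x ≠ 0) (a : ℂ) :
    fderiv ℝ (fun z : ℂ => Real.log ‖z‖) x a = (a / x).re := by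
  have hd := (contDiffAt_log_norm hx 1).differentiableAt one_ne_zero
  have h1 := ofReal_fderiv hd a
  rw [HasFDerivAt.fderiv (hasWirtinger_log_norm hx), wirtingerCLM_apply] at h1
  apply Complex.ofReal_injective
  rw [← h1, Complex.re_eq_add_conj, map_div₀]
  have hc : conj x ≠ 0 := by simpa using hx
  field_simp

/-- The last term is the derivative of -log|ζ - η| in ζ at ζ₀ in the direction `a`: differentiation
in the pole turns the logarithmic pole into a simple one. -/
theorem greenDir_symm [CompactSpace R] [T2Space R] [IsManifold 𝓘(ℂ, ℂ) ω R]
    (hg : IsGreenFunction U g) (hU : IsOpen U) (hζ₀ : ζ₀ ∈ chartImage e U)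
    (a : ℂ) {η : ℂ} (hη : η ∈ chartImage e U) (hne : η ≠ ζ₀) :
    greenDir g e ζ₀ a (e.1.symm η) = greenRegDir g e ζ₀ a η + (a / (η - ζ₀)).re := by
  have h1 : HasFDerivAt (greenReg g e η) (fderiv ℝ (greenReg g e η) ζ₀) ζ₀ :=
    ((hg.harmonicAt_greenReg_right hU hη hζ₀).1.differentiableAt two_ne_zero).hasFDerivAt
  have h2 : HasFDerivAt (fun ζ => Real.log ‖ζ - η‖)
      (fderiv ℝ (fun z : ℂ => Real.log ‖z‖) (ζ₀ - η)) ζ₀ := by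
    have h := ((contDiffAt_log_norm (sub_ne_zero.2 hne.symm) 1).differentiableAt
      one_ne_zero).hasFDerivAt.comp ζ₀ ((hasFDerivAt_id (𝕜 := ℝ) ζ₀).sub_const η)
    exact h
  have h3 : (fun ζ => g (e.1.symm η) (e.1.symm ζ)) =ᶠ[𝓝 ζ₀]
      fun ζ => greenReg g e η ζ - Real.log ‖ζ - η‖ := by
    filter_upwards [isOpen_ne.mem_nhds hne.symm] with ζ hζ
    rw [greenReg_of_ne (Ne.symm hζ), norm_sub_rev ζ η, add_sub_cancel_right]
  rw [greenDir, h3.fderiv_eq]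
  refine (congrArg (fun L : ℂ →L[ℝ] ℝ => L a) (h1.sub h2).fderiv).trans ?_
  rw [_root_.sub_apply, fderiv_log_norm (sub_ne_zero.2 hne.symm), greenRegDir, ← neg_sub η ζ₀,
    div_neg, Complex.neg_re, sub_neg_eq_add]

variable [CompactSpace R] [T2Space R] [ConnectedSpace R] [IsManifold 𝓘(ℂ, ℂ) ω R]

theorem contDiffAt_greenDir (hg : IsGreenFunction U g) (hU : IsOpen U) (hζ₀ : ζ₀ ∈ chartImage e U)
    (a : ℂ) {f : atlas ℂ R} {η : ℂ} (hη : η ∈ chartImage f U)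
    (hne : f.1.symm η ≠ e.1.symm ζ₀) :
    ContDiffAt ℝ 2 (fun z => greenDir g e ζ₀ a (f.1.symm z)) η :=
  ContDiffAt.slice_left (ContDiffAt.fderiv_right_apply (m := 2) (n := 3)
    (hg.contDiffAt hU hη hζ₀ hne 3) (by norm_num) (by norm_num) a)

theorem smoothAt_greenDir (hg : IsGreenFunction U g) (hU : IsOpen U) (hζ₀ : ζ₀ ∈ chartImage e U)
    (a : ℂ) {x : R} (hx : x ∈ U) (hne : x ≠ e.1.symm ζ₀) : SmoothAt 2 (greenDir g e ζ₀ a) x :=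
  fun f hf => contDiffAt_greenDir hg hU hζ₀ a (mem_chartImage hf hx) (by rwa [f.1.left_inv hf])

theorem contDiffAt_greenRegDir (hg : IsGreenFunction U g) (hU : IsOpen U)
    (hζ₀ : ζ₀ ∈ chartImage e U) (a : ℂ) {η : ℂ} (hη : η ∈ chartImage e U) :
    ContDiffAt ℝ 2 (greenRegDir g e ζ₀ a) η :=
  ContDiffAt.slice_left (ContDiffAt.fderiv_right_apply (m := 2) (n := 3)
    (hg.contDiffAt_greenReg hU hη hζ₀ 3) (by norm_num) (by norm_num) a)

theorem contDiffAt_ofReal_comp {F : ℂ × ℂ → ℝ} {p : ℂ × ℂ} {n : WithTop ℕ∞}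
    (h : ContDiffAt ℝ n F p) : ContDiffAt ℝ n (fun q => (F q : ℂ)) p :=
  Complex.ofRealCLM.contDiff.contDiffAt.comp p h

theorem wirtinger_ofReal_fderiv {F : ℂ × ℂ → ℝ} {η : ℂ} (h : ContDiffAt ℝ 1 F (η, ζ₀)) (a : ℂ) :
    (wirtinger fun z => ((fderiv ℝ (fun ζ => F (z, ζ)) ζ₀ a : ℝ) : ℂ)) =ᶠ[𝓝 η]
      wirtinger fun z => fderiv ℝ (fun ζ => (F (z, ζ) : ℂ)) ζ₀ a := by
  have hev : (fun z => ((fderiv ℝ (fun ζ => F (z, ζ)) ζ₀ a : ℝ) : ℂ)) =ᶠ[𝓝 η]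
      fun z => fderiv ℝ (fun ζ => (F (z, ζ) : ℂ)) ζ₀ a := by
    filter_upwards [(Continuous.tendsto (f := fun z : ℂ => (z, ζ₀)) (by fun_prop) η).eventually
      (h.eventually (by simp))] with z hz
    exact (ofReal_fderiv (u := fun ζ => F (z, ζ))
      ((ContDiffAt.slice_right hz).differentiableAt one_ne_zero) a).symm
  filter_upwards [hev.eventuallyEq_nhds] with z hz using wirtinger_congr hz

theorem lap_greenDir (hg : IsGreenFunction U g) (hU : IsOpen U) (hζ₀ : ζ₀ ∈ chartImage e U)
    (a : ℂ) {f : atlas ℂ R} {η : ℂ} (hη : η ∈ chartImage f U)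
    (hne : f.1.symm η ≠ e.1.symm ζ₀) : lap (greenDir g e ζ₀ a) f η = 0 := by
  have h := hg.contDiffAt hU hη hζ₀ hne 3
  have h1 : del (greenDir g e ζ₀ a) f =ᶠ[𝓝 η] _ :=
    wirtinger_ofReal_fderiv (h.of_le (by norm_num)) a
  rw [lap, wirtingerBar_congr h1]
  refine wirtingerBar_wirtinger_fderiv (F := fun p : ℂ × ℂ => (g (f.1.symm p.1) (e.1.symm p.2) : ℂ))
    (contDiffAt_ofReal_comp h) ?_ a
  have hc : ContinuousAt (fun p : ℂ × ℂ => (f.1.symm p.1, e.1.symm p.2)) (η, ζ₀) :=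
    (ContinuousAt.comp (f := Prod.fst) (x := (η, ζ₀)) (continuousAt_symm hη.1)
      continuousAt_fst).prodMk
      (ContinuousAt.comp (f := Prod.snd) (x := (η, ζ₀)) (continuousAt_symm hζ₀.1) continuousAt_snd)
  filter_upwards [prod_mem_nhds ((isOpen_chartImage f hU).mem_nhds hη)
    ((isOpen_chartImage e hU).mem_nhds hζ₀), hc.eventually
      ((isOpen_ne_fun continuous_fst continuous_snd).mem_nhds hne)] with p hp hpne
  exact wirtinger_harmonic_holomorphic (hg.harmonicAt hp.2.2 hp.1 hpne)

/-- Differentiation in the parameter commutes with ∂̄∂, so the derivative of a family of harmonic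
functions is harmonic, and ∂ of it is holomorphic. -/
theorem wirtinger_greenRegDir_holomorphic (hg : IsGreenFunction U g) (hU : IsOpen U)
    (hζ₀ : ζ₀ ∈ chartImage e U) (a : ℂ) {η : ℂ} (hη : η ∈ chartImage e U) :
    DifferentiableAt ℂ (wirtinger fun z => (greenRegDir g e ζ₀ a z : ℂ)) η := by
  have h := hg.contDiffAt_greenReg hU hη hζ₀ 3
  have h2 : ContDiffAt ℝ 2 (fun z => (greenRegDir g e ζ₀ a z : ℂ)) η :=
    Complex.ofRealCLM.contDiff.contDiffAt.comp η (contDiffAt_greenRegDir hg hU hζ₀ a hη)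
  refine differentiableAt_of_wirtingerBar_eq_zero
    ((ContDiffAt.wirtinger (m := 1) h2 (by norm_num)).differentiableAt one_ne_zero) ?_
  have h1 : (wirtinger fun z => (greenRegDir g e ζ₀ a z : ℂ)) =ᶠ[𝓝 η] _ :=
    wirtinger_ofReal_fderiv (F := fun p : ℂ × ℂ => greenReg g e p.1 p.2) (h.of_le (by norm_num)) a
  rw [wirtingerBar_congr h1]
  refine wirtingerBar_wirtinger_fderiv (F := fun p : ℂ × ℂ => (greenReg g e p.1 p.2 : ℂ))
    (contDiffAt_ofReal_comp h) ?_ a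
  filter_upwards [prod_mem_nhds ((isOpen_chartImage e hU).mem_nhds hη)
    ((isOpen_chartImage e hU).mem_nhds hζ₀)] with p hp
  exact wirtinger_harmonic_holomorphic (hg.harmonicAt_greenReg hp.1 hp.2)

/-- For `x` off a disc around ζ₀ the function `g x` is nonnegative and harmonic in the pole on that
disc. Its gradient at ζ₀ is thus at most a constant times `g x` at ζ₀, with a constant independent
of `x`, and that value is small off a compact set. -/
theorem exists_compact_greenDir (hg : IsGreenFunction U g) (hU : IsOpen U)
    (hζ₀ : ζ₀ ∈ chartImage e U) (a : ℂ) {ε : ℝ} (hε : 0 < ε) :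
    ∃ K ⊆ U, IsCompact K ∧ ∀ x ∈ U, x ∉ K → |greenDir g e ζ₀ a x| < ε := by
  obtain ⟨ρ, hρ, hB⟩ := Metric.isOpen_iff.1 (isOpen_chartImage e hU) ζ₀ hζ₀
  -- The gradient constant for the radius `ρ / 2` is `4 / (ρ / 2)`; the summand 1 keeps the divisor
  -- positive when `a = 0`.
  have hε' : 0 < ε / (4 / (ρ / 2) * (‖a‖ + 1)) := by positivity
  obtain ⟨K, hKU, hK, hζK, hsmall⟩ := hg.exists_compact hU hζ₀.2 hε'
  have hr : ρ / 2 < ρ := half_lt_self hρ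
  refine ⟨K ∪ disc e ζ₀ (ρ / 2), union_subset hKU (disc_subset hr hB),
    hK.union (isCompact_disc hr hB), fun x hx hxK => ?_⟩
  rw [mem_union, not_or] at hxK
  have hne : ∀ ζ ∈ ball ζ₀ (ρ / 2), e.1.symm ζ ≠ x := fun ζ hζ h =>
    hxK.2 ⟨ζ, ball_subset_closedBall hζ, h⟩
  have hsub : ∀ ζ ∈ ball ζ₀ (ρ / 2), ζ ∈ chartImage e U := fun ζ hζ =>
    hB (ball_subset_ball hr.le hζ)
  have h1 := norm_fderiv_le_of_nonneg_harmonic (half_pos hρ)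
    (u := fun ζ => g x (e.1.symm ζ)) (c := ζ₀)
    (fun ζ hζ => hg.harmonicAt_right hU hx (hsub ζ hζ) (hne ζ hζ))
    (fun ζ hζ => hg.nonneg hU (hsub ζ hζ).2 hx (hne ζ hζ).symm)
  have h2 := hsmall x hx hxK.1
  have h3 : |greenDir g e ζ₀ a x| ≤ ‖fderiv ℝ (fun ζ => g x (e.1.symm ζ)) ζ₀‖ * ‖a‖ :=
    ContinuousLinearMap.le_opNorm (fderiv ℝ (fun ζ => g x (e.1.symm ζ)) ζ₀) a
  have h4 : g x (e.1.symm ζ₀) < ε / (4 / (ρ / 2) * (‖a‖ + 1)) := (le_abs_self _).trans_lt h2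
  have h5 : 4 / (ρ / 2) * (‖a‖ + 1) * g x (e.1.symm ζ₀) < ε := by
    rw [lt_div_iff₀ (by positivity)] at h4
    linarith
  have h0 : 0 ≤ g x (e.1.symm ζ₀) := hg.nonneg hU hζ₀.2 hx (hne ζ₀ (mem_ball_self (half_pos hρ))).symm
  calc |greenDir g e ζ₀ a x| ≤ 4 / (ρ / 2) * g x (e.1.symm ζ₀) * ‖a‖ := h3.trans (by gcongr)
    _ ≤ 4 / (ρ / 2) * g x (e.1.symm ζ₀) * (‖a‖ + 1) := by gcongr; linarith
    _ = 4 / (ρ / 2) * (‖a‖ + 1) * g x (e.1.symm ζ₀) := by ring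
    _ < ε := h5

end GreenDerivative

/-! ### The kernel form -/

section KernelForm

open Metric InnerProductSpace

/-- The function `Re (a / x)` multiplied by a cutoff which vanishes near the origin. -/
def cutPole (r : ℝ) (a x : ℂ) : ℝ := (1 - cut r x) * (a / x).re

variable {r : ℝ}

theorem cutPole_eventuallyEq_zero (hr : 0 < r) (a : ℂ) : cutPole r a =ᶠ[𝓝 0] fun _ => 0 := by
  filter_upwards [ball_mem_nhds (0 : ℂ) (half_pos hr)] with x hx
  rw [cutPole, cut_eq_one hr (by simpa using (mem_ball_zero_iff.1 hx).le)]
  simp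

theorem hasWirtinger_re_div (a : ℂ) {x : ℂ} (hx : x ≠ 0) :
    HasWirtinger (fun z => ((a / z).re : ℂ)) (-a / (2 * x ^ 2)) (conj (-a / (2 * x ^ 2))) x := by
  have hd : HasDerivAt (fun z : ℂ => a / z) (-a / x ^ 2) x := by
    simpa [div_eq_mul_inv] using (hasDerivAt_inv hx).const_mul a
  have h := (hasWirtinger_of_hasDerivAt hd).add (hasWirtinger_of_hasDerivAt hd).conj
  have h2 := h.const_mul (1 / 2)
  have h3 : (fun z : ℂ => ((a / z).re : ℂ)) = fun z => 1 / 2 * (a / z + conj (a / z)) := by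
    ext z
    rw [Complex.re_eq_add_conj]
    ring
  rw [h3]
  have hc : conj x ≠ 0 := by simpa using hx
  refine h2.congr ?_ ?_
  · simp only [map_zero, add_zero]
    field_simp
  · simp only [zero_add, map_div₀, map_neg, map_mul, map_pow, Complex.conj_ofNat]
    field_simp

theorem contDiff_cutPole (hr : 0 < r) (a : ℂ) : ContDiff ℝ 2 (cutPole r a) := by
  rw [contDiff_iff_contDiffAt]
  intro x
  rcases eq_or_ne x 0 with rfl | hx
  · exact contDiffAt_const.congr_of_eventuallyEq (cutPole_eventuallyEq_zero hr a)
  · refine (contDiffAt_const.sub (contDiff_cut r 2).contDiffAt).mul ?_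
    exact Complex.reCLM.contDiff.contDiffAt.comp x
      (contDiffAt_const.mul (contDiffAt_inv ℝ hx) : ContDiffAt ℝ 2 (fun z : ℂ => a * z⁻¹) x)

/-- In the combination of the directions 1 and i the terms -a/(2x²) cancel, since 1 + i·i = 0, while
Re(1/x) + i Re(i/x) is the inverse of `conj x` and cancels the factor `conj x` in ∂ of the cutoff.
What remains is radial. -/
theorem wirtinger_cutPole (hr : 0 < r) (x : ℂ) :
    wirtinger (fun z => (cutPole r 1 z : ℂ)) x +
      Complex.I * wirtinger (fun z => (cutPole r Complex.I z : ℂ)) x = -cutDeriv r x := by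
  rcases eq_or_ne x 0 with rfl | hx
  · have h : ∀ a, wirtinger (fun z => (cutPole r a z : ℂ)) 0 = 0 := fun a => by
      have h1 : (fun z => (cutPole r a z : ℂ)) =ᶠ[𝓝 0] fun _ => 0 := by
        filter_upwards [cutPole_eventuallyEq_zero hr a] with z hz using by simp [hz]
      rw [wirtinger_congr h1]; simp [wirtinger]
    rw [h, h, cutDeriv_eq_zero' hr (by simpa using (half_pos hr).le)]
    simp
  · have h : ∀ a, wirtinger (fun z => (cutPole r a z : ℂ)) x =
        -(cutDeriv r x * conj x) * ((a / x).re : ℂ) + (1 - cut r x) * (-a / (2 * x ^ 2)) := by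
      intro a
      have h1 := ((hasWirtinger_of_hasDerivAt (hasDerivAt_const x (1 : ℂ))).sub
        (hasWirtinger_cut r x)).mul (hasWirtinger_re_div a hx)
      have h2 : (fun z => (cutPole r a z : ℂ)) = fun z => (1 - (cut r z : ℂ)) * ((a / z).re : ℂ) := by
        ext z; simp [cutPole]
      rw [h2, h1.wirtinger_eq]
      ring
    have hc : conj x ≠ 0 := by simpa using hx
    have hI : Complex.I * Complex.I = -1 := Complex.I_mul_I
    have hre : ((1 / x).re : ℂ) + Complex.I * ((Complex.I / x).re : ℂ) = 1 / conj x := by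
      rw [Complex.re_eq_add_conj, Complex.re_eq_add_conj]
      simp only [map_div₀, map_one, Complex.conj_I]
      field_simp
      linear_combination (conj x - x) * hI
    rw [h, h]
    have h4 : conj x * (1 / conj x) = 1 := mul_one_div_cancel hc
    linear_combination (-(cutDeriv r x : ℂ) * conj x) * hre - (cutDeriv r x : ℂ) * h4 -
      (1 - cut r x : ℂ) / (2 * x ^ 2) * hI

variable {R : Type*} [TopologicalSpace R] [ChartedSpace ℂ R] {U : Set R} {g : R → R → ℝ}

/-- The coefficients of `∂_w ∂̄_z g(w, z)` off the point `z` with coordinate `ζ₀` in the chart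
`e`. -/
def greenKernel (g : R → R → ℝ) (e : atlas ℂ R) (ζ₀ : ℂ) (f : atlas ℂ R) (η : ℂ) : ℂ :=
  (del (greenDir g e ζ₀ 1) f η + Complex.I * del (greenDir g e ζ₀ Complex.I) f η) / 2

/-- The extension of `greenKernel g e ζ₀ e` across `ζ₀`. -/
def greenKernelReg (g : R → R → ℝ) (e : atlas ℂ R) (ζ₀ η : ℂ) : ℂ :=
  (wirtinger (fun z => (greenRegDir g e ζ₀ 1 z : ℂ)) η +
    Complex.I * wirtinger (fun z => (greenRegDir g e ζ₀ Complex.I z : ℂ)) η) / 2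

open Classical in
/-- The form `∂_w ∂̄_z g(w, z)` on `U`. -/
def greenForm (g : R → R → ℝ) (U : Set R) (e : atlas ℂ R) (ζ₀ : ℂ) (f : atlas ℂ R) (η : ℂ) : ℂ :=
  if η ∈ chartImage f U then
    if f.1.symm η = e.1.symm ζ₀ then greenKernelReg g e ζ₀ ζ₀ * deriv (transition f e) η
    else greenKernel g e ζ₀ f η
  else 0

variable {e : atlas ℂ R} {ζ₀ : ℂ}

theorem greenForm_of_ne {f : atlas ℂ R} {η : ℂ} (hη : η ∈ chartImage f U)
    (hne : f.1.symm η ≠ e.1.symm ζ₀) : greenForm g U e ζ₀ f η = greenKernel g e ζ₀ f η := by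
  rw [greenForm, if_pos hη, if_neg hne]

variable [CompactSpace R] [T2Space R] [ConnectedSpace R] [IsManifold 𝓘(ℂ, ℂ) ω R]

/-- The double poles -a/(2(η - ζ₀)²) for a = 1 and a = i cancel in the combination that forms ∂̄ in
the pole. Hence the kernel has no singularity on the diagonal. -/
theorem greenKernel_eq (hg : IsGreenFunction U g) (hU : IsOpen U) (hζ₀ : ζ₀ ∈ chartImage e U)
    {η : ℂ} (hη : η ∈ chartImage e U) (hne : η ≠ ζ₀) :
    greenKernel g e ζ₀ e η = greenKernelReg g e ζ₀ η := by
  have hs : η - ζ₀ ≠ 0 := sub_ne_zero.2 hne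
  have h : ∀ a, del (greenDir g e ζ₀ a) e η =
      wirtinger (fun z => (greenRegDir g e ζ₀ a z : ℂ)) η + -a / (2 * (η - ζ₀) ^ 2) := by
    intro a
    have hd : DifferentiableAt ℝ (fun z => (greenRegDir g e ζ₀ a z : ℂ)) η :=
      Complex.ofRealCLM.differentiableAt.comp η
        ((contDiffAt_greenRegDir hg hU hζ₀ a hη).differentiableAt two_ne_zero)
    have h1 := (hasWirtinger hd).add (HasWirtinger.comp_hasDerivAt (τ := fun z => z - ζ₀)
      (hasWirtinger_re_div a hs) ((hasDerivAt_id η).sub_const ζ₀))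
    have hev : (fun z => (greenDir g e ζ₀ a (e.1.symm z) : ℂ)) =ᶠ[𝓝 η]
        fun z => (greenRegDir g e ζ₀ a z : ℂ) + ((a / (z - ζ₀)).re : ℂ) := by
      filter_upwards [(isOpen_chartImage e hU).mem_nhds hη, isOpen_ne.mem_nhds hne] with z hz hzne
      rw [greenDir_symm hg hU hζ₀ a hz hzne, Complex.ofReal_add]
    rw [del, wirtinger_congr hev, h1.wirtinger_eq, mul_one]
  rw [greenKernel, greenKernelReg, h, h]
  generalize η - ζ₀ = d
  linear_combination (-1 / (4 * d ^ 2)) * Complex.I_mul_I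

theorem isSmoothForm_greenKernel (hg : IsGreenFunction U g) (hU : IsOpen U)
    (hζ₀ : ζ₀ ∈ chartImage e U) (a : ℂ) :
    IsSmoothForm (U \ {e.1.symm ζ₀}) (del (greenDir g e ζ₀ a)) :=
  isSmoothForm_del (hU.sdiff isClosed_singleton) fun _ hx => smoothAt_greenDir hg hU hζ₀ a hx.1 hx.2

theorem greenKernel_transform (hg : IsGreenFunction U g) (hU : IsOpen U)
    (hζ₀ : ζ₀ ∈ chartImage e U) {f f' : atlas ℂ R} {η : ℂ} (hη : η ∈ chartImage f U)
    (hne : f.1.symm η ≠ e.1.symm ζ₀) (hf : f.1.symm η ∈ f'.1.source) :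
    greenKernel g e ζ₀ f η =
      greenKernel g e ζ₀ f' (transition f f' η) * deriv (transition f f') η := by
  have hη' : η ∈ chartImage f (U \ {e.1.symm ζ₀}) := ⟨hη.1, hη.2, hne⟩
  rw [greenKernel, greenKernel, (isSmoothForm_greenKernel hg hU hζ₀ 1).transform f f' η hη' hf,
    (isSmoothForm_greenKernel hg hU hζ₀ Complex.I).transform f f' η hη' hf]
  ring

/-- One formula for both cases of the definition, valid wherever the chart `e` reaches; holomorphy
and the transformation law at the pole are read off from it. -/
theorem greenForm_eq (hg : IsGreenFunction U g) (hU : IsOpen U) (hζ₀ : ζ₀ ∈ chartImage e U)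
    {f : atlas ℂ R} {η : ℂ} (hη : η ∈ chartImage f U) (hf : f.1.symm η ∈ e.1.source) :
    greenForm g U e ζ₀ f η =
      greenKernelReg g e ζ₀ (transition f e η) * deriv (transition f e) η := by
  by_cases h : f.1.symm η = e.1.symm ζ₀
  · rw [greenForm, if_pos hη, if_pos h, transition, h, e.1.right_inv hζ₀.1]
  · rw [greenForm_of_ne hη h, greenKernel_transform hg hU hζ₀ hη h hf,
      greenKernel_eq hg hU hζ₀ (transition_mem hη hf)]
    rintro h'
    rw [← symm_transition hf, h'] at h
    exact h rfl

theorem greenForm_transform (hg : IsGreenFunction U g) (hU : IsOpen U)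
    (hζ₀ : ζ₀ ∈ chartImage e U) (f f' : atlas ℂ R) (η : ℂ) (hη : η ∈ chartImage f U)
    (hf : f.1.symm η ∈ f'.1.source) :
    greenForm g U e ζ₀ f η =
      greenForm g U e ζ₀ f' (transition f f' η) * deriv (transition f f') η := by
  have hη' := transition_mem hη hf
  by_cases h : f.1.symm η = e.1.symm ζ₀
  · have hs : f.1.symm η ∈ e.1.source := h ▸ e.1.map_target hζ₀.1
    have hs' : f'.1.symm (transition f f' η) ∈ e.1.source := by rwa [symm_transition hf]
    rw [greenForm_eq hg hU hζ₀ hη hs, greenForm_eq hg hU hζ₀ hη' hs']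
    have h1 : transition f' e (transition f f' η) = transition f e η := by
      rw [transition, symm_transition hf]; rfl
    have h2 : transition f e =ᶠ[𝓝 η] fun z => transition f' e (transition f f' z) := by
      filter_upwards [(isOpen_chartImage f f'.1.open_source).mem_nhds ⟨hη.1, hf⟩] with z hz
      rw [transition, transition, symm_transition hz.2]
    have h3 := ((analyticAt_transition hη'.1 hs').differentiableAt.hasDerivAt.comp η
      (analyticAt_transition hη.1 hf).differentiableAt.hasDerivAt).deriv
    rw [h1, h2.deriv_eq, mul_assoc]
    exact congrArg _ h3
  · rw [greenForm_of_ne hη h, greenForm_of_ne hη' (by rwa [symm_transition hf]),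
      greenKernel_transform hg hU hζ₀ hη h hf]

/-- At the pole the form is the pullback of the regularised kernel; elsewhere it is a combination of
∂ of functions that are harmonic in η. -/
theorem isHolomorphicForm_greenForm (hg : IsGreenFunction U g) (hU : IsOpen U)
    (hζ₀ : ζ₀ ∈ chartImage e U) : IsHolomorphicForm U (greenForm g U e ζ₀) := by
  refine ⟨fun f η hη => ?_, fun f η hη => if_neg hη, greenForm_transform hg hU hζ₀⟩
  refine DifferentiableAt.differentiableWithinAt ?_
  by_cases h : f.1.symm η = e.1.symm ζ₀
  · have hs : f.1.symm η ∈ e.1.source := h ▸ e.1.map_target hζ₀.1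
    have hτ := analyticAt_transition hη.1 hs
    have hreg : DifferentiableAt ℂ (greenKernelReg g e ζ₀) (transition f e η) :=
      ((wirtinger_greenRegDir_holomorphic hg hU hζ₀ 1 (transition_mem hη hs)).add
        ((wirtinger_greenRegDir_holomorphic hg hU hζ₀ Complex.I
          (transition_mem hη hs)).const_mul Complex.I)).div_const 2
    refine ((hreg.comp η hτ.differentiableAt).mul
      hτ.deriv.differentiableAt).congr_of_eventuallyEq ?_
    filter_upwards [(isOpen_chartImage f hU).mem_nhds hη,
      (isOpen_chartImage f e.1.open_source).mem_nhds ⟨hη.1, hs⟩] with z hz hz'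
    exact greenForm_eq hg hU hζ₀ hz hz'.2
  · have hd : ∀ a, DifferentiableAt ℂ (del (greenDir g e ζ₀ a) f) η := fun a =>
      differentiableAt_of_wirtingerBar_eq_zero
        ((((isSmoothForm_greenKernel hg hU hζ₀ a).smooth f).contDiffAt
          ((isOpen_chartImage f (hU.sdiff isClosed_singleton)).mem_nhds
            ⟨hη.1, hη.2, h⟩)).differentiableAt one_ne_zero) (lap_greenDir hg hU hζ₀ a hη h)
    refine (((hd 1).add ((hd Complex.I).const_mul Complex.I)).div_const 2).congr_of_eventuallyEq ?_
    filter_upwards [(isOpen_chartImage f hU).mem_nhds hη,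
      (continuousAt_symm hη.1).eventually (isOpen_ne.mem_nhds h)] with z hz hzne
    exact greenForm_of_ne hz hzne

end KernelForm

/-! ### The reproducing property -/

section Reproducing

open Metric InnerProductSpace

variable {R : Type*} [TopologicalSpace R] [ChartedSpace ℂ R] {U : Set R} {g : R → R → ℝ}

/-- The derivative of the Green's function in the pole with its singularity smoothed out. -/
def greenDirPatch (g : R → R → ℝ) (e : atlas ℂ R) (ζ₀ : ℂ) (r : ℝ) (a : ℂ) : R → ℝ :=
  patch e ζ₀ r (fun η => greenRegDir g e ζ₀ a η + cutPole r a (η - ζ₀)) (greenDir g e ζ₀ a)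

/-- The exact form which differs from `greenForm` by a form supported in a coordinate disc. -/
def smoothForm (g : R → R → ℝ) (e : atlas ℂ R) (ζ₀ : ℂ) (r : ℝ) (f : atlas ℂ R) (η : ℂ) : ℂ :=
  (del (greenDirPatch g e ζ₀ r 1) f η + Complex.I * del (greenDirPatch g e ζ₀ r Complex.I) f η) / 2

variable {e : atlas ℂ R} {ζ₀ : ℂ} {r R' : ℝ}

theorem smoothForm_eq_of_notMem [T2Space R] (hr0 : 0 < r) (hr : r < R') (hB : ball ζ₀ R' ⊆ chartImage e U)
    {f : atlas ℂ R} {η : ℂ} (hη : η ∈ chartImage f U) (hd : f.1.symm η ∉ disc e ζ₀ r) :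
    smoothForm g e ζ₀ r f η = greenForm g U e ζ₀ f η := by
  have hne : f.1.symm η ≠ e.1.symm ζ₀ := fun h => hd (h ▸ symm_mem_disc_self hr0)
  rw [greenForm_of_ne hη hne, smoothForm, greenKernel, greenDirPatch, (del_patch_of_notMem hr hB hη.1 hd).eq_of_nhds, greenDirPatch,
    (del_patch_of_notMem hr hB hη.1 hd).eq_of_nhds]

variable [CompactSpace R] [T2Space R] [ConnectedSpace R] [IsManifold 𝓘(ℂ, ℂ) ω R]

theorem greenDirPatch_compatible (hg : IsGreenFunction U g) (hU : IsOpen U) (hr0 : 0 < r)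
    (hr : r < R') (hB : ball ζ₀ R' ⊆ chartImage e U) (a : ℂ) :
    ∀ η ∈ ball ζ₀ R', r < ‖η - ζ₀‖ →
      greenRegDir g e ζ₀ a η + cutPole r a (η - ζ₀) = greenDir g e ζ₀ a (e.1.symm η) := by
  intro η hη h
  have hne : η ≠ ζ₀ := by
    rintro rfl
    simp only [sub_self, norm_zero] at h
    exact h.not_gt hr0
  rw [greenDir_symm hg hU (hB (mem_ball_self (hr0.trans hr))) a (hB hη) hne, cutPole,
    cut_eq_zero hr0 h.le, sub_zero, one_mul]

theorem vanishesAtBoundary_greenDirPatch (hg : IsGreenFunction U g) (hU : IsOpen U) (hr0 : 0 < r)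
    (hr : r < R') (hB : ball ζ₀ R' ⊆ chartImage e U) (a : ℂ) :
    VanishesAtBoundary U (greenDirPatch g e ζ₀ r a) := by
  have hζ₀ : ζ₀ ∈ chartImage e U := hB (mem_ball_self (hr0.trans hr))
  have hne : ∀ x, x ∉ disc e ζ₀ r → x ≠ e.1.symm ζ₀ := fun x hx h =>
    hx (h ▸ symm_mem_disc_self hr0)
  exact vanishesAtBoundary_patch hr hB (greenDirPatch_compatible hg hU hr0 hr hB a)
    (fun η hη => (contDiffAt_greenRegDir hg hU hζ₀ a (hB hη)).add
      ((contDiff_cutPole hr0 a).comp (contDiff_id.sub contDiff_const)).contDiffAt)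
    (fun x hx hd => smoothAt_greenDir hg hU hζ₀ a hx (hne x hd))
    (fun f η hη hd => lap_greenDir hg hU hζ₀ a hη (hne _ hd))
    fun ε hε => exists_compact_greenDir hg hU hζ₀ a hε

/-- The regular parts give the regularised kernel, and the two cut-off poles combine to a radial
term by `wirtinger_cutPole`. -/
theorem smoothForm_eq_of_mem_ball (hg : IsGreenFunction U g) (hU : IsOpen U) (hr0 : 0 < r)
    (hr : r < R') (hB : ball ζ₀ R' ⊆ chartImage e U) {η : ℂ} (hη : η ∈ ball ζ₀ R') :
    smoothForm g e ζ₀ r e η = greenKernelReg g e ζ₀ η - (1 / 2) * cutDeriv r (η - ζ₀) := by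
  have hζ₀ : ζ₀ ∈ chartImage e U := hB (mem_ball_self (hr0.trans hr))
  have h : ∀ a, del (greenDirPatch g e ζ₀ r a) e η =
      wirtinger (fun z => (greenRegDir g e ζ₀ a z : ℂ)) η +
        wirtinger (fun z => (cutPole r a z : ℂ)) (η - ζ₀) := by
    intro a
    have hd : DifferentiableAt ℝ (fun z => (greenRegDir g e ζ₀ a z : ℂ)) η :=
      Complex.ofRealCLM.differentiableAt.comp η
        ((contDiffAt_greenRegDir hg hU hζ₀ a (hB hη)).differentiableAt two_ne_zero)
    have hd' : DifferentiableAt ℝ (fun z => (cutPole r a z : ℂ)) (η - ζ₀) :=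
      Complex.ofRealCLM.differentiableAt.comp (η - ζ₀)
        ((contDiff_cutPole hr0 a).contDiffAt.differentiableAt two_ne_zero)
    have h1 := (hasWirtinger hd).add (HasWirtinger.comp_hasDerivAt (τ := fun z => z - ζ₀)
      (hasWirtinger hd') ((hasDerivAt_id η).sub_const ζ₀))
    rw [greenDirPatch, (del_patch_of_mem_ball hr hB
      (greenDirPatch_compatible hg hU hr0 hr hB a) hη).eq_of_nhds]
    simp only [Complex.ofReal_add]
    rw [h1.wirtinger_eq, mul_one]
  rw [smoothForm, greenKernelReg, h, h]
  linear_combination (1 / 2) * wirtinger_cutPole hr0 (η - ζ₀)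

theorem isSmoothForm_smoothForm (hg : IsGreenFunction U g) (hU : IsOpen U) (hr0 : 0 < r)
    (hr : r < R') (hB : ball ζ₀ R' ⊆ chartImage e U) : IsSmoothForm U (smoothForm g e ζ₀ r) := by
  have h := fun a => isSmoothForm_del hU (vanishesAtBoundary_greenDirPatch hg hU hr0 hr hB a).smooth
  refine ⟨fun f => (((h 1).smooth f).add (contDiffOn_const.mul ((h Complex.I).smooth f))).div_const 2,
    fun f f' η hη hf => ?_⟩
  rw [smoothForm, smoothForm, (h 1).transform f f' η hη hf, (h Complex.I).transform f f' η hη hf]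
  ring

theorem memLp_smoothForm (hg : IsGreenFunction U g) (hU : IsOpen U) (hr0 : 0 < r)
    (hr : r < R') (hB : ball ζ₀ R' ⊆ chartImage e U) (i : Fin (coverCard R)) :
    MemLp (smoothForm g e ζ₀ r (coverChart R i)) 2 (volume.restrict (cell U i)) := by
  have h := fun a => memLp_del hU (vanishesAtBoundary_greenDirPatch hg hU hr0 hr hB a) i
  have h1 := ((h 1).add ((h Complex.I).const_mul Complex.I)).mul_const (2⁻¹ : ℂ)
  simp only [← div_eq_mul_inv] at h1
  exact h1

/-- The part of `greenForm` which is not exact. -/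
def greenDefect (g : R → R → ℝ) (U : Set R) (e : atlas ℂ R) (ζ₀ : ℂ) (r : ℝ) (f : atlas ℂ R)
    (η : ℂ) : ℂ := greenForm g U e ζ₀ f η - smoothForm g e ζ₀ r f η

theorem greenDefect_transform (hg : IsGreenFunction U g) (hU : IsOpen U) (hr0 : 0 < r)
    (hr : r < R') (hB : ball ζ₀ R' ⊆ chartImage e U) (f f' : atlas ℂ R) (η : ℂ)
    (hη : η ∈ chartImage f U) (hf : f.1.symm η ∈ f'.1.source) :
    greenDefect g U e ζ₀ r f η =
      greenDefect g U e ζ₀ r f' (transition f f' η) * deriv (transition f f') η := by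
  rw [greenDefect, greenDefect, (isSmoothForm_smoothForm hg hU hr0 hr hB).transform f f' η hη hf,
    greenForm_transform hg hU (hB (mem_ball_self (hr0.trans hr))) f f' η hη hf]
  ring

theorem greenDefect_eq_of_mem_ball (hg : IsGreenFunction U g) (hU : IsOpen U) (hr0 : 0 < r)
    (hr : r < R') (hB : ball ζ₀ R' ⊆ chartImage e U) {η : ℂ} (hη : η ∈ ball ζ₀ R') :
    greenDefect g U e ζ₀ r e η = (1 / 2) * cutDeriv r (η - ζ₀) := by
  have hs : e.1.symm η ∈ e.1.source := e.1.map_target (hB hη).1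
  have h1 : transition e e =ᶠ[𝓝 η] id := by
    filter_upwards [isOpen_ball.mem_nhds hη] with z hz using e.1.right_inv (hB hz).1
  rw [greenDefect, smoothForm_eq_of_mem_ball hg hU hr0 hr hB hη,
    greenForm_eq hg hU (hB (mem_ball_self (hr0.trans hr))) (hB hη) hs, h1.deriv_eq, h1.eq_of_nhds]
  simp

theorem greenDefect_eq_zero (hr0 : 0 < r) (hr : r < R') (hB : ball ζ₀ R' ⊆ chartImage e U)
    (f : atlas ℂ R) (η : ℂ) (hη : η ∈ chartImage f U) (hd : f.1.symm η ∉ disc e ζ₀ r) :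
    greenDefect g U e ζ₀ r f η = 0 := by
  rw [greenDefect, smoothForm_eq_of_notMem hr0 hr hB hη hd, sub_self]

theorem continuousOn_greenDefect (hg : IsGreenFunction U g) (hU : IsOpen U) (hr0 : 0 < r)
    (hr : r < R') (hB : ball ζ₀ R' ⊆ chartImage e U) (f : atlas ℂ R) :
    ContinuousOn (greenDefect g U e ζ₀ r f) (chartImage f U) :=
  ((isHolomorphicForm_greenForm hg hU (hB (mem_ball_self (hr0.trans hr)))).holomorphic
    f).continuousOn.sub ((isSmoothForm_smoothForm hg hU hr0 hr hB).smooth f).continuousOn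

theorem memLp_greenDefect (hg : IsGreenFunction U g) (hU : IsOpen U) (hr0 : 0 < r)
    (hr : r < R') (hB : ball ζ₀ R' ⊆ chartImage e U) (i : Fin (coverCard R)) :
    MemLp (greenDefect g U e ζ₀ r (coverChart R i)) 2 (volume.restrict (cell U i)) := by
  have ht := greenDefect_transform hg hU hr0 hr hB
  have hc := (continuousOn_greenDefect hg hU hr0 hr hB e).mono hB
  have h1 := (surfaceIntegral_eq_integral_ball hU hr hB (isTwoForm_conj_mul ht ht)
    (Continuous.comp_continuousOn Complex.continuous_conj hc |>.mul hc)
    fun f η hη hd => by rw [greenDefect_eq_zero hr0 hr hB f η hη hd, mul_zero]).1 i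
  have hm : AEStronglyMeasurable (greenDefect g U e ζ₀ r (coverChart R i))
      (volume.restrict (cell U i)) :=
    ((continuousOn_greenDefect hg hU hr0 hr hB _).mono fun ζ hζ => hζ.1).aestronglyMeasurable
      (measurableSet_cell hU i)
  rw [memLp_two_iff_integrable_sq_norm hm]
  refine h1.norm.congr (ae_of_all _ fun ζ => ?_)
  simp only [norm_mul, RCLike.norm_conj]
  ring

/-- The form splits into a combination of ∂u_a, where u_a has finite Dirichlet integral, and a
continuous form supported in a compact disc. -/
theorem memLp_greenForm (hg : IsGreenFunction U g) (hU : IsOpen U)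
    (hζ₀ : ζ₀ ∈ chartImage e U) (i : Fin (coverCard R)) :
    MemLp (greenForm g U e ζ₀ (coverChart R i)) 2 (volume.restrict (cell U i)) := by
  obtain ⟨ρ, hρ, hB⟩ := Metric.isOpen_iff.1 (isOpen_chartImage e hU) ζ₀ hζ₀
  have h := (memLp_greenDefect hg hU (half_pos hρ) (half_lt_self hρ) hB i).add
    (memLp_smoothForm hg hU (half_pos hρ) (half_lt_self hρ) hB i)
  convert h using 1
  ext η
  simp [greenDefect]

/-- The form `greenForm` represents the evaluation of forms in the Bergman space. -/
theorem surfaceIntegral_conj_greenForm_mul (hg : IsGreenFunction U g) (hU : IsOpen U)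
    (hζ₀ : ζ₀ ∈ chartImage e U) {b : atlas ℂ R → ℂ → ℂ} (hb : IsHolomorphicForm U b)
    (hb2 : ∀ i, MemLp (b (coverChart R i)) 2 (volume.restrict (cell U i))) :
    surfaceIntegral U (fun f η => conj (greenForm g U e ζ₀ f η) * b f η) =
      -(Real.pi / 2) * b e ζ₀ := by
  obtain ⟨ρ, hρ, hB⟩ := Metric.isOpen_iff.1 (isOpen_chartImage e hU) ζ₀ hζ₀
  have hr0 := half_pos hρ
  have hr := half_lt_self hρ
  set r := ρ / 2 with hrdef
  have hv := vanishesAtBoundary_greenDirPatch hg hU hr0 hr hB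
  have hb0 : ∀ e, ∀ ζ ∈ chartImage e U, wirtingerBar (b e) ζ = 0 := fun e ζ hζ =>
    wirtingerBar_eq_zero_of_differentiableAt
      ((hb.holomorphic e).differentiableAt ((isOpen_chartImage e hU).mem_nhds hζ))
  -- A holomorphic form has ∂̄b = 0, so in Stokes' theorem only the pairing with ∂ of the smoothed
  -- function survives, and it is zero.
  have hst : ∀ a, surfaceIntegral U
      (fun f η => conj (del (greenDirPatch g e ζ₀ r a) f η) * b f η) = 0 := by
    intro a
    have h1 := stokes_of_vanishesAtBoundary hU (hv a) (hb.isSmoothForm hU) hb2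
      ⟨∅, empty_subset _, isCompact_empty, fun e ζ hζ _ => hb0 e ζ hζ⟩
    have h2 : surfaceIntegral U (fun f η => (greenDirPatch g e ζ₀ r a (f.1.symm η) : ℂ) *
        wirtingerBar (b f) η) = 0 := by
      rw [surfaceIntegral_congr hU (G := fun _ _ => 0) fun f η hη => by rw [hb0 f η hη, mul_zero]]
      simp [surfaceIntegral]
    rwa [h2, add_zero] at h1
  have hi : ∀ a, SurfaceIntegrable U
      (fun f η => conj (del (greenDirPatch g e ζ₀ r a) f η) * b f η) := fun a =>
    integrable_conj_mul hb2 (memLp_del hU (hv a))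
  have hW : surfaceIntegral U (fun f η => conj (smoothForm g e ζ₀ r f η) * b f η) = 0 := by
    have h1 : (fun (f : atlas ℂ R) η => conj (smoothForm g e ζ₀ r f η) * b f η) = fun f η =>
        (1 / 2) * (conj (del (greenDirPatch g e ζ₀ r 1) f η) * b f η) +
          (-Complex.I / 2) * (conj (del (greenDirPatch g e ζ₀ r Complex.I) f η) * b f η) := by
      ext f η
      simp only [smoothForm, map_div₀, map_add, map_mul, Complex.conj_I, Complex.conj_ofNat]
      ring
    have h2 : ∀ c a, SurfaceIntegrable U
        (fun f η => c * (conj (del (greenDirPatch g e ζ₀ r a) f η) * b f η)) := fun c a i =>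
      (hi a i).const_mul c
    rw [h1, surfaceIntegral_add (h2 _ _) (h2 _ _), surfaceIntegral_const_mul,
      surfaceIntegral_const_mul, hst, hst]
    simp
  have hD : surfaceIntegral U (fun f η => conj (greenDefect g U e ζ₀ r f η) * b f η) =
      -(Real.pi / 2) * b e ζ₀ := by
    rw [(surfaceIntegral_eq_integral_ball hU hr hB (isTwoForm_conj_mul hb.transform
      (greenDefect_transform hg hU hr0 hr hB))
      ((Continuous.comp_continuousOn Complex.continuous_conj
        ((continuousOn_greenDefect hg hU hr0 hr hB e).mono hB)).mul
          ((hb.holomorphic e).continuousOn.mono hB))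
      fun f η hη hd => by rw [greenDefect_eq_zero hr0 hr hB f η hη hd, map_zero, zero_mul]).2]
    have hbh : HarmonicOnNhd (b e) (ball ζ₀ ρ) := fun ζ hζ =>
      (((hb.holomorphic e).mono hB).analyticAt (isOpen_ball.mem_nhds hζ)).harmonicAt
    -- The defect is a radial weight of total mass -π/2 around ζ₀; the mean value property of the
    -- holomorphic coefficient gives the value at ζ₀.
    obtain ⟨s, hs, hs'⟩ := exists_between hr
    have h1 := integral_radial_mul_harmonic (φ := fun x => (1 / 2 : ℂ) * cutDeriv r x) hs'
      (continuous_const.mul (Complex.continuous_ofReal.comp (continuous_cutDeriv r)))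
      (fun x hx => by rw [cutDeriv_eq_zero hr0 (hs.trans_le hx)]; simp)
      (fun v x hv => by
        rw [cutDeriv, cutDeriv, map_mul, Complex.normSq_eq_norm_sq v, hv, one_pow, one_mul]) hbh
    rw [integral_const_mul, integral_complex_ofReal, integral_cutDeriv hr0] at h1
    have h2 : ∀ ζ, ζ ∉ ball ζ₀ ρ → (1 / 2 : ℂ) * cutDeriv r (ζ - ζ₀) * b e ζ = 0 := by
      intro ζ hζ
      rw [mem_ball, dist_eq_norm, not_lt] at hζ
      rw [cutDeriv_eq_zero hr0 (hr.trans_le hζ)]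
      simp
    rw [show (-((Real.pi : ℂ) / 2) * b e ζ₀) = 1 / 2 * ((-Real.pi : ℝ) : ℂ) * b e ζ₀ by
      push_cast; ring, ← h1, ← setIntegral_eq_integral_of_forall_compl_eq_zero h2]
    refine setIntegral_congr_fun isOpen_ball.measurableSet fun ζ hζ => ?_
    simp only [greenDefect_eq_of_mem_ball hg hU hr0 hr hB hζ, map_mul, map_div₀, map_one,
      Complex.conj_ofNat, Complex.conj_ofReal]
  have hsum : (fun (f : atlas ℂ R) η => conj (greenForm g U e ζ₀ f η) * b f η) = fun f η =>
      conj (smoothForm g e ζ₀ r f η) * b f η + conj (greenDefect g U e ζ₀ r f η) * b f η := by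
    ext f η
    simp only [greenDefect, map_sub]
    ring
  rw [hsum, surfaceIntegral_add (integrable_conj_mul hb2 (memLp_smoothForm hg hU hr0 hr hB))
    (integrable_conj_mul hb2 (memLp_greenDefect hg hU hr0 hr hB)), hW, hD, zero_add]

end Reproducing

/-! ### The Schiffer operator as an adjoint -/

section Adjoint

open TopologicalSpace (Opens)

variable {R : Type*} [TopologicalSpace R] [ChartedSpace ℂ R] [CompactSpace R] [T2Space R]
  [ConnectedSpace R] [IsManifold 𝓘(ℂ, ℂ) ω R] {g : R → R → ℝ} {e : atlas ℂ R} {ζ₀ : ℂ}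

theorem greenKernel_eq_wirtingerBar {U : Set R} (hg : IsGreenFunction U g) (hU : IsOpen U)
    (hζ₀ : ζ₀ ∈ chartImage e U) {f : atlas ℂ R} {η : ℂ} (hη : η ∈ chartImage f U)
    (hne : f.1.symm η ≠ e.1.symm ζ₀) : greenKernel g e ζ₀ f η = wirtingerBar
      (fun ζ => wirtinger (fun z => (g (f.1.symm z) (e.1.symm ζ) : ℂ)) η) ζ₀ := by
  have h := hg.contDiffAt hU hη hζ₀ hne 2
  have h1 : ∀ a, del (greenDir g e ζ₀ a) f η =
      fderiv ℝ (fun ζ => wirtinger (fun z => (g (f.1.symm z) (e.1.symm ζ) : ℂ)) η) ζ₀ a := by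
    intro a
    have h2 : del (greenDir g e ζ₀ a) f =ᶠ[𝓝 η] _ :=
      wirtinger_ofReal_fderiv (h.of_le (by norm_num)) a
    rw [h2.eq_of_nhds]
    exact wirtinger_fderiv (contDiffAt_ofReal_comp h) a
  rw [greenKernel, h1, h1, wirtingerBar]

/-- As `g` is real, ∂_z ∂̄_w g is the conjugate of ∂̄_z ∂_w g. -/
theorem bergmanKernel_eq {U : Set R} (hg : IsGreenFunction U g) (hU : IsOpen U)
    (hζ₀ : ζ₀ ∈ chartImage e U) {f : atlas ℂ R} {η : ℂ} (hη : η ∈ chartImage f U)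
    (hne : f.1.symm η ≠ e.1.symm ζ₀) : bergmanKernel g e f ζ₀ η =
      -(1 / ((Real.pi : ℂ) * Complex.I)) * conj (greenKernel g e ζ₀ f η) := by
  have h := hg.contDiffAt hU hη hζ₀ hne 2
  have hev : (fun ζ => wirtingerBar (fun z => (g (f.1.symm z) (e.1.symm ζ) : ℂ)) η) =ᶠ[𝓝 ζ₀]
      fun ζ => conj (wirtinger (fun z => (g (f.1.symm z) (e.1.symm ζ) : ℂ)) η) := by
    filter_upwards [(Continuous.tendsto (f := fun ζ : ℂ => (η, ζ)) (by fun_prop) ζ₀).eventually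
      (h.eventually (by simp))] with ζ hζ
    exact wirtingerBar_ofReal ((ContDiffAt.slice_left hζ).differentiableAt two_ne_zero)
  have hd : DifferentiableAt ℝ
      (fun ζ => wirtinger (fun z => (g (f.1.symm z) (e.1.symm ζ) : ℂ)) η) ζ₀ :=
    (ContDiffAt.slice_right (ContDiffAt.wirtinger_left (m := 1) (contDiffAt_ofReal_comp h)
      (by norm_num) (by norm_num))).differentiableAt one_ne_zero
  rw [bergmanKernel, wirtinger_congr hev, (hasWirtinger hd).conj.wirtinger_eq,
    greenKernel_eq_wirtingerBar hg hU hζ₀ hη hne]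

variable {S S' : Opens R}

/-- The element of the Bergman space given by `greenForm`. -/
def greenElement (hg : IsGreenFunction (S' : Set R) g) (hζ₀ : ζ₀ ∈ chartImage e (S' : Set R)) :
    Bergman S' :=
  (⟨greenForm g S' e ζ₀, isHolomorphicForm_greenForm hg S'.isOpen hζ₀,
    memLp_greenForm hg S'.isOpen hζ₀⟩ : bergmanSubmodule S')

theorem inner_greenElement (hg : IsGreenFunction (S' : Set R) g)
    (hζ₀ : ζ₀ ∈ chartImage e (S' : Set R)) (β : Bergman S') :
    inner ℂ (greenElement hg hζ₀) β = -(Real.pi / 2) * β.coeff e ζ₀ := by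
  rw [Bergman.inner_def, pairing,
    ← surfaceIntegral_conj_greenForm_mul hg S'.isOpen hζ₀ β.isHolomorphicForm β.memLp]
  simp only [mul_comm (β.coeff _ _)]
  rfl

/-- The constant is -(1/(πi)) · 2i = -2/π. Equality holds only almost everywhere, because at the
point w = z the kernel is computed from the arbitrary diagonal values of `g`, while `greenForm` is
extended holomorphically. -/
theorem schifferIntegrand_ae_eq (hg : IsGreenFunction (S' : Set R) g)
    (hζ₀ : ζ₀ ∈ chartImage e (S' : Set R)) (hSS' : S ≤ S') (α : Bergman S)
    (i : Fin (coverCard R)) :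
    schifferIntegrand g α.coeff e ζ₀ (coverChart R i) =ᵐ[volume.restrict (cell (S : Set R) i)]
      fun η => -(2 / Real.pi) * (α.coeff (coverChart R i) η *
        conj ((Bergman.restrict hSS' (greenElement hg hζ₀)).coeff (coverChart R i) η)) := by
  have hnull : ∀ᵐ η : ℂ, η ≠ (coverChart R i).1 (e.1.symm ζ₀) := by simp [ae_iff]
  filter_upwards [ae_restrict_of_ae hnull, ae_restrict_mem (measurableSet_cell S.isOpen i)]
    with η hη hmem
  have hηS := hmem.1
  have hηS' : η ∈ chartImage (coverChart R i) (S' : Set R) := chartImage_mono _ hSS' hηS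
  have hne : (coverChart R i).1.symm η ≠ e.1.symm ζ₀ := fun h => hη (by
    rw [← h, (coverChart R i).1.right_inv hηS.1])
  rw [Bergman.restrict_coeff hSS' _ _ hηS, schifferIntegrand,
    bergmanKernel_eq hg S'.isOpen hζ₀ hηS' hne, ← greenForm_of_ne hηS' hne]
  have hpi : (Real.pi : ℂ) ≠ 0 := by exact_mod_cast Real.pi_ne_zero
  change _ = -(2 / Real.pi) * (α.coeff (coverChart R i) η *
    conj (greenForm g S' e ζ₀ (coverChart R i) η))
  field_simp

theorem surfaceIntegrable_schifferIntegrand (hg : IsGreenFunction (S' : Set R) g)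
    (hζ₀ : ζ₀ ∈ chartImage e (S' : Set R)) (hSS' : S ≤ S') (α : Bergman S) :
    SurfaceIntegrable (S : Set R) (schifferIntegrand g α.coeff e ζ₀) := fun i =>
  ((Bergman.integrable_mul_conj α _ i).const_mul _).congr
    (schifferIntegrand_ae_eq hg hζ₀ hSS' α i).symm

theorem surfaceIntegral_schifferIntegrand (hg : IsGreenFunction (S' : Set R) g)
    (hζ₀ : ζ₀ ∈ chartImage e (S' : Set R)) (hSS' : S ≤ S') (α : Bergman S) :
    surfaceIntegral (S : Set R) (schifferIntegrand g α.coeff e ζ₀) =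
      -(2 / Real.pi) * inner ℂ (Bergman.restrict hSS' (greenElement hg hζ₀)) α := by
  rw [Bergman.inner_def, pairing, ← surfaceIntegral_const_mul]
  exact Finset.sum_congr rfl fun i _ => integral_congr_ae (schifferIntegrand_ae_eq hg hζ₀ hSS' α i)

/-- The coefficient at ζ is -2/π times the pairing of α with the restricted kernel form. Moving the
restriction to the other side as its adjoint makes this a pairing on `S'`, which the reproducing
property evaluates; the factors -2/π and -π/2 cancel. -/
theorem schiffer_eq_adjoint (hg : IsGreenFunction (S' : Set R) g) (hSS' : S ≤ S')
    (α : Bergman S) : schiffer g S S' α =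
      (ContinuousLinearMap.adjoint (Bergman.restrict hSS') α).coeff := by
  ext e ζ
  rw [schiffer]
  split_ifs with hζ
  · rw [surfaceIntegral_schifferIntegrand hg hζ hSS' α, ← ContinuousLinearMap.adjoint_inner_right,
      inner_greenElement]
    have hpi : (Real.pi : ℂ) ≠ 0 := by exact_mod_cast Real.pi_ne_zero
    field_simp
  · exact ((Bergman.isHolomorphicForm _).zero_off e ζ hζ).symm

end Adjoint

end Schiffer

end

/-! ### The adjoint theorem -/

theorem mainTheorem8 {R : Type*} [TopologicalSpace R] [T2Space R] [CompactSpace R]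
    [ConnectedSpace R] [ChartedSpace ℂ R] [IsManifold 𝓘(ℂ, ℂ) ω R]
    (S S' : TopologicalSpace.Opens R) (hSS' : S ≤ S') (hcl : closure (S : Set R) ⊆ S')
    (hconn : IsConnected (S' : Set R)) (hproper : (S' : Set R) ≠ Set.univ)
    (g : R → R → ℝ) (hg : Schiffer.IsGreenFunction (S' : Set R) g)
    (hhyp : ∃ ρ : atlas ℂ R → ℂ → ℝ, Schiffer.IsHyperbolicMetric (S' : Set R) ρ) :
    ∃ (_ : CompleteSpace (Schiffer.Bergman S)) (_ : CompleteSpace (Schiffer.Bergman S')),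
      ∀ α : Schiffer.Bergman S,
        (∀ e : atlas ℂ R, ∀ ζ ∈ Schiffer.chartImage e (S' : Set R),
          Schiffer.SurfaceIntegrable (S : Set R)
            (Schiffer.schifferIntegrand g α.coeff e ζ)) ∧
        Schiffer.schiffer g S S' α =
          (ContinuousLinearMap.adjoint (Schiffer.Bergman.restrict hSS') α).coeff := by
  exact ⟨inferInstance, inferInstance, fun α =>
    ⟨fun e ζ hζ => Schiffer.surfaceIntegrable_schifferIntegrand hg hζ hSS' α,
      Schiffer.schiffer_eq_adjoint hg hSS' α⟩⟩
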